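/- Let $p$ be a prime, $N\ge 0$, $\Gamma=\mathbb{Z}^N$, $R=\mathbb{Z}\Gamma$, and let $c_0(\Gamma)$ be the $\mathbb{Q}_p$-Banach algebra of formal sums $\sum_{\gamma}x_\gamma\gamma$ with $x_\gamma\in\mathbb{Q}_p$ and $|x_\gamma|\to 0$ as $\gamma\to\infty$, with the convolution product and the norm $\|x\|=\max_\gamma|x_\gamma|$. Let $K_T(c_0(\Gamma))=K_1(c_0(\Gamma))/\langle\pm\Gamma\rangle$ and let $\log_p\det_\Gamma:K_T(c_0(\Gamma))\to\mathbb{Q}_p$ be the homomorphism sending the class of $f\in \mathrm{GL}_r(c_0(\Gamma))$ to the coefficient at the neutral element of $\log g=-\sum_{\nu\ge1}(1-g)^\nu/\nu$, where $\det f=p^{\nu}\zeta\gamma g$ with $\nu\in\mathbb{Z}$, $\zeta\in\mathbb{Q}_p$, $\zeta^{p-1}=1$, $\gamma\in\Gamma$, $\|1-g\|<1$ (every unit of $c_0(\Gamma)$ has a unique such decomposition). An $R$-module $M$ is called $p$-adically expansive if it is finitely generated and $c_0(\Gamma)\otimes_R M=0$. *$p$-adic $R$-torsion.* Choose a resolution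 $0\to F_d\xrightarrow{\partial}\cdots\xrightarrow{\partial}F_0\to M\to0$ by finitely generated free $R$-modules and $R$-bases of the $F_i$. If the complex $c_0(\Gamma)\otimes_R F_\bullet$ with differential $\hat\partial$ is acyclic, choose a chain contraction $\delta$, $\delta\hat\partial+\hat\partial\delta=\mathrm{id}$. The torsion of the based complex is the class in $K_T(c_0(\Gamma))$ of the matrix of the isomorphism $(\hat\partial+\delta):\bigoplus_{i\text{ odd}}c_0(\Gamma)\otimes F_i\to\bigoplus_{i\text{ even}}c_0(\Gamma)\otimes F_i$, and $\tau_p^\Gamma(M)\in\mathbb{Q}_p$ is its image under $\log_p\det_\Gamma$. *Bräuer's determinant.* Let $S_p=R\cap c_0(\Gamma)^\times$ and let $\mathcal{M}_{S_p}(R)$ be the category of finitely generated $S_p$-torsion $R$-modules. The boundary map $\delta:K_1(R[S_p^{-1}])\to K_0(\mathcal{M}_{S_p}(R))$ of the localization sequence sends the class of $f=s^{-1}g\in\mathrm{GL}_r(R[S_p^{-1}])$, where $s\in S_p$ and $g\in M_r(R)$, to $[R^r/R^rg]-[R^r/R^rs]$. It induces an isomorphism $\overline\delta:K_1(R[S_p^{-1}])/R^\times\to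 K_0(\mathcal{M}_{S_p}(R))$, with inverse $\mathrm{cl}_p$. Let $\log_p\det_\Gamma:K_0(\mathcal{M}_{S_p}(R))\to\mathbb{Q}_p$ be the composition of $\mathrm{cl}_p$, the natural map $K_1(R[S_p^{-1}])/R^\times\to K_T(c_0(\Gamma))$, and $\log_p\det_\Gamma$ on $K_T(c_0(\Gamma))$. **Proposition.** Let $M$ be a $p$-adically expansive $R$-module. Then $M$ has a resolution as above, for every based resolution the torsion is defined, and $\tau_p^\Gamma(M)$ does not depend on the choices; $M$ is $S_p$-torsion, $[M]$ lies in the image of $\overline\delta$, and $\log_p\det_\Gamma$ takes the same value on the images in $K_T(c_0(\Gamma))$ of all its $\overline\delta$-preimages; and $$\log_p\mathrm{det}_\Gamma[M]=\tau_p^\Gamma(M).$$ -/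

import Mathlib

open scoped TensorProduct

namespace PadicDet

noncomputable section

/-- The group `Γ = ℤ^N`, written additively. -/
abbrev Lat (N : ℕ) : Type := Fin N → ℤ

/-- The integral group ring `R = ℤΓ = ℤ[ℤ^N]`. -/
abbrev GrpRing (N : ℕ) : Type := AddMonoidAlgebra ℤ (Lat N)

/-! ### The `p`-adic Banach algebra `c₀(Γ)` -/

/-- `c₀(Γ)`: the functions `x : Γ → ℚ_p` with `|x_γ| → 0` as `γ → ∞` (in the discrete group `Γ`), with
the maximum norm of Mathlib's space of functions vanishing at infinity. The product, defined below,
is the convolution (not the pointwise product). -/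
def C0 (p : ℕ) [Fact p.Prime] (N : ℕ) : Type := ZeroAtInftyContinuousMap (Lat N) ℚ_[p]

variable {p : ℕ} [Fact p.Prime] {N : ℕ}

namespace C0

instance : NormedAddCommGroup (C0 p N) :=
  inferInstanceAs (NormedAddCommGroup (ZeroAtInftyContinuousMap (Lat N) ℚ_[p]))

instance : Module ℚ_[p] (C0 p N) :=
  inferInstanceAs (Module ℚ_[p] (ZeroAtInftyContinuousMap (Lat N) ℚ_[p]))

instance : FunLike (C0 p N) (Lat N) ℚ_[p] :=
  inferInstanceAs (FunLike (ZeroAtInftyContinuousMap (Lat N) ℚ_[p]) (Lat N) ℚ_[p])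

@[ext] theorem ext {a b : C0 p N} (h : ∀ γ, a γ = b γ) : a = b := DFunLike.ext _ _ h

@[simp] theorem zero_apply (γ : Lat N) : (0 : C0 p N) γ = 0 := rfl
@[simp] theorem add_apply (a b : C0 p N) (γ : Lat N) : (a + b) γ = a γ + b γ := rfl
@[simp] theorem neg_apply (a : C0 p N) (γ : Lat N) : (-a) γ = -a γ := rfl

instance : NonarchimedeanRing ℚ_[p] where
  is_nonarchimedean := NonarchimedeanAddGroup.is_nonarchimedean

theorem summable (a : C0 p N) : Summable (fun γ => a γ) := by
  apply NonarchimedeanAddGroup.summable_of_tendsto_cofinite_zero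
  rw [← Filter.cocompact_eq_cofinite (Lat N)]
  exact ZeroAtInftyContinuousMap.zero_at_infty' a

/-- A summable family is an element of `c₀(Γ)` (over `ℚ_p`, summable means tending to zero). -/
def ofSummable (f : Lat N → ℚ_[p]) (hf : Summable f) : C0 p N :=
  (⟨⟨f, continuous_of_discreteTopology⟩, by
    rw [Filter.cocompact_eq_cofinite (Lat N)]
    exact hf.tendsto_cofinite_zero⟩ : ZeroAtInftyContinuousMap (Lat N) ℚ_[p])

@[simp] theorem ofSummable_apply (f : Lat N → ℚ_[p]) (hf : Summable f) (γ : Lat N) :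
    ofSummable f hf γ = f γ := rfl

theorem summable_prod (a b : C0 p N) : Summable fun x : Lat N × Lat N => a x.1 * b x.2 :=
  a.summable.mul_of_nonarchimedean b.summable

theorem summable_conv (a b : C0 p N) :
    Summable fun x : Lat N × Lat N => a x.2 * b (x.1 - x.2) := by
  refine (summable_prod a b).comp_injective (i := fun x : Lat N × Lat N => (x.2, x.1 - x.2)) ?_
  rintro ⟨x, y⟩ ⟨x', y'⟩ h
  simp only [Prod.mk.injEq] at h ⊢
  obtain ⟨rfl, h⟩ := h
  exact ⟨sub_left_injective h, rfl⟩

theorem summable_mul (a b : C0 p N) (γ : Lat N) : Summable fun x => a x * b (γ - x) :=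
  (summable_prod a b).comp_injective (i := fun x : Lat N => (x, γ - x)) fun x y h => by
    simpa using congrArg Prod.fst h

/-- Convolution: `(ab)_γ = ∑_x a_x b_{γ - x}`. -/
instance : Mul (C0 p N) where
  mul a b := ofSummable (fun γ => ∑' x, a x * b (γ - x)) (summable_conv a b).prod

theorem mul_apply (a b : C0 p N) (γ : Lat N) : (a * b) γ = ∑' x, a x * b (γ - x) := rfl

/-- The element `γ` of the group, as an element of `c₀(Γ)`. -/
def single (γ : Lat N) : C0 p N :=
  ofSummable (Pi.single γ 1) (by
    apply summable_of_ne_finset_zero (s := {γ})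
    intro b hb
    simp only [Finset.mem_singleton] at hb
    simp [hb])

theorem single_apply (γ x : Lat N) : (single γ : C0 p N) x = if x = γ then 1 else 0 := by
  simp [single, Pi.single_apply]

theorem single_mul_apply (γ : Lat N) (a : C0 p N) (x : Lat N) :
    ((single γ : C0 p N) * a) x = a (x - γ) := by
  rw [mul_apply, tsum_eq_single γ]
  · simp [single_apply]
  · intro b hb
    simp [single_apply, hb]

instance : One (C0 p N) where
  one := single 0

theorem one_def : (1 : C0 p N) = single 0 := rfl

theorem mul_comm' (a b : C0 p N) : a * b = b * a := by
  ext γ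
  rw [mul_apply, mul_apply, ← (Equiv.subLeft γ).tsum_eq]
  exact tsum_congr fun x => by simp [mul_comm]

theorem mul_assoc' (a b c : C0 p N) : a * b * c = a * (b * c) := by
  ext γ
  have hs : Summable (Function.uncurry fun x y : Lat N => a y * b (x - y) * c (γ - x)) := by
    have h3 := (summable_prod a b).mul_of_nonarchimedean c.summable
    refine h3.comp_injective
      (i := fun x : Lat N × Lat N => ((x.2, x.1 - x.2), γ - x.1)) ?_
    rintro ⟨x, y⟩ ⟨x', y'⟩ h
    simp only [Prod.mk.injEq] at h ⊢
    exact ⟨sub_right_injective h.2, h.1.1⟩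
  calc (a * b * c) γ = ∑' x, ∑' y, a y * b (x - y) * c (γ - x) := by
        rw [mul_apply]
        exact tsum_congr fun x => by rw [mul_apply, tsum_mul_right]
    _ = ∑' y, ∑' x, a y * b (x - y) * c (γ - x) := hs.tsum_comm.symm
    _ = ∑' y, ∑' z, a y * (b z * c (γ - y - z)) := by
        refine tsum_congr fun y => ?_
        rw [← (Equiv.addRight y).tsum_eq]
        exact tsum_congr fun z => by
          simp only [Equiv.coe_addRight, add_sub_cancel_right]
          rw [mul_assoc, show γ - (z + y) = γ - y - z by abel]
    _ = (a * (b * c)) γ := by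
        rw [mul_apply]
        exact tsum_congr fun y => by rw [mul_apply, tsum_mul_left]

theorem one_mul' (a : C0 p N) : 1 * a = a := by
  ext γ
  rw [one_def, single_mul_apply, sub_zero]

theorem mul_add' (a b c : C0 p N) : a * (b + c) = a * b + a * c := by
  ext γ
  simp only [mul_apply, add_apply, mul_add]
  exact (summable_mul a b γ).tsum_add (summable_mul a c γ)

instance : CommRing (C0 p N) :=
  { (inferInstance : AddCommGroup (C0 p N)) with
    mul_assoc := mul_assoc'
    mul_comm := mul_comm'
    one_mul := one_mul'
    mul_one := fun a => by rw [mul_comm', one_mul']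
    left_distrib := mul_add'
    right_distrib := fun a b c => by rw [mul_comm', mul_add', mul_comm' c a, mul_comm' c b]
    zero_mul := fun a => by ext γ; simp [mul_apply]
    mul_zero := fun a => by ext γ; simp [mul_apply] }

theorem single_mul_single (γ δ : Lat N) :
    (single γ * single δ : C0 p N) = single (γ + δ) := by
  ext x
  rw [single_mul_apply, single_apply, single_apply]
  simp only [sub_eq_iff_eq_add, add_comm]

instance : Nontrivial (C0 p N) :=
  ⟨⟨1, 0, fun h => by
    have := DFunLike.congr_fun h (0 : Lat N)
    rw [one_def, single_apply] at this
    simp at this⟩⟩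

/-- `Γ → c₀(Γ)ˣ`. -/
def unitSingle (γ : Lat N) : (C0 p N)ˣ where
  val := single γ
  inv := single (-γ)
  val_inv := by rw [single_mul_single, add_neg_cancel]; rfl
  inv_val := by rw [single_mul_single, neg_add_cancel]; rfl

/-- The inclusion `ℤΓ → c₀(Γ)`. -/
def ofGrpRing : GrpRing N →+* C0 p N :=
  (AddMonoidAlgebra.lift ℤ (C0 p N) (Lat N)
    { toFun := fun γ => single γ.toAdd
      map_one' := rfl
      map_mul' := fun _ _ => (single_mul_single _ _).symm }).toRingHom

instance : Algebra (GrpRing N) (C0 p N) := ofGrpRing.toAlgebra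

theorem algebraMap_single (γ : Lat N) (n : ℤ) :
    algebraMap (GrpRing N) (C0 p N) (AddMonoidAlgebra.single γ n) = n • single γ := by
  change AddMonoidAlgebra.lift ℤ (C0 p N) (Lat N) _ _ = _
  rw [AddMonoidAlgebra.lift_single]
  rfl

theorem zsmul_apply (n : ℤ) (a : C0 p N) (γ : Lat N) : (n • a) γ = n * a γ := by
  change n • (a γ) = _
  rw [zsmul_eq_mul]

/-- The coefficients of the image of `f ∈ ℤΓ` in `c₀(Γ)` are those of `f`. -/
theorem algebraMap_apply (f : GrpRing N) (γ : Lat N) :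
    (algebraMap (GrpRing N) (C0 p N) f) γ = (f.coeff γ : ℚ_[p]) := by
  induction f using AddMonoidAlgebra.induction_on with
  | of m =>
    rw [AddMonoidAlgebra.of_apply, algebraMap_single, zsmul_apply, single_apply]
    simp [AddMonoidAlgebra.coeff_single, Finsupp.single_apply, eq_comm]
  | add f g hf hg => simp [hf, hg]
  | smul r f hf =>
    rw [map_zsmul, zsmul_apply, hf, AddMonoidAlgebra.coeff_smul]
    simp

theorem algebraMap_injective : Function.Injective (algebraMap (GrpRing N) (C0 p N)) := by
  intro f g h
  ext γ
  have := DFunLike.congr_fun h γ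
  rw [algebraMap_apply, algebraMap_apply] at this
  exact_mod_cast this

end C0

/-! ### Units of the integral group ring -/

namespace GrpRing

/-- `Γ → (ℤΓ)ˣ`. -/
def unitSingle (γ : Lat N) : (GrpRing N)ˣ where
  val := AddMonoidAlgebra.single γ 1
  inv := AddMonoidAlgebra.single (-γ) 1
  val_inv := by rw [AddMonoidAlgebra.single_mul_single]; simp [AddMonoidAlgebra.one_def]
  inv_val := by rw [AddMonoidAlgebra.single_mul_single]; simp [AddMonoidAlgebra.one_def]

/-- The units of `ℤ[ℤ^N]` are the `± γ`. -/
theorem units_eq (u : (GrpRing N)ˣ) : ∃ γ : Lat N, u = unitSingle γ ∨ u = -unitSingle γ := by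
  obtain ⟨f, g, hfg, hgf⟩ := u
  have hf0 : f ≠ 0 := fun h => by rw [h, zero_mul] at hfg; exact zero_ne_one hfg
  have hg0 : g ≠ 0 := fun h => by rw [h, mul_zero] at hfg; exact zero_ne_one hfg
  have hfs : f.coeff.support.Nonempty := by
    rw [Finsupp.support_nonempty_iff]; simpa using hf0
  have hgs : g.coeff.support.Nonempty := by
    rw [Finsupp.support_nonempty_iff]; simpa using hg0
  have key : ∀ a b : Lat N, a ∈ f.coeff.support → b ∈ g.coeff.support →
      UniqueAdd f.coeff.support g.coeff.support a b → a + b = 0 := by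
    intro a b ha hb hu
    have h1 := AddMonoidAlgebra.coeff_mul_add_of_uniqueAdd hu
    rw [hfg, AddMonoidAlgebra.one_def, AddMonoidAlgebra.coeff_single, Finsupp.single_apply] at h1
    by_contra hne
    rw [if_neg (fun h => hne h.symm)] at h1
    exact mul_ne_zero (Finsupp.mem_support_iff.mp ha) (Finsupp.mem_support_iff.mp hb) h1.symm
  have hcard : f.coeff.support.card * g.coeff.support.card ≤ 1 := by
    by_contra hlt
    push Not at hlt
    obtain ⟨⟨a, b⟩, hab, ⟨c, d⟩, hcd, hne, hu, hv⟩ := TwoUniqueSums.uniqueAdd_of_one_lt_card hlt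
    simp only [Finset.mem_product] at hab hcd hne hu hv
    have h1 := key a b hab.1 hab.2 hu
    have h2 := key c d hcd.1 hcd.2 hv
    have := hu hcd.1 hcd.2 (h2.trans h1.symm)
    exact hne (Prod.ext this.1.symm this.2.symm)
  have hc1 : f.coeff.support.card = 1 := by
    have h1 := hfs.card_pos
    have h2 := hgs.card_pos
    nlinarith
  have hc2 : g.coeff.support.card = 1 := by
    have h1 := hfs.card_pos
    have h2 := hgs.card_pos
    nlinarith
  obtain ⟨a, n, -, hf⟩ := Finsupp.card_support_eq_one'.mp hc1
  obtain ⟨b, m, -, hg⟩ := Finsupp.card_support_eq_one'.mp hc2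
  have hf' : f = AddMonoidAlgebra.single a n := by
    apply AddMonoidAlgebra.coeff_injective; rw [hf, AddMonoidAlgebra.coeff_single]
  have hg' : g = AddMonoidAlgebra.single b m := by
    apply AddMonoidAlgebra.coeff_injective; rw [hg, AddMonoidAlgebra.coeff_single]
  have hnm : n * m = 1 := by
    have h := hfg
    rw [hf', hg', AddMonoidAlgebra.single_mul_single, AddMonoidAlgebra.one_def] at h
    have h0 := congrArg AddMonoidAlgebra.coeff h
    rw [AddMonoidAlgebra.coeff_single, AddMonoidAlgebra.coeff_single,
      Finsupp.single_eq_single_iff] at h0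
    rcases h0 with h0 | h0
    · exact h0.2
    · exact absurd h0.2 one_ne_zero
  refine ⟨a, ?_⟩
  rcases Int.eq_one_or_neg_one_of_mul_eq_one hnm with h | h
  · left; ext1; exact hf'.trans (by rw [h]; rfl)
  · right; ext1; exact hf'.trans (by rw [h]; simp [unitSingle])

end GrpRing

/-! ### The logarithm and the logarithmic determinant on `c₀(Γ)ˣ` -/

namespace C0

/-- The trace functional `tr_Γ (∑ x_γ γ) = x_e`. -/
def tr (a : C0 p N) : ℚ_[p] := a 0

/-- `g ∈ U¹_Γ = 1 + p ℤΓ^`, i.e. `‖1 - g‖ < 1`. -/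
def IsOneUnit (g : C0 p N) : Prop := ‖1 - g‖ < 1

/-- `log u = - ∑_{ν ≥ 1} (1 - u)^ν / ν`, a convergent series in the Banach space `c₀(Γ)` for
`u ∈ U¹_Γ`. -/
def log (u : C0 p N) : C0 p N := -∑' ν : ℕ, ((ν + 1 : ℚ_[p])⁻¹) • (1 - u) ^ (ν + 1)

/-- `q` is the value at `u ∈ c₀(Γ)ˣ` of the logarithmic determinant: `u = p^ν ζ γ g` in the
decomposition `c₀(Γ)ˣ = p^ℤ μ_{p-1} Γ U¹_Γ` and `q = tr_Γ (log g)`. -/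
def HasLogDet (u : (C0 p N)ˣ) (q : ℚ_[p]) : Prop :=
  ∃ (ν : ℤ) (ζ : ℚ_[p]) (γ : Lat N) (g : C0 p N), ζ ^ (p - 1) = 1 ∧ IsOneUnit g ∧
    (u : C0 p N) = ((p : ℚ_[p]) ^ ν * ζ) • (single γ * g) ∧ q = tr (log g)

end C0

/-! ### The group `K₁` -/

section K1

variable {A : Type*} [CommRing A]

/-- The equivalence used to write an `n × n`-matrix as a block matrix. -/
def blockEquiv {m n : ℕ} (h : m ≤ n) : Fin m ⊕ Fin (n - m) ≃ Fin n :=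
  finSumFinEquiv.trans (finCongr (Nat.add_sub_cancel' h))

/-- `M ↦ diag(M, 1)`, from `m × m`-matrices to `n × n`-matrices. -/
def stabMatrix {m n : ℕ} (h : m ≤ n) : Matrix (Fin m) (Fin m) A →* Matrix (Fin n) (Fin n) A where
  toFun M := Matrix.reindex (blockEquiv h) (blockEquiv h) (Matrix.fromBlocks M 0 0 1)
  map_one' := by simp
  map_mul' M M' := by
    simp only [Matrix.reindex_apply]
    rw [Matrix.submatrix_mul_equiv, Matrix.fromBlocks_multiply]
    simp

theorem stabMatrix_apply {m n : ℕ} (h : m ≤ n) (M : Matrix (Fin m) (Fin m) A) (i j : Fin n) :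
    stabMatrix h M i j = if h' : (i : ℕ) < m ∧ (j : ℕ) < m then M ⟨i, h'.1⟩ ⟨j, h'.2⟩
      else if i = j then 1 else 0 := by
  obtain ⟨a, rfl⟩ := (blockEquiv h).surjective i
  obtain ⟨b, rfl⟩ := (blockEquiv h).surjective j
  simp only [stabMatrix, MonoidHom.coe_mk, OneHom.coe_mk, Matrix.reindex_apply,
    Matrix.submatrix_apply, Equiv.symm_apply_apply, EmbeddingLike.apply_eq_iff_eq]
  rcases a with a | a <;> rcases b with b | b <;> simp [blockEquiv, Matrix.one_apply]

/-- The stabilization `GL_m(A) → GL_n(A)`, `f ↦ diag(f, 1)`. -/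
def stab {m n : ℕ} (h : m ≤ n) :
    Matrix.GeneralLinearGroup (Fin m) A →* Matrix.GeneralLinearGroup (Fin n) A :=
  Units.map (stabMatrix h)

instance : DirectedSystem (fun n : ℕ => Matrix.GeneralLinearGroup (Fin n) A)
    (fun _ _ h => stab h) where
  map_self := by
    intro n x
    ext i j
    change stabMatrix le_rfl x.val i j = x.val i j
    simp [stabMatrix_apply]
  map_map := by
    intro k j i hij hjk x
    ext a b
    change stabMatrix hjk (stabMatrix hij x.val) a b = stabMatrix _ x.val a b
    simp only [stabMatrix_apply]
    by_cases h1 : (a : ℕ) < i ∧ (b : ℕ) < i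
    · have h2 : (a : ℕ) < j ∧ (b : ℕ) < j := ⟨h1.1.trans_le hij, h1.2.trans_le hij⟩
      simp [h1, h2]
    · by_cases h2 : (a : ℕ) < j ∧ (b : ℕ) < j
      · simp [h1, h2, Fin.ext_iff]
      · simp [h1, h2]

variable (A) in
/-- `GL_∞(A)`, the direct limit of the groups `GL_n(A)`. -/
abbrev GLInf : Type _ :=
  DirectLimit (fun n : ℕ => Matrix.GeneralLinearGroup (Fin n) A) (fun _ _ h => stab h)

variable (A) in
/-- `K₁(A) = GL_∞(A)^{ab}`. -/
abbrev K1 : Type _ := Abelianization (GLInf A)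

namespace K1

/-- The canonical map `GL_n(A) → K₁(A)`. -/
def mk (n : ℕ) : Matrix.GeneralLinearGroup (Fin n) A →* K1 A :=
  Abelianization.of.comp
    { toFun := fun x => (⟦⟨n, x⟩⟧ : GLInf A)
      map_one' := (DirectLimit.one_def n).symm
      map_mul' := fun x y => by rw [DirectLimit.mul_def] }

/-- The universal property of `K₁(A)`. -/
def lift {C : Type*} [CommGroup C] (φ : ∀ n : ℕ, Matrix.GeneralLinearGroup (Fin n) A →* C)
    (hφ : ∀ (m n : ℕ) (h : m ≤ n) (x : Matrix.GeneralLinearGroup (Fin m) A),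
      φ m x = φ n (stab h x)) : K1 A →* C :=
  Abelianization.lift
    { toFun := DirectLimit.lift _ (fun n x => φ n x) hφ
      map_one' := by
        rw [DirectLimit.one_def 0, DirectLimit.lift_def]
        exact map_one _
      map_mul' := fun x y => by
        induction x, y using DirectLimit.induction₂ with
        | _ n x y =>
          rw [DirectLimit.mul_def, DirectLimit.lift_def, DirectLimit.lift_def,
            DirectLimit.lift_def]
          exact map_mul _ _ _ }

@[simp] theorem lift_mk {C : Type*} [CommGroup C]
    (φ : ∀ n : ℕ, Matrix.GeneralLinearGroup (Fin n) A →* C)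
    (hφ : ∀ (m n : ℕ) (h : m ≤ n) (x : Matrix.GeneralLinearGroup (Fin m) A),
      φ m x = φ n (stab h x)) (n : ℕ) (x : Matrix.GeneralLinearGroup (Fin n) A) :
    lift φ hφ (mk n x) = φ n x := rfl

theorem mk_stab {m n : ℕ} (h : m ≤ n) (x : Matrix.GeneralLinearGroup (Fin m) A) :
    mk n (stab h x) = mk m x := by
  have : (⟦⟨n, stab h x⟩⟧ : GLInf A) = ⟦⟨m, x⟩⟧ := by
    refine Quotient.sound ⟨n, le_rfl, h, ?_⟩
    exact DirectedSystem.map_self (f := fun _ _ h => stab h) _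
  exact congrArg Abelianization.of this

/-- Functoriality of `K₁`. -/
def map {B : Type*} [CommRing B] (φ : A →+* B) : K1 A →* K1 B :=
  lift (fun n => (mk n).comp (Matrix.GeneralLinearGroup.map φ)) (by
    intro m n h x
    simp only [MonoidHom.comp_apply]
    rw [← mk_stab h]
    congr 1
    ext i j
    change stabMatrix h (x.val.map φ) i j = φ (stabMatrix h x.val i j)
    simp only [stabMatrix_apply]
    split_ifs <;> simp)

/-- The determinant `K₁(A) → Aˣ`. -/
def det : K1 A →* Aˣ :=
  lift (fun _ => Matrix.GeneralLinearGroup.det) (by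
    intro m n h x
    ext1
    change Matrix.det x.val = Matrix.det (stabMatrix h x.val)
    simp [stabMatrix])

/-- The natural map `Aˣ → K₁(A)`, through the `1 × 1`-matrices. -/
def ofUnit : Aˣ →* K1 A :=
  (mk 1).comp (Units.map (Matrix.scalar (Fin 1)).toMonoidHom)

theorem map_ofUnit {B : Type*} [CommRing B] (φ : A →+* B) (u : Aˣ) :
    map φ (ofUnit u) = ofUnit (Units.map φ.toMonoidHom u) := by
  simp only [ofUnit, MonoidHom.comp_apply, map, lift_mk]
  congr 1
  ext i j
  obtain rfl := Subsingleton.elim i j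
  simp [Matrix.GeneralLinearGroup.map, Matrix.scalar_apply]

end K1

end K1

/-! ### The multiplicative system `S_p` and the group `K₀` of `S_p`-torsion modules -/

universe u

variable (p N) in
/-- `S_p = ℤΓ ∩ c₀(Γ)ˣ`. -/
def Sp : Submonoid (GrpRing N) :=
  (IsUnit.submonoid (C0 p N)).comap (algebraMap (GrpRing N) (C0 p N))

theorem mem_Sp {s : GrpRing N} : s ∈ Sp p N ↔ IsUnit (algebraMap (GrpRing N) (C0 p N) s) :=
  Iff.rfl

variable (p N) in
/-- `R[S_p⁻¹]`. -/
abbrev Loc : Type := Localization (Sp p N)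

theorem Sp_le : Sp p N ≤ nonZeroDivisors (GrpRing N) := by
  refine le_nonZeroDivisors_of_noZeroDivisors ?_
  intro h
  have h' : IsUnit (algebraMap (GrpRing N) (C0 p N) 0) := h
  rw [map_zero] at h'
  exact not_isUnit_zero h'

theorem loc_injective : Function.Injective (algebraMap (GrpRing N) (Loc p N)) :=
  IsLocalization.injective _ (Sp_le (p := p))

variable (p N) in
/-- The inclusion `R[S_p⁻¹] → c₀(Γ)`. -/
def locToC0 : Loc p N →+* C0 p N :=
  IsLocalization.lift (M := Sp p N) (g := algebraMap (GrpRing N) (C0 p N)) fun s => mem_Sp.mp s.2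

theorem locToC0_algebraMap (s : GrpRing N) :
    locToC0 p N (algebraMap (GrpRing N) (Loc p N) s) = algebraMap (GrpRing N) (C0 p N) s :=
  IsLocalization.lift_eq _ s

theorem mem_Sp_of_isUnit {s : GrpRing N} (h : IsUnit (algebraMap (GrpRing N) (Loc p N) s)) :
    s ∈ Sp p N := by
  have := h.map (locToC0 p N)
  rwa [locToC0_algebraMap] at this

variable (p N) in
/-- Every element of the module is annihilated by an element of `S_p`. -/
def IsSpTorsion (M : Type u) [AddCommGroup M] [Module (GrpRing N) M] : Prop :=
  ∀ m : M, ∃ s ∈ Sp p N, s • m = 0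

variable (p N) in
/-- The objects of the category `𝓜_{S_p}(R)`: the finitely generated `S_p`-torsion `R`-modules. -/
structure TorsMod : Type (u + 1) where
  carrier : Type u
  [addCommGroup : AddCommGroup carrier]
  [module : Module (GrpRing N) carrier]
  [finite : Module.Finite (GrpRing N) carrier]
  torsion : IsSpTorsion p N carrier

attribute [instance] TorsMod.addCommGroup TorsMod.module TorsMod.finite

variable (p N) in
/-- The elements `[M] - [M'] - [M'']` for the short exact sequences `0 → M' → M → M'' → 0`. -/
def exactRelations : Set (FreeAbelianGroup (TorsMod.{u} p N)) :=
  {x | ∃ (M' M M'' : TorsMod.{u} p N) (f : M'.carrier →ₗ[GrpRing N] M.carrier)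
    (g : M.carrier →ₗ[GrpRing N] M''.carrier), Function.Injective f ∧ Function.Exact f g ∧
      Function.Surjective g ∧
      x = FreeAbelianGroup.of M - FreeAbelianGroup.of M' - FreeAbelianGroup.of M''}

variable (p N) in
/-- `K₀(𝓜_{S_p}(R))`. -/
abbrev K0 : Type (u + 1) :=
  FreeAbelianGroup (TorsMod.{u} p N) ⧸ AddSubgroup.closure (exactRelations.{u} p N)

namespace K0

/-- The class of a finitely generated `S_p`-torsion module. -/
def cls (M : TorsMod.{u} p N) : K0.{u} p N := QuotientAddGroup.mk (FreeAbelianGroup.of M)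

theorem cls_exact {M' M M'' : TorsMod.{u} p N} (f : M'.carrier →ₗ[GrpRing N] M.carrier)
    (g : M.carrier →ₗ[GrpRing N] M''.carrier) (hf : Function.Injective f)
    (hfg : Function.Exact f g) (hg : Function.Surjective g) : cls M = cls M' + cls M'' := by
  have h : (QuotientAddGroup.mk (FreeAbelianGroup.of M - FreeAbelianGroup.of M' -
      FreeAbelianGroup.of M'') : K0.{u} p N) = 0 :=
    (QuotientAddGroup.eq_zero_iff _).mpr
      (AddSubgroup.subset_closure ⟨M', M, M'', f, g, hf, hfg, hg, rfl⟩)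
  have h' : cls M - cls M' - cls M'' = 0 := h
  rw [sub_sub, sub_eq_zero] at h'
  exact h'

theorem cls_subsingleton (M : TorsMod.{u} p N) [Subsingleton M.carrier] : cls M = 0 := by
  have h := cls_exact (M' := M) (M := M) (M'' := M) LinearMap.id LinearMap.id
    Function.injective_id (fun x => by simp [Subsingleton.elim x 0]) Function.surjective_id
  simpa using h

theorem cls_congr {M M' : TorsMod.{u} p N} (e : M.carrier ≃ₗ[GrpRing N] M'.carrier) :
    cls M = cls M' := by
  let Z : TorsMod.{u} p N := { carrier := PUnit, torsion := fun m => ⟨1, one_mem _, rfl⟩ }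
  have h := cls_exact (M' := M) (M := M') (M'' := Z) e.toLinearMap 0 e.injective
    (fun x => by simp) (fun x => ⟨0, Subsingleton.elim _ _⟩)
  have hz : cls Z = 0 := by
    have : Subsingleton Z.carrier := inferInstanceAs (Subsingleton PUnit)
    exact cls_subsingleton Z
  rw [hz, add_zero] at h
  exact h.symm

end K0

/-! ### The boundary map `δ : K₁(R[S_p⁻¹]) → K₀(𝓜_{S_p}(R))` -/

/-- `R^r / R^r g`. -/
abbrev Coker {r : ℕ} (g : Matrix (Fin r) (Fin r) (GrpRing N)) : Type :=
  (Fin r → GrpRing N) ⧸ LinearMap.range g.vecMulLinear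

theorem coker_torsion {r : ℕ} {g : Matrix (Fin r) (Fin r) (GrpRing N)} (hg : g.det ∈ Sp p N) :
    IsSpTorsion p N (ULift.{u} (Coker g)) := by
  rintro ⟨m⟩
  obtain ⟨v, rfl⟩ := Submodule.mkQ_surjective _ m
  refine ⟨g.det, hg, ?_⟩
  ext1
  change g.det • Submodule.mkQ _ v = 0
  rw [← map_smul, Submodule.mkQ_apply, Submodule.Quotient.mk_eq_zero]
  refine ⟨Matrix.vecMul v g.adjugate, ?_⟩
  rw [Matrix.vecMulLinear_apply, Matrix.vecMul_vecMul, Matrix.adjugate_mul, Matrix.vecMul_smul,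
    Matrix.vecMul_one]

/-- `R^r / R^r g` as an object of `𝓜_{S_p}(R)`, for `g ∈ M_r(R)` with `det g ∈ S_p`, i.e. for
`g ∈ M_r(R) ∩ GL_r(R[S_p⁻¹])`. -/
def cokerMod {r : ℕ} (g : Matrix (Fin r) (Fin r) (GrpRing N)) (hg : g.det ∈ Sp p N) :
    TorsMod.{u} p N where
  carrier := ULift.{u} (Coker g)
  torsion := coker_torsion hg

theorem vecMul_injective {r : ℕ} {g : Matrix (Fin r) (Fin r) (GrpRing N)} (hg : g.det ∈ Sp p N) :
    Function.Injective fun v => Matrix.vecMul v g := by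
  intro v w h
  have h' := congrArg (fun v => Matrix.vecMul v g.adjugate) h
  simp only [Matrix.vecMul_vecMul, Matrix.mul_adjugate, Matrix.vecMul_smul,
    Matrix.vecMul_one] at h'
  have h0 : g.det ≠ 0 := nonZeroDivisors.ne_zero (Sp_le hg)
  exact smul_right_injective _ h0 h'

theorem cls_cokerMod_mul {r : ℕ} {g h : Matrix (Fin r) (Fin r) (GrpRing N)}
    (hg : g.det ∈ Sp p N) (hh : h.det ∈ Sp p N) (hgh : (g * h).det ∈ Sp p N) :
    K0.cls (cokerMod.{u} (g * h) hgh) =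
      K0.cls (cokerMod.{u} g hg) + K0.cls (cokerMod.{u} h hh) := by
  have h1 : LinearMap.range g.vecMulLinear ≤
      (LinearMap.range (g * h).vecMulLinear).comap h.vecMulLinear := by
    rintro _ ⟨v, rfl⟩
    exact ⟨v, by simp [Matrix.vecMul_vecMul]⟩
  have h2 : LinearMap.range (g * h).vecMulLinear ≤
      (LinearMap.range h.vecMulLinear).comap LinearMap.id := by
    rintro _ ⟨v, rfl⟩
    exact ⟨Matrix.vecMul v g, by simp [Matrix.vecMul_vecMul]⟩
  let α : Coker g →ₗ[GrpRing N] Coker (g * h) := Submodule.mapQ _ _ h.vecMulLinear h1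
  let β : Coker (g * h) →ₗ[GrpRing N] Coker h := Submodule.mapQ _ _ LinearMap.id h2
  have hα : Function.Injective α := by
    rw [← LinearMap.ker_eq_bot, LinearMap.ker_eq_bot']
    intro m hm
    obtain ⟨v, rfl⟩ := Submodule.mkQ_surjective _ m
    rw [Submodule.mkQ_apply, Submodule.mapQ_apply, Submodule.Quotient.mk_eq_zero] at hm
    obtain ⟨w, hw⟩ := hm
    rw [Submodule.mkQ_apply, Submodule.Quotient.mk_eq_zero]
    refine ⟨w, vecMul_injective hh ?_⟩
    simpa [Matrix.vecMul_vecMul] using hw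
  have hβ : Function.Surjective β := by
    intro m
    obtain ⟨v, rfl⟩ := Submodule.mkQ_surjective _ m
    exact ⟨Submodule.Quotient.mk v, rfl⟩
  have hαβ : Function.Exact α β := by
    intro m
    obtain ⟨v, rfl⟩ := Submodule.mkQ_surjective _ m
    constructor
    · intro hm
      rw [Submodule.mkQ_apply, Submodule.mapQ_apply, Submodule.Quotient.mk_eq_zero] at hm
      obtain ⟨w, hw⟩ := hm
      refine ⟨Submodule.Quotient.mk w, ?_⟩
      rw [Submodule.mapQ_apply, hw]
      rfl
    · rintro ⟨m', hm'⟩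
      obtain ⟨w, rfl⟩ := Submodule.mkQ_surjective _ m'
      rw [← hm']
      change β (α (Submodule.Quotient.mk w)) = 0
      rw [Submodule.mapQ_apply, Submodule.mapQ_apply, Submodule.Quotient.mk_eq_zero]
      exact ⟨w, rfl⟩
  refine K0.cls_exact (M' := cokerMod g hg) (M := cokerMod (g * h) hgh) (M'' := cokerMod h hh)
    (ULift.moduleEquiv.symm.toLinearMap ∘ₗ α ∘ₗ ULift.moduleEquiv.toLinearMap)
    (ULift.moduleEquiv.symm.toLinearMap ∘ₗ β ∘ₗ ULift.moduleEquiv.toLinearMap) ?_ ?_ ?_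
  · exact ULift.up_injective.comp (hα.comp ULift.down_injective)
  · rintro ⟨m⟩
    constructor
    · intro hm
      obtain ⟨x, hx⟩ := (hαβ m).mp (congrArg ULift.down hm)
      exact ⟨⟨x⟩, congrArg ULift.up hx⟩
    · rintro ⟨⟨x⟩, hx⟩
      exact congrArg ULift.up ((hαβ m).mpr ⟨x, congrArg ULift.down hx⟩)
  · exact ULift.up_surjective.comp (hβ.comp ULift.down_surjective)

theorem cls_cokerMod_isUnit {r : ℕ} {g : Matrix (Fin r) (Fin r) (GrpRing N)}
    (hu : IsUnit g.det) (hg : g.det ∈ Sp p N) : K0.cls (cokerMod.{u} g hg) = 0 := by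
  have hsub : Subsingleton (Coker g) := by
    rw [Submodule.Quotient.subsingleton_iff, LinearMap.range_eq_top]
    intro v
    refine ⟨Matrix.vecMul v g⁻¹, ?_⟩
    rw [Matrix.vecMulLinear_apply, Matrix.vecMul_vecMul, Matrix.nonsing_inv_mul _ hu,
      Matrix.vecMul_one]
  have : Subsingleton (cokerMod.{u} g hg).carrier :=
    inferInstanceAs (Subsingleton (ULift (Coker g)))
  exact K0.cls_subsingleton _

theorem det_stabMatrix {A : Type*} [CommRing A] {m n : ℕ} (h : m ≤ n)
    (g : Matrix (Fin m) (Fin m) A) : (stabMatrix h g).det = g.det := by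
  simp [stabMatrix]

theorem cls_cokerMod_stab {m n : ℕ} (h : m ≤ n) {g : Matrix (Fin m) (Fin m) (GrpRing N)}
    (hg : g.det ∈ Sp p N) (hs : (stabMatrix h g).det ∈ Sp p N) :
    K0.cls (cokerMod.{u} (stabMatrix h g) hs) = K0.cls (cokerMod.{u} g hg) := by
  let ρ : (Fin n → GrpRing N) →ₗ[GrpRing N] (Fin m → GrpRing N) :=
    LinearMap.funLeft _ _ fun i => blockEquiv h (Sum.inl i)
  have hblock : ∀ w : Fin n → GrpRing N, Matrix.vecMul w (stabMatrix h g) =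
      (Sum.elim (Matrix.vecMul (ρ w) g) fun j => w (blockEquiv h (Sum.inr j))) ∘
        (blockEquiv h).symm := by
    intro w
    change Matrix.vecMul w ((Matrix.fromBlocks g 0 0 1).submatrix (blockEquiv h).symm
      (blockEquiv h).symm) = _
    rw [Matrix.submatrix_vecMul_equiv, Matrix.vecMul_fromBlocks]
    simp [ρ, Function.comp_def, LinearMap.funLeft]
  have h1 : LinearMap.range (stabMatrix h g).vecMulLinear ≤
      (LinearMap.range g.vecMulLinear).comap ρ := by
    rintro _ ⟨w, rfl⟩
    refine ⟨ρ w, ?_⟩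
    rw [Matrix.vecMulLinear_apply, Matrix.vecMulLinear_apply, hblock]
    ext i
    simp [ρ, LinearMap.funLeft_apply]
  let β : Coker (stabMatrix h g) →ₗ[GrpRing N] Coker g := Submodule.mapQ _ _ ρ h1
  have hβ : Function.Bijective β := by
    constructor
    · rw [← LinearMap.ker_eq_bot, LinearMap.ker_eq_bot']
      intro x hx
      obtain ⟨w, rfl⟩ := Submodule.mkQ_surjective _ x
      rw [Submodule.mkQ_apply, Submodule.mapQ_apply, Submodule.Quotient.mk_eq_zero] at hx
      obtain ⟨v, hv⟩ := hx
      rw [Submodule.mkQ_apply, Submodule.Quotient.mk_eq_zero]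
      refine ⟨(Sum.elim v fun j => w (blockEquiv h (Sum.inr j))) ∘ (blockEquiv h).symm, ?_⟩
      rw [Matrix.vecMulLinear_apply, hblock]
      rw [Matrix.vecMulLinear_apply] at hv
      have hρ : ρ ((Sum.elim v fun j => w (blockEquiv h (Sum.inr j))) ∘ (blockEquiv h).symm) = v := by
        ext i
        simp [ρ, LinearMap.funLeft_apply]
      rw [hρ, hv]
      ext i
      obtain ⟨a, rfl⟩ := (blockEquiv h).surjective i
      rcases a with a | a <;> simp [ρ, LinearMap.funLeft_apply]
    · intro x
      obtain ⟨v, rfl⟩ := Submodule.mkQ_surjective _ x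
      refine ⟨Submodule.Quotient.mk ((Sum.elim v 0) ∘ (blockEquiv h).symm), ?_⟩
      rw [Submodule.mapQ_apply, Submodule.mkQ_apply]
      congr 1
      ext i
      simp [ρ, LinearMap.funLeft_apply]
  exact K0.cls_congr (M := cokerMod (stabMatrix h g) hs) (M' := cokerMod g hg)
    (ULift.moduleEquiv.trans ((LinearEquiv.ofBijective β hβ).trans ULift.moduleEquiv.symm))

/-- `(s, g)` is a presentation `f = s⁻¹ g` of `f ∈ GL_r(R[S_p⁻¹])` with a common denominator
`s ∈ S_p` and `g ∈ M_r(R)`. -/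
def IsFraction {r : ℕ} (f : Matrix.GeneralLinearGroup (Fin r) (Loc p N)) (s : GrpRing N)
    (g : Matrix (Fin r) (Fin r) (GrpRing N)) : Prop :=
  s ∈ Sp p N ∧ g.map (algebraMap (GrpRing N) (Loc p N)) =
    algebraMap (GrpRing N) (Loc p N) s • (f : Matrix (Fin r) (Fin r) (Loc p N))

theorem exists_isFraction {r : ℕ} (f : Matrix.GeneralLinearGroup (Fin r) (Loc p N)) :
    ∃ s g, IsFraction f s g := by
  classical
  obtain ⟨s, hs⟩ := IsLocalization.exist_integer_multiples_of_finset (Sp p N)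
    (Finset.univ.image fun x : Fin r × Fin r => f.val x.1 x.2)
  have hs' : ∀ i j, ∃ a, algebraMap (GrpRing N) (Loc p N) a = (s : GrpRing N) • f.val i j :=
    fun i j => hs _ (Finset.mem_image_of_mem (fun x : Fin r × Fin r => f.val x.1 x.2)
      (Finset.mem_univ (i, j)))
  choose g hg using hs'
  refine ⟨s, Matrix.of g, s.2, ?_⟩
  ext i j
  simp [hg, Algebra.smul_def]

theorem IsFraction.det_mem {r : ℕ} {f : Matrix.GeneralLinearGroup (Fin r) (Loc p N)}
    {s : GrpRing N} {g : Matrix (Fin r) (Fin r) (GrpRing N)} (h : IsFraction f s g) :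
    g.det ∈ Sp p N := by
  apply mem_Sp_of_isUnit
  rw [RingHom.map_det, RingHom.mapMatrix_apply, h.2, Matrix.det_smul]
  exact ((IsLocalization.map_units (Loc p N) (⟨s, h.1⟩ : Sp p N)).pow _).mul
    ((Matrix.isUnit_iff_isUnit_det _).mp f.isUnit)

theorem scalar_det_mem {s : GrpRing N} (hs : s ∈ Sp p N) (r : ℕ) :
    (Matrix.scalar (Fin r) s).det ∈ Sp p N := by
  rw [Matrix.scalar_apply, Matrix.det_diagonal, Finset.prod_const]
  exact pow_mem hs _

/-- `[R^r / R^r g] - [R^r / R^r s]`. -/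
def fractionCls {r : ℕ} {f : Matrix.GeneralLinearGroup (Fin r) (Loc p N)} {s : GrpRing N}
    {g : Matrix (Fin r) (Fin r) (GrpRing N)} (h : IsFraction f s g) : K0.{u} p N :=
  K0.cls (cokerMod g h.det_mem) -
    K0.cls (cokerMod (Matrix.scalar (Fin r) s) (scalar_det_mem h.1 r))

theorem fractionCls_eq {r : ℕ} {f : Matrix.GeneralLinearGroup (Fin r) (Loc p N)}
    {s s' : GrpRing N} {g g' : Matrix (Fin r) (Fin r) (GrpRing N)} (h : IsFraction f s g)
    (h' : IsFraction f s' g') : fractionCls.{u} h = fractionCls.{u} h' := by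
  have hm : Matrix.scalar (Fin r) s' * g = Matrix.scalar (Fin r) s * g' := by
    refine Matrix.ext fun i j => loc_injective (p := p) ?_
    have h1 := congrFun (congrFun h.2 i) j
    have h2 := congrFun (congrFun h'.2 i) j
    simp only [Matrix.map_apply, Matrix.smul_apply, smul_eq_mul] at h1 h2
    simp only [Matrix.scalar_apply, Matrix.diagonal_mul, map_mul, h1, h2]
    ring
  have d1 : (Matrix.scalar (Fin r) s' * g).det ∈ Sp p N := by
    rw [Matrix.det_mul]; exact mul_mem (scalar_det_mem h'.1 r) h.det_mem
  have d2 : (Matrix.scalar (Fin r) s * g').det ∈ Sp p N := hm ▸ d1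
  have e1 := cls_cokerMod_mul.{u} (scalar_det_mem h'.1 r) h.det_mem d1
  have e2 := cls_cokerMod_mul.{u} (scalar_det_mem h.1 r) h'.det_mem d2
  have e3 : K0.cls (cokerMod.{u} _ d1) = K0.cls (cokerMod.{u} _ d2) := by
    congr 2
  rw [e1, e2] at e3
  rw [fractionCls, fractionCls, sub_eq_sub_iff_add_eq_add, add_comm, e3, add_comm]

theorem IsFraction.mul {r : ℕ} {f f' : Matrix.GeneralLinearGroup (Fin r) (Loc p N)}
    {s s' : GrpRing N} {g g' : Matrix (Fin r) (Fin r) (GrpRing N)} (h : IsFraction f s g)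
    (h' : IsFraction f' s' g') : IsFraction (f * f') (s * s') (g * g') := by
  refine ⟨mul_mem h.1 h'.1, ?_⟩
  rw [Matrix.map_mul, h.2, h'.2, map_mul, Matrix.smul_mul, Matrix.mul_smul, smul_smul]
  rfl

theorem fractionCls_mul {r : ℕ} {f f' : Matrix.GeneralLinearGroup (Fin r) (Loc p N)}
    {s s' : GrpRing N} {g g' : Matrix (Fin r) (Fin r) (GrpRing N)} (h : IsFraction f s g)
    (h' : IsFraction f' s' g') :
    fractionCls.{u} (h.mul h') = fractionCls.{u} h + fractionCls.{u} h' := by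
  have e1 := cls_cokerMod_mul.{u} h.det_mem h'.det_mem (h.mul h').det_mem
  have d : (Matrix.scalar (Fin r) s * Matrix.scalar (Fin r) s').det ∈ Sp p N := by
    rw [Matrix.det_mul]; exact mul_mem (scalar_det_mem h.1 r) (scalar_det_mem h'.1 r)
  have e2 := cls_cokerMod_mul.{u} (scalar_det_mem h.1 r) (scalar_det_mem h'.1 r) d
  have e3 : K0.cls (cokerMod.{u} _ (scalar_det_mem (h.mul h').1 r)) =
      K0.cls (cokerMod.{u} _ d) := by
    congr 2
    rw [map_mul]
  rw [fractionCls, e1, e3, e2, fractionCls, fractionCls]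
  abel

variable (p N) in
/-- `δ_r : GL_r(R[S_p⁻¹]) → K₀`, `f ↦ [R^r / R^r g] - [R^r / R^r s]` for `f = s⁻¹ g`. -/
def deltaGL (r : ℕ) :
    Matrix.GeneralLinearGroup (Fin r) (Loc p N) →* Multiplicative (K0.{u} p N) where
  toFun f := Multiplicative.ofAdd
    (fractionCls (exists_isFraction f).choose_spec.choose_spec)
  map_one' := by
    have h : IsFraction (1 : Matrix.GeneralLinearGroup (Fin r) (Loc p N)) 1
        (Matrix.scalar (Fin r) 1) := ⟨one_mem _, by simp⟩
    rw [fractionCls_eq _ h, fractionCls, sub_self]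
    rfl
  map_mul' f f' := by
    rw [fractionCls_eq _ ((exists_isFraction f).choose_spec.choose_spec.mul
      (exists_isFraction f').choose_spec.choose_spec),
      fractionCls_mul (exists_isFraction f).choose_spec.choose_spec
        (exists_isFraction f').choose_spec.choose_spec]
    rfl

theorem deltaGL_eq {r : ℕ} {f : Matrix.GeneralLinearGroup (Fin r) (Loc p N)} {s : GrpRing N}
    {g : Matrix (Fin r) (Fin r) (GrpRing N)} (h : IsFraction f s g) :
    deltaGL.{u} p N r f = Multiplicative.ofAdd (fractionCls h) :=
  congrArg Multiplicative.ofAdd (fractionCls_eq _ h)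

theorem deltaGL_stab {m n : ℕ} (hmn : m ≤ n)
    (f : Matrix.GeneralLinearGroup (Fin m) (Loc p N)) :
    deltaGL.{u} p N m f = deltaGL.{u} p N n (stab hmn f) := by
  obtain ⟨s, g, h⟩ := exists_isFraction f
  let D : Matrix (Fin n) (Fin n) (GrpRing N) :=
    Matrix.diagonal fun i => if (i : ℕ) < m then 1 else s
  have hD : D.det ∈ Sp p N := by
    rw [Matrix.det_diagonal]
    refine prod_mem fun i _ => ?_
    split_ifs
    · exact one_mem _
    · exact h.1
  have hsc : stabMatrix hmn (Matrix.scalar (Fin m) s) * D = Matrix.scalar (Fin n) s := by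
    ext i j
    simp only [D, Matrix.mul_diagonal, stabMatrix_apply, Matrix.scalar_apply,
      Matrix.diagonal_apply, Fin.ext_iff]
    split_ifs <;> simp_all
  have hg : IsFraction (stab hmn f) s (stabMatrix hmn g * D) := by
    refine ⟨h.1, ?_⟩
    ext i j
    have hf : ∀ i j, algebraMap (GrpRing N) (Loc p N) (g i j) =
        algebraMap (GrpRing N) (Loc p N) s * f.val i j := fun i j =>
      congrFun (congrFun h.2 i) j
    change algebraMap _ _ ((stabMatrix hmn g * D) i j) = _ * stabMatrix hmn f.val i j
    simp only [D, Matrix.mul_diagonal, stabMatrix_apply]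
    split_ifs <;> simp_all
  have d1 : (stabMatrix hmn g).det ∈ Sp p N := by rw [det_stabMatrix]; exact h.det_mem
  have d2 : (stabMatrix hmn (Matrix.scalar (Fin m) s)).det ∈ Sp p N := by
    rw [det_stabMatrix]; exact scalar_det_mem h.1 m
  have d3 : (stabMatrix hmn (Matrix.scalar (Fin m) s) * D).det ∈ Sp p N := by
    rw [hsc]; exact scalar_det_mem h.1 n
  have e1 := cls_cokerMod_mul.{u} d1 hD hg.det_mem
  have e2 := cls_cokerMod_mul.{u} d2 hD d3
  have e3 : K0.cls (cokerMod.{u} _ (scalar_det_mem hg.1 n)) = K0.cls (cokerMod.{u} _ d3) := by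
    congr 2
    exact hsc.symm
  rw [deltaGL_eq h, deltaGL_eq hg, fractionCls, fractionCls, e1, e3, e2,
    cls_cokerMod_stab hmn h.det_mem, cls_cokerMod_stab hmn (scalar_det_mem h.1 m)]
  congr 1
  abel

variable (p N) in
/-- The boundary map `δ : K₁(R[S_p⁻¹]) → K₀(𝓜_{S_p}(R))` of the localization sequence. -/
def delta : K1 (Loc p N) →* Multiplicative (K0.{u} p N) :=
  K1.lift (deltaGL p N) fun _ _ h f => deltaGL_stab h f

variable (p N) in
/-- The image of `Rˣ` in `K₁(R[S_p⁻¹])`. -/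
def unitsInK1 : Subgroup (K1 (Loc p N)) :=
  (K1.ofUnit.comp (Units.map (algebraMap (GrpRing N) (Loc p N)).toMonoidHom)).range

theorem delta_ofUnit (x : (GrpRing N)ˣ) :
    delta.{u} p N (K1.ofUnit (Units.map (algebraMap (GrpRing N) (Loc p N)).toMonoidHom x)) = 1 := by
  have h : IsFraction (Units.map (Matrix.scalar (Fin 1)).toMonoidHom
      (Units.map (algebraMap (GrpRing N) (Loc p N)).toMonoidHom x)) 1
      (Matrix.scalar (Fin 1) (x : GrpRing N)) := by
    refine ⟨one_mem _, ?_⟩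
    ext i j
    obtain rfl := Subsingleton.elim i j
    simp [Matrix.scalar_apply]
  have e : delta.{u} p N (K1.ofUnit (Units.map (algebraMap (GrpRing N) (Loc p N)).toMonoidHom x)) =
      Multiplicative.ofAdd (fractionCls h) := by
    rw [← deltaGL_eq h]
    simp only [delta, K1.ofUnit, MonoidHom.comp_apply, K1.lift_mk]
  rw [e, fractionCls, cls_cokerMod_isUnit, cls_cokerMod_isUnit, sub_zero]
  · rfl
  · simp
  · simp

variable (p N) in
/-- The induced map `δ̄ : K₁(R[S_p⁻¹]) / Rˣ → K₀(𝓜_{S_p}(R))`. -/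
def deltaBar : K1 (Loc p N) ⧸ unitsInK1 p N →* Multiplicative (K0.{u} p N) :=
  QuotientGroup.lift _ (delta p N) (by
    rintro _ ⟨x, rfl⟩
    exact delta_ofUnit x)

/-! ### The logarithmic determinant on `K_T(c₀(Γ))` -/

variable (p N) in
/-- The image `⟨± Γ⟩` of the group `± Γ ⊆ c₀(Γ)ˣ` in `K₁(c₀(Γ))`. -/
def trivialUnits : Subgroup (K1 (C0 p N)) :=
  Subgroup.closure (insert (K1.ofUnit (-1)) (Set.range fun γ => K1.ofUnit (C0.unitSingle γ)))

variable (p N) in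
/-- `K_T(c₀(Γ)) = K₁(c₀(Γ)) / ⟨± Γ⟩`. -/
abbrev KT : Type := K1 (C0 p N) ⧸ trivialUnits p N

variable (p N) in
/-- The natural map `K₁(R[S_p⁻¹]) / Rˣ → K_T(c₀(Γ))`. -/
def locToKT : K1 (Loc p N) ⧸ unitsInK1 p N →* KT p N :=
  QuotientGroup.map _ _ (K1.map (locToC0 p N)) (by
    rintro _ ⟨x, rfl⟩
    rw [Subgroup.mem_comap, MonoidHom.comp_apply, K1.map_ofUnit]
    have key : ∀ γ : Lat N, Units.map (locToC0 p N).toMonoidHom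
        (Units.map (algebraMap (GrpRing N) (Loc p N)).toMonoidHom (GrpRing.unitSingle γ)) =
          C0.unitSingle γ := by
      intro γ
      ext1
      change locToC0 p N (algebraMap (GrpRing N) (Loc p N) (AddMonoidAlgebra.single γ 1)) =
        C0.single γ
      rw [locToC0_algebraMap, C0.algebraMap_single, one_smul]
    have hneg : ∀ u : (GrpRing N)ˣ, Units.map (locToC0 p N).toMonoidHom
        (Units.map (algebraMap (GrpRing N) (Loc p N)).toMonoidHom (-u)) =
          -1 * Units.map (locToC0 p N).toMonoidHom
            (Units.map (algebraMap (GrpRing N) (Loc p N)).toMonoidHom u) := by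
      intro u
      ext1
      simp
    obtain ⟨γ, rfl | rfl⟩ := GrpRing.units_eq x
    · rw [key]
      exact Subgroup.subset_closure (Set.mem_insert_of_mem _ ⟨γ, rfl⟩)
    · rw [hneg, key, map_mul]
      exact mul_mem (Subgroup.subset_closure (Set.mem_insert _ _))
        (Subgroup.subset_closure (Set.mem_insert_of_mem _ ⟨γ, rfl⟩)))

/-- `q` is the value of `log_p det_Γ` at the class `t ∈ K_T(c₀(Γ))`: the class is represented by
some `x ∈ K₁(c₀(Γ))` and `q` is the value obtained from `det x = p^ν ζ γ g`. -/
def HasLogDet (t : KT p N) (q : ℚ_[p]) : Prop :=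
  ∃ x : K1 (C0 p N), (QuotientGroup.mk x : KT p N) = t ∧ C0.HasLogDet (K1.det x) q

open Classical in
/-- `log_p det_Γ : K_T(c₀(Γ)) → ℚ_p`. -/
def logDetKT (t : KT p N) : ℚ_[p] := if h : ∃ q, HasLogDet t q then h.choose else 0

/-! ### The determinant of a `p`-adically expansive module through the localization sequence -/

/-- `cl_p`, the inverse of the isomorphism `δ̄`. -/
def clp (x : K0.{u} p N) : K1 (Loc p N) ⧸ unitsInK1 p N :=
  Function.invFun (deltaBar.{u} p N) (Multiplicative.ofAdd x)

/-- `log_p det_Γ : K₀(𝓜_{S_p}(R)) → ℚ_p`, the composition of `cl_p`, of the natural map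
`K₁(R[S_p⁻¹]) / Rˣ → K_T(c₀(Γ))` and of `log_p det_Γ` on `K_T(c₀(Γ))`. -/
def logDetK0 (x : K0.{u} p N) : ℚ_[p] := logDetKT (locToKT p N (clp x))

variable (p N) in
/-- A `ℤΓ`-module `M` is `p`-adically expansive: it is finitely generated and
`c₀(Γ) ⊗_{ℤΓ} M = 0`. -/
structure IsPadicallyExpansive (M : Type u) [AddCommGroup M] [Module (GrpRing N) M] : Prop where
  finite : Module.Finite (GrpRing N) M
  subsingleton : Subsingleton (C0 p N ⊗[GrpRing N] M)

/-- The class `[M]` in `K₀(𝓜_{S_p}(R))`. -/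
def classOf (M : Type u) [AddCommGroup M] [Module (GrpRing N) M]
    (hM : IsPadicallyExpansive p N M) (hT : IsSpTorsion p N M) : K0.{u} p N :=
  haveI := hM.finite
  K0.cls ⟨M, hT⟩

/-! ### The `p`-adic `R`-torsion -/

/-- A resolution `0 → F_d → ⋯ → F_0 → M → 0` of a `ℤΓ`-module by finitely generated free
`ℤΓ`-modules with chosen bases: a finitely generated free module with an (ordered) basis is
`(ℤΓ)^n`. Here `F_i = (ℤΓ)^(rank i)`, and `F_i = 0` for `i > d = len`. -/
structure BasedResolution (N : ℕ) (M : Type u) [AddCommGroup M] [Module (GrpRing N) M] where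
  len : ℕ
  rank : ℕ → ℕ
  rank_eq_zero : ∀ i, len < i → rank i = 0
  d : ∀ i, (Fin (rank (i + 1)) → GrpRing N) →ₗ[GrpRing N] (Fin (rank i) → GrpRing N)
  aug : (Fin (rank 0) → GrpRing N) →ₗ[GrpRing N] M
  aug_surjective : Function.Surjective aug
  exact_zero : Function.Exact (d 0) aug
  exact_succ : ∀ i, Function.Exact (d (i + 1)) (d i)

namespace BasedResolution

variable {M : Type u} [AddCommGroup M] [Module (GrpRing N) M]

variable (p) in
/-- The differential `id ⊗ ∂` of the complex `c₀(Γ) ⊗ F`, in the bases `1 ⊗ 𝔟`. -/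
def dHat (F : BasedResolution N M) (i : ℕ) :
    (Fin (F.rank (i + 1)) → C0 p N) →ₗ[C0 p N] (Fin (F.rank i) → C0 p N) :=
  Matrix.toLin' ((LinearMap.toMatrix' (F.d i)).map (algebraMap (GrpRing N) (C0 p N)))

variable (p) in
/-- A chain contraction of the complex `c₀(Γ) ⊗ F`. -/
structure Contraction (F : BasedResolution N M) where
  h : ∀ i, (Fin (F.rank i) → C0 p N) →ₗ[C0 p N] (Fin (F.rank (i + 1)) → C0 p N)
  zero : F.dHat p 0 ∘ₗ h 0 = LinearMap.id
  succ : ∀ i, F.dHat p (i + 1) ∘ₗ h (i + 1) + h i ∘ₗ F.dHat p i = LinearMap.id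

/-- The map `∂ + δ` on the sum of all `c₀(Γ) ⊗ F_i`. -/
def Contraction.total {F : BasedResolution N M} (c : F.Contraction p)
    (v : ∀ i, Fin (F.rank i) → C0 p N) : ∀ i, Fin (F.rank i) → C0 p N
  | 0 => F.dHat p 0 (v 1)
  | k + 1 => F.dHat p (k + 1) (v (k + 2)) + c.h k (v k)

/-- The basis of `F_odd`. -/
abbrev OddIdx (F : BasedResolution N M) : Type :=
  {x : Σ i : Fin (F.len + 1), Fin (F.rank i) // Odd (x.1 : ℕ)}

/-- The basis of `F_even`. -/
abbrev EvenIdx (F : BasedResolution N M) : Type :=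
  {x : Σ i : Fin (F.len + 1), Fin (F.rank i) // Even (x.1 : ℕ)}

/-- The matrix `(a_{xy})` of `(∂ + δ)_odd : c₀(Γ) ⊗ F_odd → c₀(Γ) ⊗ F_even`, where
`e_x ↦ ∑_y a_{xy} e_y`. -/
def Contraction.oddMatrix {F : BasedResolution N M} (c : F.Contraction p) :
    Matrix F.OddIdx F.EvenIdx (C0 p N) :=
  Matrix.of fun x y => c.total (Pi.single (x.1.1 : ℕ) (Pi.single x.1.2 1)) y.1.1 y.1.2

/-- `t ∈ K_T(c₀(Γ))` is the torsion of the based complex `c₀(Γ) ⊗ F`: the class of the matrix of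
`(∂ + δ)_odd` for a chain contraction `δ` and for orderings of the bases of `F_odd` and `F_even`. -/
def IsTorsion (F : BasedResolution N M) (t : KT p N) : Prop :=
  ∃ (c : F.Contraction p) (r : ℕ) (eo : F.OddIdx ≃ Fin r) (ee : F.EvenIdx ≃ Fin r)
    (g : Matrix.GeneralLinearGroup (Fin r) (C0 p N)),
    (g : Matrix (Fin r) (Fin r) (C0 p N)) = c.oddMatrix.submatrix eo.symm ee.symm ∧
      t = QuotientGroup.mk (K1.mk r g)

end BasedResolution

open Classical in
variable (p N) in
/-- The `p`-adic `R`-torsion `τ_p^Γ(M) = log_p det_Γ (τ(F, 𝔟))` for a based resolution `F` of `M`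
for which the torsion of `c₀(Γ) ⊗ F` is defined. -/
def padicRTorsion (M : Type u) [AddCommGroup M] [Module (GrpRing N) M] : ℚ_[p] :=
  if h : ∃ t : KT p N, ∃ F : BasedResolution N M, F.IsTorsion t then logDetKT h.choose else 0

end
end PadicDet

/-! Write `L` for `R[S_p⁻¹]`. On `K_T(c₀(Γ))` the logarithmic determinant depends only on the
determinant in `c₀(Γ)ˣ` modulo `± Γ`. So everything reduces to two facts about determinants over
`L`, and neither `SK₁` nor the bijectivity of `δ̄` is needed.

(a) For a based resolution `F` of a finitely generated `S_p`-torsion module `M`, the determinant of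
`(∂ + δ)_odd` over `L` is the determinant of some `ξ ∈ K₁(L)` with boundary `[M]`
(`exists_delta_eq_cls_and_det_eq`). The proof is by induction on the length. If `s ∈ S_p` kills `M`,
multiplication by `s` on `F` is null homotopic, say by `S`, and `S² = 0` may be assumed after
replacing `s` by `s²`. The kernel `M'` of `F₀ / s F₀ → M` is generated by `F₁`, with relations from
`F₂` (through `∂`) and from `F₀` (through `S`). This gives a resolution of `M'` on the same basis,
with `F₀` moved to degree one and all other degrees lowered by one. Up to the factor `s ^ rank F₀`,
its odd determinant is the even determinant of `F`, which is the inverse of the odd one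
(`blockDet_odd_mul_blockDet_even`). This matches `[M] = [F₀ / s F₀] - [M']`. In length at most one
the odd block is the matrix of `F₁ → F₀`, whose cokernel is `M`.

(b) If `δ ξ = 0`, then `det ξ` is a unit of `R`, hence lies in `± Γ` (`det_mem_of_delta_eq_one`). At
a prime element `π` the local ring `R_(π)` is a principal ideal domain. Length over it is additive,
so it is defined on `K₀`, and it sends `[R^r / R^r g]` to the order of `det g`. Since `R` is
factorial, equal orders at all `π` make two elements associated.

By (b) the logarithmic determinant is constant on the fibres of `δ̄`. By (a) and `blockDet_odd_eq`
(independence of the contraction) every torsion has the value of such a fibre, whatever the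
resolution. Three inputs remain. Finite free resolutions over `ℤ[ℤ^N]` come from induction on `N` by
a dévissage over Laurent polynomial rings (`hasFFR_laurent`). An expansive module is `S_p`-torsion
because its annihilator generates the unit ideal of `c₀(Γ)`, in which `ℤ[1/p]Γ` is dense. Finally
`log_p det_Γ` is well defined modulo `± Γ`; only the sign for `p = 2` needs an argument, through
`log g = lim p⁻ⁿ (g^(pⁿ) - 1)`. -/

open scoped TensorProduct

namespace PadicDet

universe u

/-! ### Modules with finite free resolutions -/

section FiniteFreeResolutions

/-- `FFR R n M`: the `R`-module `M` has a resolution by finitely generated free modules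
of length less than `n`. -/
def FFR (R : Type u) [CommRing R] : ℕ → ∀ (M : Type u) [AddCommGroup M] [Module R M], Prop
  | 0, M, _, _ => Subsingleton M
  | n + 1, M, _, _ => ∃ (k : ℕ) (f : (Fin k → R) →ₗ[R] M),
      Function.Surjective f ∧ FFR R n (LinearMap.ker f)

/-- `M` has a finite resolution by finitely generated free modules. -/
def HasFFR (R : Type u) [CommRing R] (M : Type u) [AddCommGroup M] [Module R M] : Prop :=
  ∃ n, FFR R n M

variable {R : Type u} [CommRing R]

theorem FFR.congr {n : ℕ} {M M' : Type u} [AddCommGroup M] [Module R M] [AddCommGroup M']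
    [Module R M'] (e : M ≃ₗ[R] M') (h : FFR R n M) : FFR R n M' := by
  induction n with
  | zero =>
    have : Subsingleton M := h
    exact e.symm.toEquiv.subsingleton
  | succ n _ =>
    obtain ⟨k, f, hf, hk⟩ := h
    refine ⟨k, e.toLinearMap ∘ₗ f, e.surjective.comp hf, ?_⟩
    rwa [LinearEquiv.ker_comp]

theorem FFR.mono {n m : ℕ} (hnm : n ≤ m) {M : Type u} [AddCommGroup M] [Module R M]
    (h : FFR R n M) : FFR R m M := by
  induction n generalizing m M with
  | zero =>
    have : Subsingleton M := h
    cases m with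
    | zero => exact h
    | succ m =>
      refine ⟨0, 0, fun x => ⟨0, Subsingleton.elim _ _⟩, ?_⟩
      clear hnm h
      have hs : ∀ (K : Type u) [AddCommGroup K] [Module R K], Subsingleton K → FFR R m K := by
        induction m with
        | zero => intro K _ _ h; exact h
        | succ m ih =>
          intro K _ _ h
          exact ⟨0, 0, fun x => ⟨0, Subsingleton.elim _ _⟩, ih _ inferInstance⟩
      exact hs _ inferInstance
  | succ n ih =>
    obtain ⟨m, rfl⟩ : ∃ m', m = m' + 1 := ⟨m - 1, by omega⟩
    obtain ⟨k, f, hf, hk⟩ := h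
    exact ⟨k, f, hf, ih (by omega) hk⟩

theorem HasFFR.congr {M M' : Type u} [AddCommGroup M] [Module R M] [AddCommGroup M']
    [Module R M'] (e : M ≃ₗ[R] M') (h : HasFFR R M) : HasFFR R M' :=
  ⟨_, h.choose_spec.congr e⟩

theorem HasFFR.of_subsingleton (M : Type u) [AddCommGroup M] [Module R M] [h : Subsingleton M] :
    HasFFR R M := ⟨0, (h : FFR R 0 M)⟩

theorem HasFFR.of_surjective {k : ℕ} {M : Type u} [AddCommGroup M] [Module R M]
    (f : (Fin k → R) →ₗ[R] M) (hf : Function.Surjective f) (h : HasFFR R (LinearMap.ker f)) :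
    HasFFR R M := ⟨h.choose + 1, k, f, hf, h.choose_spec⟩

theorem HasFFR.of_free (M : Type u) [AddCommGroup M] [Module R M] [Module.Free R M]
    [Module.Finite R M] : HasFFR R M := by
  classical
  let b := Module.Free.chooseBasis R M
  let e := (b.reindex (Fintype.equivFin _)).equivFun
  refine HasFFR.of_surjective e.symm.toLinearMap e.symm.surjective ?_
  rw [LinearEquiv.ker]
  exact HasFFR.of_subsingleton _

/-- The horseshoe lemma. -/
theorem FFR.extension {n : ℕ} {M' M M'' : Type u} [AddCommGroup M] [Module R M] [AddCommGroup M']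
    [Module R M'] [AddCommGroup M''] [Module R M''] (f : M' →ₗ[R] M) (g : M →ₗ[R] M'')
    (hf : Function.Injective f) (hfg : Function.Exact f g) (hg : Function.Surjective g)
    (h' : FFR R n M') (h'' : FFR R n M'') : FFR R n M := by
  induction n generalizing M' M M'' with
  | zero =>
    have : Subsingleton M' := h'
    have : Subsingleton M'' := h''
    refine ⟨fun x y => ?_⟩
    obtain ⟨z, hz⟩ := (hfg (x - y)).mp (Subsingleton.elim _ _)
    rw [Subsingleton.elim z 0, map_zero] at hz
    exact (sub_eq_zero.mp hz.symm)
  | succ n ih =>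
    obtain ⟨a, s, hs, hks⟩ := h'
    obtain ⟨b, t, ht, hkt⟩ := h''
    obtain ⟨t', ht'⟩ : ∃ t' : (Fin b → R) →ₗ[R] M, g ∘ₗ t' = t :=
      Module.projective_lifting_property g t hg
    have ht1 : ∀ y, g (t' y) = t y := fun y => LinearMap.congr_fun ht' y
    have hgf : ∀ y, g (f y) = 0 := fun y => (hfg _).mpr ⟨y, rfl⟩
    let φ : ((Fin a → R) × (Fin b → R)) →ₗ[R] M := (f ∘ₗ s).coprod t'
    have hφ : Function.Surjective φ := by
      intro m
      obtain ⟨y, hy⟩ := ht (g m)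
      obtain ⟨z, hz⟩ := (hfg (m - t' y)).mp (by rw [map_sub, ht1, hy, sub_self])
      obtain ⟨x, hx⟩ := hs z
      exact ⟨(x, y), by simp [φ, hx, hz]⟩
    let e : (Fin (a + b) → R) ≃ₗ[R] (Fin a → R) × (Fin b → R) :=
      (LinearEquiv.funCongrLeft R R finSumFinEquiv).trans (LinearEquiv.sumArrowLequivProdArrow _ _ R R)
    -- The kernels of the three covers again form a short exact sequence, to which the induction
    -- hypothesis applies.
    have hK : FFR R n (LinearMap.ker φ) := by
      let α : LinearMap.ker s →ₗ[R] LinearMap.ker φ :=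
        ((LinearMap.inl R _ _) ∘ₗ (LinearMap.ker s).subtype).codRestrict _ (by
          rintro ⟨x, hx⟩
          have hx' : s x = 0 := hx
          simp [φ, hx'])
      let β : LinearMap.ker φ →ₗ[R] LinearMap.ker t :=
        ((LinearMap.snd R _ _) ∘ₗ (LinearMap.ker φ).subtype).codRestrict _ (by
          rintro ⟨⟨x, y⟩, hxy⟩
          have h1 : f (s x) + t' y = 0 := by simpa [φ] using hxy
          have h2 := congrArg g h1
          rw [map_add, hgf, zero_add, map_zero, ht1] at h2
          simpa using h2)
      refine ih α β ?_ ?_ ?_ hks hkt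
      · rintro ⟨x, hx⟩ ⟨y, hy⟩ hxy
        have := congrArg (fun z => z.1.1) hxy
        exact Subtype.ext this
      · rintro ⟨⟨x, y⟩, hxy⟩
        constructor
        · intro h
          have hy : y = 0 := congrArg Subtype.val h
          subst hy
          have h1 : f (s x) = 0 := by simpa [φ] using hxy
          exact ⟨⟨x, hf (h1.trans (map_zero f).symm)⟩, rfl⟩
        · rintro ⟨z, hz⟩
          have := congrArg (fun z => z.1.2) hz
          exact Subtype.ext this.symm
      · rintro ⟨y, hy⟩
        have hy' : t y = 0 := hy
        obtain ⟨z, hz⟩ := (hfg (t' y)).mp (by rw [ht1, hy'])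
        obtain ⟨x, hx⟩ := hs z
        refine ⟨⟨(-x, y), ?_⟩, rfl⟩
        simp [φ, hx, hz]
    refine ⟨a + b, φ ∘ₗ e.toLinearMap, hφ.comp e.surjective, ?_⟩
    refine hK.congr ?_
    exact (LinearEquiv.ofSubmodule' e (LinearMap.ker φ)).symm.trans
      (LinearEquiv.ofEq _ _ (LinearMap.ker_comp _ _).symm)

theorem HasFFR.extension {M' M M'' : Type u} [AddCommGroup M] [Module R M] [AddCommGroup M']
    [Module R M'] [AddCommGroup M''] [Module R M''] (f : M' →ₗ[R] M) (g : M →ₗ[R] M'')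
    (hf : Function.Injective f) (hfg : Function.Exact f g) (hg : Function.Surjective g)
    (h' : HasFFR R M') (h'' : HasFFR R M'') : HasFFR R M := by
  obtain ⟨n, hn⟩ := h'
  obtain ⟨m, hm⟩ := h''
  exact ⟨max n m, FFR.extension f g hf hfg hg (hn.mono (le_max_left _ _)) (hm.mono (le_max_right _ _))⟩

/-- A free cover `s` of `M` also covers `M''`, and the kernel of `g ∘ s` is an extension of `M'` by
`ker s`; the horseshoe lemma concludes. The dévissage below rests on this case of two out of three.
-/
theorem HasFFR.quotient {M' M M'' : Type u} [AddCommGroup M] [Module R M] [AddCommGroup M']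
    [Module R M'] [AddCommGroup M''] [Module R M''] (f : M' →ₗ[R] M) (g : M →ₗ[R] M'')
    (hf : Function.Injective f) (hfg : Function.Exact f g) (hg : Function.Surjective g)
    (h' : HasFFR R M') (h : HasFFR R M) : HasFFR R M'' := by
  obtain ⟨n, hn⟩ := h
  -- The bound is raised by one so that it unfolds to an explicit cover even for `n = 0`.
  obtain ⟨k, s, hs, hk⟩ := hn.mono (Nat.le_succ n)
  refine HasFFR.of_surjective (g ∘ₗ s) (hg.comp hs) ?_
  choose r hr using fun x : LinearMap.ker (g ∘ₗ s) => (hfg (s x)).mp x.2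
  let β : LinearMap.ker (g ∘ₗ s) →ₗ[R] M' :=
    { toFun := r
      map_add' := fun x y => hf (by rw [map_add, hr, hr, hr]; simp)
      map_smul' := fun c x => hf (by rw [RingHom.id_apply, map_smul, hr, hr]; simp) }
  have hker : LinearMap.ker s ≤ LinearMap.ker (g ∘ₗ s) := LinearMap.ker_le_ker_comp _ _
  refine HasFFR.extension (Submodule.inclusion hker) β (Submodule.inclusion_injective _) ?_ ?_
    ⟨n, hk⟩ h'
  · intro x
    constructor
    · intro hx
      have hx' : r x = 0 := hx
      have h1 := hr x
      rw [hx', map_zero] at h1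
      exact ⟨⟨x, h1.symm⟩, rfl⟩
    · rintro ⟨y, rfl⟩
      refine hf ?_
      have h1 := hr (Submodule.inclusion hker y)
      have h2 : s y = 0 := y.2
      rw [map_zero]
      exact h1.trans h2
  · intro m
    obtain ⟨x, hx⟩ := hs (f m)
    refine ⟨⟨x, ?_⟩, hf ?_⟩
    · rw [LinearMap.mem_ker, LinearMap.comp_apply, hx]
      exact (hfg _).mpr ⟨m, rfl⟩
    · exact (hr _).trans hx

theorem HasFFR.of_finite_of_pid [IsDomain R] [IsPrincipalIdealRing R] (M : Type u)
    [AddCommGroup M] [Module R M] [Module.Finite R M] : HasFFR R M := by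
  obtain ⟨k, f, hf⟩ := Module.Finite.exists_fin' R M
  refine HasFFR.of_surjective f hf ?_
  exact HasFFR.of_free _

/-- Flatness keeps `0 → ker f → A^k → M → 0` exact, and `HasFFR.quotient` makes it unnecessary to
identify the kernel of the base-changed cover. -/
theorem HasFFR.baseChange {A : Type u} [CommRing A] [Algebra A R] [Module.Flat A R] {M : Type u}
    [AddCommGroup M] [Module A M] (h : HasFFR A M) : HasFFR R (R ⊗[A] M) := by
  obtain ⟨n, hn⟩ := h
  induction n generalizing M with
  | zero =>
    have : Subsingleton M := hn
    have : Subsingleton (R ⊗[A] M) := inferInstance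
    exact HasFFR.of_subsingleton _
  | succ n ih =>
    obtain ⟨k, f, hf, hk⟩ := hn
    refine HasFFR.quotient ((LinearMap.ker f).subtype.baseChange R) (f.baseChange R) ?_ ?_ ?_
      (ih hk) (HasFFR.of_free _)
    · exact Module.Flat.lTensor_preserves_injective_linearMap (M := R) _
        (Submodule.injective_subtype _)
    · exact lTensor_exact R (LinearMap.exact_subtype_ker_map f) hf
    · exact LinearMap.lTensor_surjective R hf

end FiniteFreeResolutions

end PadicDet

open scoped TensorProduct

namespace PadicDet

universe u

set_option linter.unusedSectionVars false

/-! ### Dévissage over a ring of Laurent polynomials -/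

section LaurentExtension

open Polynomial

/-- Pseudo-division by an element of minimal degree of an ideal. -/
theorem exists_pseudo_generator {A : Type*} [CommRing A] [IsDomain A] {J : Ideal A[X]}
    (hJ : J ≠ ⊥) : ∃ f ∈ J, f ≠ 0 ∧ ∃ d : A, d ≠ 0 ∧
      ∀ g ∈ J, ∃ k : ℕ, C d ^ k * g ∈ Ideal.span {f} := by
  classical
  obtain ⟨f₀, hf₀, hf₀'⟩ := Submodule.exists_mem_ne_zero_of_ne_bot hJ
  have hex : ∃ n, ∃ f ∈ J, f ≠ 0 ∧ f.natDegree = n := ⟨_, f₀, hf₀, hf₀', rfl⟩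
  obtain ⟨f, hf, hf0, hfn⟩ := Nat.find_spec hex
  have hmin : ∀ g ∈ J, g ≠ 0 → f.natDegree ≤ g.natDegree := fun g hg hg0 => by
    rw [hfn]; exact Nat.find_min' hex ⟨g, hg, hg0, rfl⟩
  refine ⟨f, hf, hf0, f.leadingCoeff, leadingCoeff_ne_zero.mpr hf0, ?_⟩
  -- Induction on the degree: each multiplication by the leading coefficient of `f` allows one step
  -- of the division algorithm.
  suffices H : ∀ n, ∀ g ∈ J, g.natDegree < n → ∃ k : ℕ, C f.leadingCoeff ^ k * g ∈ Ideal.span {f}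
    from fun g hg => H _ g hg (Nat.lt_succ_self _)
  intro n
  induction n with
  | zero => intro g _ h; omega
  | succ n ih =>
    intro g hg hn
    by_cases hg0 : g = 0
    · exact ⟨0, by simp [hg0]⟩
    have hle := hmin g hg hg0
    have hc : f.cancelLeads g ∈ J := by
      rw [cancelLeads]
      exact J.sub_mem (J.mul_mem_left _ hg) (J.mul_mem_left _ hf)
    have key : C f.leadingCoeff * g = f.cancelLeads g +
        (C g.leadingCoeff * X ^ (g.natDegree - f.natDegree)) * f := by
      rw [cancelLeads, Nat.sub_eq_zero_of_le hle]
      ring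
    have hk : ∃ k : ℕ, C f.leadingCoeff ^ k * f.cancelLeads g ∈ Ideal.span {f} := by
      -- The degree of a constant cannot drop; but then minimality makes `f` constant too, and `C d`
      -- is `f` itself.
      by_cases h0 : g.natDegree = 0
      · by_cases hc0 : f.cancelLeads g = 0
        · exact ⟨0, by simp [hc0]⟩
        · refine ⟨1, ?_⟩
          have hf00 : f.natDegree = 0 := by omega
          rw [eq_C_of_natDegree_eq_zero hf00, pow_one, leadingCoeff_C]
          exact Ideal.mul_mem_right _ _ (Ideal.mem_span_singleton_self _)
      · refine ih _ hc ?_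
        have := natDegree_cancelLeads_lt_of_natDegree_le_natDegree hle (by omega)
        omega
    obtain ⟨k, hk⟩ := hk
    refine ⟨k + 1, ?_⟩
    rw [pow_succ, mul_assoc, key, mul_add, ← mul_assoc]
    refine Ideal.add_mem _ hk ?_
    rw [mul_assoc, ← mul_assoc]
    exact Ideal.mul_mem_left _ _ (Ideal.mem_span_singleton_self _)

variable {A R : Type u} [CommRing A] [CommRing R] [Algebra A R]
  [Algebra A[X] R] [IsScalarTower A A[X] R] [IsLocalization.Away (X : A[X]) R]

theorem exists_mul_X_pow_eq (r : R) : ∃ (m : ℕ) (g : A[X]),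
    algebraMap A[X] R X ^ m * r = algebraMap A[X] R g := by
  obtain ⟨⟨g, ⟨_, m, rfl⟩⟩, h⟩ := IsLocalization.surj (Submonoid.powers (X : A[X])) r
  refine ⟨m, g, ?_⟩
  rw [← h, map_pow, mul_comm]

theorem map_algebraMap_eq_map_map_C (I : Ideal A) :
    I.map (algebraMap A R) = (I.map (C : A →+* A[X])).map (algebraMap A[X] R) := by
  rw [Ideal.map_map, IsScalarTower.algebraMap_eq A A[X] R]
  rfl

theorem disjoint_powers_X (I : Ideal A) [I.IsPrime] :
    Disjoint (Submonoid.powers (X : A[X]) : Set A[X]) (I.map (C : A →+* A[X]) : Set A[X]) := by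
  rw [Set.disjoint_left]
  rintro _ ⟨n, rfl⟩ h
  have h' := Ideal.mem_map_C_iff.mp h n
  simp only [coeff_X_pow, if_true] at h'
  exact Ideal.IsPrime.one_notMem ‹_› h'

-- `I A[X]` is prime because `A[X] / I A[X] = (A/I)[X]`, and it stays prime after inverting `X`
-- because it contains no power of `X`.
variable (R) in
theorem isPrime_map_algebraMap (I : Ideal A) [I.IsPrime] : (I.map (algebraMap A R)).IsPrime := by
  rw [map_algebraMap_eq_map_map_C]
  exact IsLocalization.isPrime_of_isPrime_disjoint (Submonoid.powers (X : A[X])) R _ inferInstance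
    (disjoint_powers_X I)

theorem algebraMap_mem_map_iff (I : Ideal A) [I.IsPrime] (f : A[X]) :
    algebraMap A[X] R f ∈ I.map (algebraMap A R) ↔ f ∈ I.map (C : A →+* A[X]) := by
  rw [map_algebraMap_eq_map_map_C, ← Ideal.mem_comap]
  have := IsLocalization.under_map_of_isPrime_disjoint (Submonoid.powers (X : A[X])) R
    (I := I.map (C : A →+* A[X])) inferInstance (disjoint_powers_X I)
  exact Ideal.ext_iff.mp this f

/-- The ideals of `R = A[X, X⁻¹]` lying over a prime `I` of `A` are, up to one denominator,
principal modulo `I R`. -/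
theorem exists_generator_mod [IsNoetherianRing R] (I : Ideal A) [I.IsPrime] (P : Ideal R)
    (hIP : I.map (algebraMap A R) < P) :
    ∃ f ∈ P, f ∉ I.map (algebraMap A R) ∧ ∃ d ∉ I, ∃ K : ℕ, ∀ g ∈ P,
      algebraMap A R d ^ K * g ∈ Ideal.span {f} ⊔ I.map (algebraMap A R) := by
  let π : A[X] →+* (A ⧸ I)[X] := mapRingHom (Ideal.Quotient.mk I)
  have hπ : Function.Surjective π := map_surjective _ Ideal.Quotient.mk_surjective
  have hker : ∀ g, π g = 0 ↔ g ∈ I.map (C : A →+* A[X]) := by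
    intro g
    rw [Ideal.mem_map_C_iff, Polynomial.ext_iff]
    refine forall_congr' fun n => ?_
    simp [π, coeff_map, Ideal.Quotient.eq_zero_iff_mem]
  -- The image of `P ∩ A[X]` modulo `I`. It is nonzero because `P` is larger than `I R`, so
  -- pseudo-division over the domain `A / I` applies to it.
  let J : Ideal (A ⧸ I)[X] := (P.comap (algebraMap A[X] R)).map π
  have hJmem : ∀ y, y ∈ J ↔ ∃ x, algebraMap A[X] R x ∈ P ∧ π x = y := fun y => by
    rw [Ideal.mem_map_iff_of_surjective π hπ]; rfl
  have hunit : ∀ m : ℕ, IsUnit (algebraMap A[X] R X ^ m) := fun m =>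
    (IsLocalization.Away.algebraMap_isUnit (X : A[X])).pow m
  have hJ : J ≠ ⊥ := by
    intro hJ
    obtain ⟨r, hrP, hr⟩ := SetLike.exists_of_lt hIP
    obtain ⟨m, g, hg⟩ := exists_mul_X_pow_eq (A := A) r
    have hgP : algebraMap A[X] R g ∈ P := hg ▸ P.mul_mem_left _ hrP
    have h0 : π g = 0 := by
      have : π g ∈ J := (hJmem _).mpr ⟨g, hgP, rfl⟩
      rwa [hJ] at this
    rw [hker, ← algebraMap_mem_map_iff (R := R), ← hg] at h0
    exact hr ((Ideal.unit_mul_mem_iff_mem _ (hunit m)).mp h0)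
  obtain ⟨f', hf', hf0, d', hd', H⟩ := exists_pseudo_generator hJ
  obtain ⟨f, hfP, rfl⟩ := (hJmem _).mp hf'
  obtain ⟨d, rfl⟩ := Ideal.Quotient.mk_surjective d'
  have hfI : algebraMap A[X] R f ∉ I.map (algebraMap A R) := by
    rwa [algebraMap_mem_map_iff, ← hker]
  refine ⟨algebraMap A[X] R f, hfP, hfI, d,
    fun h => hd' (Ideal.Quotient.eq_zero_iff_mem.mpr h), ?_⟩
  set I' := Ideal.span {algebraMap A[X] R f} ⊔ I.map (algebraMap A R)
  have hstep : ∀ g ∈ P, ∃ k : ℕ, algebraMap A R d ^ k * g ∈ I' := by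
    intro r hr
    obtain ⟨m, g, hg⟩ := exists_mul_X_pow_eq (A := A) r
    have hgP : algebraMap A[X] R g ∈ P := hg ▸ P.mul_mem_left _ hr
    obtain ⟨k, hk⟩ := H (π g) ((hJmem _).mpr ⟨g, hgP, rfl⟩)
    obtain ⟨q', hq⟩ := Ideal.mem_span_singleton'.mp hk
    obtain ⟨q, rfl⟩ := hπ q'
    have h1 : C d ^ k * g - q * f ∈ I.map (C : A →+* A[X]) := by
      rw [← hker, map_sub, map_mul, map_mul, hq, map_pow]
      simp [π]
    rw [← algebraMap_mem_map_iff (R := R)] at h1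
    refine ⟨k, (Ideal.unit_mul_mem_iff_mem _ (hunit m)).mp ?_⟩
    have h2 : algebraMap A[X] R X ^ m * (algebraMap A R d ^ k * r) =
        algebraMap A[X] R (C d ^ k * g - q * f) + algebraMap A[X] R q * algebraMap A[X] R f := by
      have h3 : algebraMap A[X] R (C d) = algebraMap A R d :=
        (IsScalarTower.algebraMap_apply A A[X] R d).symm
      rw [map_sub, map_mul, map_mul, map_pow, h3, ← hg]
      ring
    rw [h2]
    exact I'.add_mem ((le_sup_right : _ ≤ I') h1)
      ((le_sup_left : _ ≤ I') (Ideal.mul_mem_left _ _ (Ideal.mem_span_singleton_self _)))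
  -- The exponent depends on `g`; finitely many generators of `P` give a uniform one.
  obtain ⟨S, hS⟩ := (isNoetherianRing_iff_ideal_fg R).mp inferInstance P
  have hSP : ∀ g ∈ S, g ∈ P := fun g hg => hS ▸ Submodule.subset_span hg
  choose! k hk using fun g (hg : g ∈ S) => hstep g (hSP g hg)
  refine ⟨S.sup k, fun g hg => ?_⟩
  rw [← hS] at hg
  induction hg using Submodule.span_induction with
  | mem x hx =>
    rw [← Nat.sub_add_cancel (Finset.le_sup (f := k) hx), pow_add, mul_assoc]
    exact I'.mul_mem_left _ (hk x hx)
  | zero => simp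
  | add x y _ _ hx hy => rw [mul_add]; exact I'.add_mem hx hy
  | smul a x _ hx => rw [smul_eq_mul, mul_left_comm]; exact I'.mul_mem_left _ hx

theorem hasFFR_quotient_map [Module.Flat A R] (I : Ideal A) (h : HasFFR A (A ⧸ I)) :
    HasFFR R (R ⧸ I.map (algebraMap A R)) :=
  (HasFFR.baseChange (R := R) h).congr
    (Algebra.TensorProduct.quotIdealMapEquivTensorQuot R I).symm.toLinearEquiv

/-- A prime filtration reduces to `R / P`. With `I = P ∩ A`, the quotient `R / I R` is resolved by
flat base change from `A / I`. Since the fibre over the generic point of `A / I` is principal, `P`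
agrees with `(f) + I R` up to a power of some `d ∉ I`, and `f` is regular on `R / I R`. The error is
killed by an ideal larger than `I`, whence Noetherian induction on `I`. -/
theorem hasFFR_laurent [IsNoetherianRing A] [IsNoetherianRing R] 
    (hA : ∀ I : Ideal A, HasFFR A (A ⧸ I))
    (M : Type u) [AddCommGroup M] [Module R M] [Module.Finite R M] : HasFFR R M := by
  have : Module.Flat A[X] R := IsLocalization.flat R (Submonoid.powers (X : A[X]))
  have : Module.Flat A R := Module.Flat.trans A A[X] R
  -- The induction runs over ideals of `A` that kill the module; the zero ideal gives the result.
  suffices H : ∀ (I : Ideal A) (M : Type u) [AddCommGroup M] [Module R M] [Module.Finite R M],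
      (∀ a ∈ I, ∀ m : M, algebraMap A R a • m = 0) → HasFFR R M from
    H ⊥ M (by rintro a rfl m; simp)
  intro I
  induction I using WellFoundedGT.induction with
  | ind I ih =>
  intro M _ _ hM
  refine IsNoetherianRing.induction_on_isQuotientEquivQuotientPrime R hM
    (motive := fun N _ _ _ => (∀ a ∈ I, ∀ m : N, algebraMap A R a • m = 0) → HasFFR R N) ?_ ?_ ?_
  · intro N _ _ _ _ _
    exact HasFFR.of_subsingleton _
  · rintro N _ _ _ ⟨P, hP⟩ e hI
    refine HasFFR.congr e.symm ?_
    have hIP : ∀ a ∈ I, algebraMap A R a ∈ P := by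
      intro a ha
      have h1 := hI a ha (e.symm 1)
      rw [← map_smul, LinearEquiv.map_eq_zero_iff] at h1
      rwa [Algebra.smul_def, mul_one, Ideal.Quotient.algebraMap_eq,
        Ideal.Quotient.eq_zero_iff_mem] at h1
    have hkill : ∀ (P : Ideal R), ∀ a ∈ P.comap (algebraMap A R), ∀ m : R ⧸ P,
        algebraMap A R a • m = 0 := by
      intro P a ha m
      obtain ⟨m, rfl⟩ := Ideal.Quotient.mk_surjective m
      exact Ideal.Quotient.eq_zero_iff_mem.mpr (P.mul_mem_right _ ha)
    -- If `P ∩ A` is strictly larger than `I`, the module `R / P` is covered by the induction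
    -- hypothesis.
    by_cases hne : P.comap (algebraMap A R) = I
    swap
    · exact ih (P.comap (algebraMap A R)) (lt_of_le_of_ne hIP (Ne.symm hne)) _ (hkill P)
    have hIprime : I.IsPrime := hne ▸ hP.comap _
    have hle : I.map (algebraMap A R) ≤ P := Ideal.map_le_iff_le_comap.mpr hIP
    have hFI := hasFFR_quotient_map (R := R) I (hA I)
    rcases eq_or_lt_of_le hle with heq | hlt
    · exact heq ▸ hFI
    obtain ⟨f, hfP, hfI, d, hd, K, hK⟩ := exists_generator_mod I P hlt
    have hprime := isPrime_map_algebraMap R I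
    set IR := I.map (algebraMap A R) with hIR
    -- `R / (f, I)` is the cokernel of multiplication by `f` on `R / I R`
    have h1 : HasFFR R (R ⧸ (Ideal.span {f} ⊔ IR)) := by
      refine HasFFR.quotient (LinearMap.lsmul R (R ⧸ IR) f)
        (Submodule.factor le_sup_right : (R ⧸ IR) →ₗ[R] R ⧸ (Ideal.span {f} ⊔ IR)) ?_ ?_
        (Submodule.factor_surjective _) hFI hFI
      · rw [← LinearMap.ker_eq_bot, LinearMap.ker_eq_bot']
        intro m hm
        obtain ⟨m, rfl⟩ := Submodule.Quotient.mk_surjective _ m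
        rw [LinearMap.lsmul_apply, ← Submodule.Quotient.mk_smul, Submodule.Quotient.mk_eq_zero] at hm
        rw [Submodule.Quotient.mk_eq_zero]
        exact (hprime.mem_or_mem hm).resolve_left hfI
      · intro m
        obtain ⟨m, rfl⟩ := Submodule.Quotient.mk_surjective _ m
        change Submodule.Quotient.mk m = 0 ↔ _
        rw [Submodule.Quotient.mk_eq_zero]
        constructor
        · intro hm
          obtain ⟨y, hy, z, hz, rfl⟩ := Submodule.mem_sup.mp hm
          obtain ⟨q, rfl⟩ := Ideal.mem_span_singleton'.mp hy
          refine ⟨Submodule.Quotient.mk q, ?_⟩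
          rw [LinearMap.lsmul_apply, ← Submodule.Quotient.mk_smul, Submodule.Quotient.eq, smul_eq_mul]
          rw [show f * q - (q * f + z) = -z by ring]
          exact IR.neg_mem hz
        · rintro ⟨q, hq⟩
          obtain ⟨q, rfl⟩ := Submodule.Quotient.mk_surjective _ q
          rw [LinearMap.lsmul_apply, ← Submodule.Quotient.mk_smul, Submodule.Quotient.eq,
            smul_eq_mul] at hq
          rw [show m = q * f - (f * q - m) by ring]
          exact Submodule.sub_mem _
            (Submodule.mem_sup_left (Ideal.mul_mem_left _ _ (Ideal.mem_span_singleton_self _)))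
            (Submodule.mem_sup_right hq)
    have hI'P : Ideal.span {f} ⊔ IR ≤ P :=
      sup_le ((Ideal.span_singleton_le_iff_mem P).mpr hfP) hle
    let ρ : (R ⧸ (Ideal.span {f} ⊔ IR)) →ₗ[R] R ⧸ P := Submodule.factor hI'P
    -- the kernel of `R / (f, I) → R / P` is killed by an ideal larger than `I`
    have h2 : HasFFR R (LinearMap.ker ρ) := by
      refine ih (I ⊔ Ideal.span {d ^ K}) ?_ _ ?_
      · refine lt_of_le_of_ne le_sup_left fun h => hd ?_
        have : d ^ K ∈ I := h ▸ Submodule.mem_sup_right (Ideal.mem_span_singleton_self _)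
        exact hIprime.mem_of_pow_mem _ this
      · rintro a ha ⟨m, hm⟩
        ext1
        change algebraMap A R a • m = 0
        obtain ⟨m, rfl⟩ := Submodule.Quotient.mk_surjective _ m
        replace hm : (Submodule.Quotient.mk m : R ⧸ P) = 0 := hm
        rw [Submodule.Quotient.mk_eq_zero] at hm
        rw [← Submodule.Quotient.mk_smul, Submodule.Quotient.mk_eq_zero, smul_eq_mul]
        obtain ⟨y, hy, z, hz, rfl⟩ := Submodule.mem_sup.mp ha
        obtain ⟨q, rfl⟩ := Ideal.mem_span_singleton'.mp hz
        rw [map_add, add_mul, map_mul, map_pow, mul_assoc]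
        exact Submodule.add_mem _
          (Submodule.mem_sup_right (Ideal.mul_mem_right _ _ (Ideal.mem_map_of_mem _ hy)))
          (Ideal.mul_mem_left _ _ (hK m hm))
    exact HasFFR.quotient (LinearMap.ker ρ).subtype ρ (Submodule.injective_subtype _)
      (LinearMap.exact_subtype_ker_map ρ) (Submodule.factor_surjective _) h2 h1
  · intro N₁ _ _ _ N₂ _ _ _ N₃ _ _ _ f g hf hg hfg h₁ h₃ hI
    refine HasFFR.extension f g hf hfg hg (h₁ ?_) (h₃ ?_)
    · intro a ha m
      exact hf (by rw [map_smul, hI a ha, map_zero])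
    · intro a ha m
      obtain ⟨m, rfl⟩ := hg m
      rw [← map_smul, hI a ha, map_zero]

end LaurentExtension
end PadicDet

open scoped TensorProduct

namespace PadicDet

universe u

/-! ### The group ring as an iterated Laurent polynomial ring -/

section GroupRing

open Polynomial

instance (N : ℕ) : IsDomain (GrpRing N) := NoZeroDivisors.to_isDomain _

instance (N : ℕ) : IsNoetherianRing (GrpRing N) :=
  Algebra.FiniteType.isNoetherianRing ℤ _

/-- `ℤ^{N+1} = ℤ × ℤ^N`. -/
def latSuccEquiv (N : ℕ) : Lat (N + 1) ≃+ ℤ × Lat N where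
  toFun v := (v 0, fun i => v i.succ)
  invFun x := Fin.cons x.1 x.2
  left_inv v := by ext i; refine Fin.cases ?_ (fun i => ?_) i <;> simp
  right_inv x := by ext <;> simp
  map_add' v w := rfl

/-- `ℤ[ℤ^{N+1}]` is the ring of Laurent polynomials over `ℤ[ℤ^N]`. -/
noncomputable def grpRingSuccEquiv (N : ℕ) :
    LaurentPolynomial (GrpRing N) ≃+* GrpRing (N + 1) :=
  ((AddMonoidAlgebra.domCongr ℤ ℤ (latSuccEquiv N)).toRingEquiv.trans
    AddMonoidAlgebra.curryRingEquiv).symm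

/-- The structure of `ℤ[ℤ^{N+1}]` as an algebra over `ℤ[ℤ^N][X]`. -/
noncomputable abbrev grpRingSuccAlgebra (N : ℕ) : Algebra (GrpRing N)[X] (GrpRing (N + 1)) :=
  ((grpRingSuccEquiv N).toRingHom.comp Polynomial.toLaurent).toAlgebra

theorem grpRingSucc_isLocalization (N : ℕ) :
    letI := grpRingSuccAlgebra N
    IsLocalization.Away (X : (GrpRing N)[X]) (GrpRing (N + 1)) := by
  let _ := grpRingSuccAlgebra N
  let e : LaurentPolynomial (GrpRing N) ≃ₐ[(GrpRing N)[X]] GrpRing (N + 1) :=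
    AlgEquiv.ofRingEquiv (f := grpRingSuccEquiv N) (fun _ => rfl)
  exact IsLocalization.isLocalization_of_algEquiv (Submonoid.powers (X : (GrpRing N)[X])) e

/-- `ℤ[ℤ^0] = ℤ`. -/
noncomputable def grpRingZeroEquiv : GrpRing 0 ≃+* ℤ := AddMonoidAlgebra.uniqueRingEquiv (Lat 0)

/-- Unique factorization passes to polynomial rings and to localizations. It is what recovers an
element, up to units, from its orders at the prime elements. -/
instance grpRing_uniqueFactorizationMonoid (N : ℕ) : UniqueFactorizationMonoid (GrpRing N) := by
  induction N with
  | zero => exact grpRingZeroEquiv.symm.toMulEquiv.uniqueFactorizationMonoid inferInstance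
  | succ N ih =>
    let _ := grpRingSuccAlgebra N
    have := grpRingSucc_isLocalization N
    exact UniqueFactorizationMonoid.of_isLocalization
      (Submonoid.powers (X : (GrpRing N)[X])) (GrpRing (N + 1))

theorem grpRing_hasFFR (N : ℕ) : ∀ (M : Type) [AddCommGroup M] [Module (GrpRing N) M]
    [Module.Finite (GrpRing N) M], HasFFR (GrpRing N) M := by
  induction N with
  | zero =>
    intro M _ _ _
    have : IsPrincipalIdealRing (GrpRing 0) :=
      IsPrincipalIdealRing.of_surjective grpRingZeroEquiv.symm.toRingHom
        grpRingZeroEquiv.symm.surjective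
    exact HasFFR.of_finite_of_pid M
  | succ N ih =>
    intro M _ _ _
    let _ := grpRingSuccAlgebra N
    have := grpRingSucc_isLocalization N
    let _ : Algebra (GrpRing N) (GrpRing (N + 1)) :=
      ((algebraMap (GrpRing N)[X] (GrpRing (N + 1))).comp C).toAlgebra
    have : IsScalarTower (GrpRing N) (GrpRing N)[X] (GrpRing (N + 1)) :=
      IsScalarTower.of_algebraMap_eq fun _ => rfl
    exact hasFFR_laurent (fun I => ih _) M

end GroupRing

/-! ### Existence of based resolutions -/

section BasedResolutions

variable {N : ℕ}

/-- Splices the nested covers in `FFR` into one complex: each cover of a kernel becomes a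
differential. The module is taken inside a free module because the successive kernels are of this
kind. -/
theorem FFR.exists_complex {R : Type u} [CommRing R] {n k : ℕ} (K : Submodule R (Fin k → R))
    (h : FFR R n K) : ∃ (rank : ℕ → ℕ) (_ : ∀ i, n ≤ i → rank i = 0)
      (d : ∀ i, (Fin (rank (i + 1)) → R) →ₗ[R] (Fin (rank i) → R))
      (a : (Fin (rank 0) → R) →ₗ[R] (Fin k → R)), LinearMap.range a = K ∧
        Function.Exact (d 0) a ∧ ∀ i, Function.Exact (d (i + 1)) (d i) := by
  induction n generalizing k with
  | zero =>
    have : Subsingleton K := h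
    refine ⟨fun _ => 0, fun _ _ => rfl, fun _ => 0, 0, ?_, ?_, ?_⟩
    · rw [LinearMap.range_zero, (Submodule.subsingleton_iff_eq_bot).mp this]
    · exact fun y => ⟨fun _ => ⟨0, Subsingleton.elim _ _⟩, fun _ => rfl⟩
    · exact fun _ y => ⟨fun _ => ⟨0, Subsingleton.elim _ _⟩, fun _ => Subsingleton.elim _ _⟩
  | succ n ih =>
    obtain ⟨r, f, hf, hk⟩ := h
    obtain ⟨rank, hrank, d, a, ha, h0, hs⟩ := ih _ hk
    let rank' : ℕ → ℕ := fun i => Nat.casesOn i r rank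
    let d' : ∀ i, (Fin (rank' (i + 1)) → R) →ₗ[R] (Fin (rank' i) → R) :=
      fun i => Nat.casesOn i a d
    refine ⟨rank', ?_, d', K.subtype ∘ₗ f, ?_, ?_, ?_⟩
    · rintro (_ | i) hi
      · omega
      · exact hrank i (by omega)
    · rw [LinearMap.range_comp, LinearMap.range_eq_top.mpr hf, Submodule.map_top,
        Submodule.range_subtype]
    · change Function.Exact a _
      rw [LinearMap.exact_iff, ha, LinearMap.ker_comp, Submodule.ker_subtype]
      rfl
    · rintro (_ | i)
      · exact h0
      · exact hs i

theorem nonempty_basedResolution (M : Type u) [AddCommGroup M] [Module (GrpRing N) M]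
    [Module.Finite (GrpRing N) M] : Nonempty (BasedResolution N M) := by
  obtain ⟨k, f, hf⟩ := Module.Finite.exists_fin' (GrpRing N) M
  -- Only the first syzygy is resolved: it lies in a free module, hence in `Type`, whatever the
  -- universe of `M`.
  obtain ⟨n, hn⟩ := grpRing_hasFFR N (LinearMap.ker f)
  obtain ⟨rank, hrank, d, a, ha, h0, hs⟩ := hn.exists_complex
  let rank' : ℕ → ℕ := fun i => Nat.casesOn i k rank
  let d' : ∀ i, (Fin (rank' (i + 1)) → GrpRing N) →ₗ[GrpRing N] (Fin (rank' i) → GrpRing N) :=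
    fun i => Nat.casesOn i a d
  refine ⟨⟨n + 1, rank', ?_, d', f, hf, ?_, ?_⟩⟩
  · rintro (_ | i) hi
    · omega
    · exact hrank i (by omega)
  · change Function.Exact a f
    rw [LinearMap.exact_iff, ha]
  · rintro (_ | i)
    · exact h0
    · exact hs i

end BasedResolutions

end PadicDet

open scoped TensorProduct

namespace PadicDet

universe u

set_option linter.unusedSectionVars false

/-! ### Graded matrices and determinants of their parity blocks -/

noncomputable section GradedMatrices

variable {ι : Type*} [Fintype ι] [DecidableEq ι] {A : Type*} [CommRing A]

/-- The matrix `X`, with rows and columns graded by `deg`, is homogeneous of degree `k`. -/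
def HomDeg (deg : ι → ℕ) (k : ℤ) (X : Matrix ι ι A) : Prop :=
  ∀ x y, X x y ≠ 0 → (deg y : ℤ) = deg x + k

theorem HomDeg.apply_eq_zero {deg : ι → ℕ} {k : ℤ} {X : Matrix ι ι A} (h : HomDeg deg k X)
    {x y : ι} (hxy : (deg y : ℤ) ≠ deg x + k) : X x y = 0 :=
  by_contra fun h' => hxy (h x y h')

theorem HomDeg.mul {deg : ι → ℕ} {k l : ℤ} {X Y : Matrix ι ι A} (hX : HomDeg deg k X)
    (hY : HomDeg deg l Y) : HomDeg deg (k + l) (X * Y) := by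
  intro x y h
  rw [Matrix.mul_apply] at h
  obtain ⟨z, -, hz⟩ := Finset.exists_ne_zero_of_sum_ne_zero h
  have h1 := hX x z (left_ne_zero_of_mul hz)
  have h2 := hY z y (right_ne_zero_of_mul hz)
  omega

theorem HomDeg.add {deg : ι → ℕ} {k : ℤ} {X Y : Matrix ι ι A} (hX : HomDeg deg k X)
    (hY : HomDeg deg k Y) : HomDeg deg k (X + Y) := by
  intro x y h
  by_cases hx : X x y = 0
  · exact hY x y fun hy => h (by rw [Matrix.add_apply, hx, hy, add_zero])
  · exact hX x y hx

theorem HomDeg.sub {deg : ι → ℕ} {k : ℤ} {X Y : Matrix ι ι A} (hX : HomDeg deg k X)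
    (hY : HomDeg deg k Y) : HomDeg deg k (X - Y) := by
  intro x y h
  by_cases hx : X x y = 0
  · exact hY x y fun hy => h (by rw [Matrix.sub_apply, hx, hy, sub_zero])
  · exact hX x y hx

theorem HomDeg.map {deg : ι → ℕ} {k : ℤ} {X : Matrix ι ι A} (hX : HomDeg deg k X) {B : Type*}
    [CommRing B] (φ : A →+* B) : HomDeg deg k (X.map φ) := by
  intro x y h
  exact hX x y fun h' => h (by rw [Matrix.map_apply, h', map_zero])

theorem HomDeg.smul {deg : ι → ℕ} {k : ℤ} {X : Matrix ι ι A} (hX : HomDeg deg k X) (c : A) :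
    HomDeg deg k (c • X) := by
  intro x y h
  exact hX x y fun h' => h (by rw [Matrix.smul_apply, h', smul_zero])

/-- A matrix which differs from the identity only by entries strictly raising the degree has
determinant one. -/
theorem det_eq_one_of_raising {deg : ι → ℕ} {U : Matrix ι ι A}
    (hU : ∀ x y, U x y ≠ (1 : Matrix ι ι A) x y → deg x < deg y) : U.det = 1 := by
  have hT : U.BlockTriangular deg := by
    intro x y hxy
    by_contra h
    have hne : x ≠ y := fun h' => by subst h'; exact lt_irrefl _ hxy
    have := hU x y (by rwa [Matrix.one_apply_ne hne])
    omega
  rw [hT.det]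
  refine Finset.prod_eq_one fun k _ => ?_
  have : U.toSquareBlock deg k = 1 := by
    ext ⟨x, hx⟩ ⟨y, hy⟩
    have h1 : U x y = (1 : Matrix ι ι A) x y := by
      by_contra h
      have := hU x y h
      omega
    rw [Matrix.toSquareBlock_def, Matrix.of_apply, h1, Matrix.one_apply, Matrix.one_apply]
    simp [Subtype.ext_iff]
  rw [this, Matrix.det_one]

open scoped Classical in
/-- The determinant of the block of `X` with rows in `p` and columns in `q`, the latter being
indexed by the former through `e`. -/
def blockDet (p q : ι → Prop) (e : {x // p x} ≃ {x // q x}) (X : Matrix ι ι A) : A :=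
  (X.submatrix (fun i : {x // p x} => (i : ι)) fun i => (e i : ι)).det

open scoped Classical in
theorem det_block_eq_one_of_raising {deg : ι → ℕ} {U : Matrix ι ι A} (p : ι → Prop)
    (hU : ∀ x y, U x y ≠ (1 : Matrix ι ι A) x y → deg x < deg y) :
    blockDet p p (Equiv.refl _) U = 1 := by
  refine det_eq_one_of_raising (deg := fun x : {x // p x} => deg (x : ι)) ?_
  intro x y h
  refine hU x y fun h' => h ?_
  rw [Matrix.submatrix_apply, Equiv.refl_apply, h', Matrix.one_apply, Matrix.one_apply]
  simp [Subtype.ext_iff]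

-- Rows in `p` have nonzero entries only in columns in `q`, so in the product the sum over all
-- intermediate indices is a sum over `q`.
open scoped Classical in
theorem blockDet_mul {p q r : ι → Prop} (e : {x // p x} ≃ {x // q x})
    (e' : {x // q x} ≃ {x // r x}) {X Y : Matrix ι ι A}
    (hX : ∀ x y, p x → X x y ≠ 0 → q y) :
    blockDet p r (e.trans e') (X * Y) = blockDet p q e X * blockDet q r e' Y := by
  have h2 : blockDet q r e' Y = (Y.submatrix (fun i : {x // p x} => (e i : ι))
      fun i => (e' (e i) : ι)).det := by
    rw [blockDet, ← Matrix.det_submatrix_equiv_self e]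
    rfl
  rw [h2, blockDet, blockDet, ← Matrix.det_mul]
  congr 1
  ext i j
  simp only [Matrix.submatrix_apply, Matrix.mul_apply, Equiv.trans_apply]
  rw [e.sum_comp (fun k : {x // q x} => X i k * Y k (e' (e j))),
    ← Fintype.sum_subtype_add_sum_subtype q, add_eq_left]
  refine Finset.sum_eq_zero fun k _ => ?_
  have : X i k = 0 := by_contra fun h => k.2 (hX i k i.2 h)
  rw [this, zero_mul]

/-- Needed because the parity conditions for `coneDeg` and `deg` are equivalent but not the same
predicates. -/
theorem blockDet_congr {p q p' q' : ι → Prop} (hp : ∀ x, p x ↔ p' x) (hq : ∀ x, q x ↔ q' x)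
    (e : {x // p x} ≃ {x // q x}) :
    ∃ e' : {x // p' x} ≃ {x // q' x}, ∀ X : Matrix ι ι A, blockDet p' q' e' X = blockDet p q e X := by
  obtain rfl : p = p' := funext fun x => propext (hp x)
  obtain rfl : q = q' := funext fun x => propext (hq x)
  exact ⟨e, fun _ => rfl⟩

open scoped Classical in
theorem blockDet_map {B : Type*} [CommRing B] (φ : A →+* B) {p q : ι → Prop}
    (e : {x // p x} ≃ {x // q x}) (X : Matrix ι ι A) :
    blockDet p q e (X.map φ) = φ (blockDet p q e X) := by
  rw [blockDet, blockDet, RingHom.map_det]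
  rfl

open scoped Classical in
theorem blockDet_reindex {p q : ι → Prop} (e : {x // p x} ≃ {x // q x}) {κ : Type*} [Fintype κ]
    [DecidableEq κ] (e' : {x // p x} ≃ κ) (X : Matrix ι ι A) :
    blockDet p q e X = (X.submatrix (fun i => (e'.symm i : ι)) fun i => (e (e'.symm i) : ι)).det := by
  rw [blockDet, ← Matrix.det_submatrix_equiv_self e'.symm]
  rfl

open scoped Classical in
theorem blockDet_scale {p q : ι → Prop} (e : {x // p x} ≃ {x // q x}) (z : ι → Prop)
    [DecidablePred z] (hz : ∀ x, z x → p x) (s : A) (g : ι → A) (X : Matrix ι ι A)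
    (hg : ∀ y, q y → g y = 1) :
    blockDet p q e (Matrix.diagonal (fun x => if z x then s else 1) * X * Matrix.diagonal g) =
      s ^ Nat.card {x // z x} * blockDet p q e X := by
  have h1 : s ^ Nat.card {x // z x} = ∏ x : {x // p x}, if z x then s else 1 := by
    have h2 := Fintype.prod_subtype_mul_prod_subtype p fun x => if z x then s else 1
    have h3 : ∏ x : {x // ¬ p x}, (if z x then s else 1) = 1 :=
      Finset.prod_eq_one fun x _ => if_neg fun h => x.2 (hz x h)
    rw [h3, mul_one] at h2
    rw [h2, Finset.prod_ite, Finset.prod_const, Finset.prod_const_one, mul_one,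
      Nat.card_eq_fintype_card, Fintype.card_subtype]
  rw [h1, blockDet, blockDet, ← Matrix.det_mul_column]
  congr 1
  ext i j
  simp [Matrix.mul_diagonal, Matrix.diagonal_mul, hg _ (e j).2]

/-! ### Contractions of a graded differential -/

/-- `H` is a chain contraction of the differential `D` of degree `-1`. -/
structure IsContraction (deg : ι → ℕ) (D H : Matrix ι ι A) : Prop where
  hom : HomDeg deg 1 H
  eq_one : D * H + H * D = 1

theorem HomDeg.swaps {deg : ι → ℕ} {D H : Matrix ι ι A} (hD : HomDeg deg (-1) D)
    (hH : HomDeg deg 1 H) (x y : ι) (h : (D + H) x y ≠ 0) : Odd (deg x) ↔ Even (deg y) := by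
  by_cases hx : D x y = 0
  · have hy := hH x y fun hy => h (by rw [Matrix.add_apply, hx, hy, add_zero])
    have : deg y = deg x + 1 := by exact_mod_cast hy
    rw [this, Nat.even_add_one, Nat.not_even_iff_odd]
  · have hy := hD x y hx
    have : deg x = deg y + 1 := by omega
    rw [this, Nat.odd_add_one, Nat.not_odd_iff_even]

/-- Degrees 2 and 4 are those of the error terms in products of two factors `∂ + δ`. -/
theorem raising_of_homDeg {deg : ι → ℕ} {V W : Matrix ι ι A} (hV : HomDeg deg 2 V)
    (hW : HomDeg deg 4 W) (x y : ι)
    (h : (1 + V + W) x y ≠ (1 : Matrix ι ι A) x y) : deg x < deg y := by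
  by_cases hx : V x y = 0
  · have := hW x y fun hy => h (by simp [Matrix.add_apply, hx, hy])
    omega
  · have := hV x y hx
    omega

variable {deg : ι → ℕ} {D H H' : Matrix ι ι A}

/-- The determinants of the odd and of the even part of `∂ + δ`, for two chain contractions `δ`,
are inverse to each other. -/
theorem blockDet_odd_mul_blockDet_even (hD : HomDeg deg (-1) D) (hDD : D * D = 0)
    (hH : IsContraction deg D H) (hH' : IsContraction deg D H')
    (e : {x // Odd (deg x)} ≃ {x // Even (deg x)}) :
    blockDet _ _ e (D + H) * blockDet _ _ e.symm (D + H') = 1 := by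
  -- The degree zero part of `(D + H) * (D + H')` is `D * H' + H * D`, which need not be `1`.
  -- Inserting the unipotent factor `1 + μ` adds `D * μ * D = D * H - D * H'` and corrects it to `D
  -- * H + H * D = 1`.
  let μ := H * (H' - H)
  have hμ : HomDeg deg 2 μ := hH.hom.mul (hH'.hom.sub hH.hom)
  have hU : blockDet _ _ (Equiv.refl {x // Even (deg x)}) (1 + μ) = 1 := by
    refine det_block_eq_one_of_raising (deg := deg) _ fun x y h => ?_
    refine raising_of_homDeg (W := 0) hμ (fun x y h => absurd rfl h) x y ?_
    rwa [add_zero]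
  have hDH : D * H' - D * H = -(H' * D - H * D) := by
    rw [eq_neg_iff_add_eq_zero, sub_add_sub_comm, hH.eq_one, hH'.eq_one, sub_self]
  have hDμD : D * μ * D = D * H - D * H' := by
    have h1 : (H' - H) * D = D * H - D * H' := by
      rw [sub_mul, ← neg_eq_iff_eq_neg.mpr hDH]; abel
    calc D * μ * D = D * H * ((H' - H) * D) := by simp only [μ, mul_assoc]
      _ = (1 - H * D) * (D * H - D * H') := by rw [h1, ← hH.eq_one, add_sub_cancel_right]
      _ = D * H - D * H' - H * (D * D) * H + H * (D * D) * H' := by noncomm_ring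
      _ = _ := by rw [hDD]; simp
  have hprod : (D + H) * (1 + μ) * (D + H') =
      1 + (H * H' + D * μ * H' + H * μ * D) + H * μ * H' := by
    calc (D + H) * (1 + μ) * (D + H') = D * D + (D * H' + H * D + D * μ * D) +
        (H * H' + D * μ * H' + H * μ * D) + H * μ * H' := by noncomm_ring
      _ = _ := by
        rw [hDD, hDμD, zero_add, show D * H' + H * D + (D * H - D * H') = D * H + H * D by abel,
          hH.eq_one]
  -- The remaining terms have degree 2 or 4, so the product is unipotent.
  have hfin : blockDet _ _ (Equiv.refl {x // Odd (deg x)}) ((D + H) * (1 + μ) * (D + H')) = 1 := by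
    rw [hprod]
    refine det_block_eq_one_of_raising (deg := deg) _ fun x y h => ?_
    exact raising_of_homDeg (((hH.hom.mul hH'.hom).add ((hD.mul hμ).mul hH'.hom)).add
      ((hH.hom.mul hμ).mul hD)) ((hH.hom.mul hμ).mul hH'.hom) x y h
  have hs := hD.swaps hH.hom
  rw [mul_assoc, ← e.self_trans_symm, blockDet_mul e e.symm fun x y hx h => (hs x y h).mp hx,
    ← Equiv.refl_trans e.symm, blockDet_mul (Equiv.refl _) e.symm, hU, one_mul] at hfin
  · exact hfin
  -- The factor `1 + μ` preserves parity since `μ` has degree two.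
  · intro x y hx h
    by_cases hxy : x = y
    · rwa [← hxy]
    · have h1 : μ x y ≠ 0 := by
        rwa [Matrix.add_apply, Matrix.one_apply_ne hxy, zero_add] at h
      have := hμ x y h1
      have : deg y = deg x + 2 := by exact_mod_cast this
      rw [this]
      exact hx.add (by decide)

/-- The determinant of the odd part of `∂ + δ` does not depend on the chain contraction `δ`. -/
theorem blockDet_odd_eq (hD : HomDeg deg (-1) D) (hDD : D * D = 0)
    (hH : IsContraction deg D H) (hH' : IsContraction deg D H')
    (e : {x // Odd (deg x)} ≃ {x // Even (deg x)}) :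
    blockDet _ _ e (D + H) = blockDet _ _ e (D + H') := by
  have h1 := blockDet_odd_mul_blockDet_even hD hDD hH hH' e
  have h2 := blockDet_odd_mul_blockDet_even hD hDD hH' hH' e
  -- Both odd determinants are inverse to the even determinant of `D + H'`.
  calc _ = blockDet _ _ e (D + H) * (blockDet _ _ e (D + H') * blockDet _ _ e.symm (D + H')) := by
        rw [h2, mul_one]
    _ = _ := by rw [mul_left_comm, h1, mul_one]

-- The block `Y` from `p` to `q` times the block `Z` from `q` to `p` is the `p`-block of `X²`, hence
-- invertible. So `Y` is surjective as a map `A^q → A^p`, which bounds the rank over a nontrivial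
-- commutative ring.
open scoped Classical in
theorem card_le_of_swaps [Nontrivial A] {p q : ι → Prop} {X : Matrix ι ι A}
    (hX : ∀ x y, p x → X x y ≠ 0 → q y)
    (hdet : blockDet p p (Equiv.refl _) (X * X) = 1) :
    Nat.card {x // p x} ≤ Nat.card {x // q x} := by
  rw [Nat.card_eq_fintype_card, Nat.card_eq_fintype_card]
  let Y : Matrix {x // p x} {x // q x} A := X.submatrix Subtype.val Subtype.val
  let Z : Matrix {x // q x} {x // p x} A := X.submatrix Subtype.val Subtype.val
  have hYZ : (X * X).submatrix (fun i : {x // p x} => (i : ι))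
      (fun i : {x // p x} => (i : ι)) = Y * Z := by
    ext i j
    simp only [Y, Z, Matrix.submatrix_apply, Matrix.mul_apply]
    rw [← Fintype.sum_subtype_add_sum_subtype q, add_eq_left]
    refine Finset.sum_eq_zero fun k _ => ?_
    have : X i k = 0 := by_contra fun h => k.2 (hX i k i.2 h)
    rw [this, zero_mul]
  have hu : IsUnit (Y * Z).det := by
    rw [← hYZ]
    exact IsUnit.of_mul_eq_one 1 ((mul_one _).trans hdet)
  have hs : Function.Surjective Y.mulVecLin := by
    intro v
    refine ⟨(Z * (Y * Z)⁻¹).mulVec v, ?_⟩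
    rw [Matrix.mulVecLin_apply, Matrix.mulVec_mulVec, ← Matrix.mul_assoc,
      Matrix.mul_nonsing_inv _ hu, Matrix.one_mulVec]
  exact card_le_of_surjective A Y.mulVecLin hs

/-- `(D + H)² = 1 + H²` is unipotent, so the rank comparison works in both directions. This is why
the matrix of `(∂ + δ)_odd` is square. -/
theorem nonempty_odd_equiv_even [Nontrivial A] (hD : HomDeg deg (-1) D) (hDD : D * D = 0)
    (hH : IsContraction deg D H) : Nonempty ({x // Odd (deg x)} ≃ {x // Even (deg x)}) := by
  classical
  have hs := hD.swaps hH.hom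
  have hsq : (D + H) * (D + H) = 1 + H * H + 0 := by
    rw [add_mul, mul_add, mul_add, hDD, ← hH.eq_one]
    abel
  have hdet : ∀ p : ι → Prop, blockDet p p (Equiv.refl _) ((D + H) * (D + H)) = 1 := by
    intro p
    rw [hsq]
    exact det_block_eq_one_of_raising (deg := deg) _ fun x y h =>
      raising_of_homDeg (hH.hom.mul hH.hom) (fun x y h => absurd rfl h) x y h
  refine Finite.card_eq.mp (le_antisymm ?_ ?_)
  · exact card_le_of_swaps (fun x y hx h => (hs x y h).mp hx) (hdet fun x => Odd (deg x))
  · refine card_le_of_swaps (X := D + H) (fun x y hx h => ?_) (hdet fun x => Even (deg x))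
    by_contra hy
    rw [Nat.not_odd_iff_even, ← hs x y h, ← Nat.not_even_iff_odd] at hy
    exact hy hx

end GradedMatrices
end PadicDet

open scoped TensorProduct

namespace PadicDet

universe u

set_option linter.unusedSectionVars false

/-! ### Null homotopies and the resolution shortened by one -/

noncomputable section GradedResolutions

variable {ι : Type*} [Fintype ι] [DecidableEq ι] {A : Type*} [CommRing A]

/-- The projection to the part of degree zero. -/
def degZero (deg : ι → ℕ) : Matrix ι ι A := Matrix.diagonal fun x => if deg x = 0 then 1 else 0

/-- The grading of the complex obtained from a complex by shifting the degrees down, the part of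
degree zero being moved to degree one. -/
def coneDeg (deg : ι → ℕ) (x : ι) : ℕ := if deg x = 0 then 1 else deg x - 1

/-- The differential for the grading `coneDeg`, given by the differential `D` in degrees at least
two and by `S` in degree zero. -/
def coneDiff (deg : ι → ℕ) (D S : Matrix ι ι A) : Matrix ι ι A :=
  D * (1 - degZero deg) + degZero deg * S

theorem degZero_mul_self (deg : ι → ℕ) : (degZero deg * degZero deg : Matrix ι ι A) = degZero deg := by
  rw [degZero, Matrix.diagonal_mul_diagonal]
  congr 1
  ext x
  split_ifs <;> simp

theorem degZero_map {B : Type*} [CommRing B] (φ : A →+* B) (deg : ι → ℕ) :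
    (degZero deg : Matrix ι ι A).map φ = degZero deg := by
  rw [degZero, Matrix.diagonal_map (map_zero φ)]
  congr 1
  ext x
  split_ifs <;> simp

variable {deg : ι → ℕ}

theorem HomDeg.degZero_mul {D : Matrix ι ι A} (hD : HomDeg deg (-1) D) : degZero deg * D = 0 := by
  ext x y
  rw [degZero, Matrix.diagonal_mul, Matrix.zero_apply]
  split_ifs with h
  · rw [one_mul]
    exact hD.apply_eq_zero (by omega)
  · rw [zero_mul]

theorem HomDeg.mul_degZero {H : Matrix ι ι A} (hH : HomDeg deg 1 H) : H * degZero deg = 0 := by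
  ext x y
  rw [degZero, Matrix.mul_diagonal, Matrix.zero_apply]
  split_ifs with h
  · rw [mul_one]
    exact hH.apply_eq_zero (by omega)
  · rw [mul_zero]

theorem coneDiff_homDeg {D S : Matrix ι ι A} (hD : HomDeg deg (-1) D) (hS : HomDeg deg 1 S) :
    HomDeg (coneDeg deg) (-1) (coneDiff deg D S) := by
  refine HomDeg.add ?_ ?_
  · intro x y h
    rw [degZero, ← Matrix.diagonal_one, Matrix.diagonal_sub, Matrix.mul_diagonal] at h
    have h1 := hD x y (left_ne_zero_of_mul h)
    have h2 : deg y ≠ 0 := fun h2 => right_ne_zero_of_mul h (by simp [h2])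
    have h3 : deg x ≠ 0 := by omega
    simp only [coneDeg, h2, h3, if_false]
    omega
  · intro x y h
    rw [degZero, Matrix.diagonal_mul] at h
    have h1 := hS x y (right_ne_zero_of_mul h)
    have h2 : deg x = 0 := by
      by_contra h2
      exact left_ne_zero_of_mul h (by simp [h2])
    have h3 : deg y ≠ 0 := by omega
    simp only [coneDeg, h2, h3, if_false, if_true]
    omega

/-- The critical composite is `F₀ → F₁ → F₀`, first `S` and then `D`. On `F₀` it equals `s`, with
target in degree zero, and the factor `1 - degZero deg` removes it. -/
theorem coneDiff_mul_self {D S : Matrix ι ι A} {s : A} (hD : HomDeg deg (-1) D)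
    (hS : HomDeg deg 1 S) (hDD : D * D = 0) (hDS : D * S + S * D = s • (1 : Matrix ι ι A)) :
    coneDiff deg D S * coneDiff deg D S = 0 := by
  have h1 := hD.degZero_mul
  have h2 := hS.mul_degZero
  have h3 := degZero_mul_self (A := A) deg
  have h4 : S * D = s • (1 : Matrix ι ι A) - D * S := eq_sub_of_add_eq' hDS
  unfold coneDiff
  generalize (degZero deg : Matrix ι ι A) = P at h1 h2 h3 ⊢
  -- Right-associated forms of the relations, so that `simp` can rewrite inside longer products.
  have h1' : ∀ X, P * (D * X) = 0 := fun X => by rw [← mul_assoc, h1, zero_mul]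
  have h2' : ∀ X, S * (P * X) = 0 := fun X => by rw [← mul_assoc, h2, zero_mul]
  have h3' : ∀ X, P * (P * X) = P * X := fun X => by rw [← mul_assoc, h3]
  have h4' : ∀ X, S * (D * X) = s • X - D * (S * X) := fun X => by
    rw [← mul_assoc, h4, sub_mul, smul_mul_assoc, one_mul, mul_assoc]
  have h5' : ∀ X, D * (D * X) = 0 := fun X => by rw [← mul_assoc, hDD, zero_mul]
  simp [mul_add, add_mul, mul_sub, sub_mul, mul_assoc, h1, h2, h3, h4, h1', h2', h3', h4', hDD, h5']

/-- The chain contraction of the complex `coneDiff`. -/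
theorem coneDiff_isContraction {D H : Matrix ι ι A} {s c : A} (hsc : c * s = 1)
    (hD : HomDeg deg (-1) D) (hDD : D * D = 0) (hH : IsContraction deg D H) (hHH : H * H = 0) :
    IsContraction (coneDeg deg) (coneDiff deg D (s • H))
      ((1 - degZero deg) * H + c • (D * degZero deg)) := by
  constructor
  · refine HomDeg.add ?_ (HomDeg.smul ?_ c)
    · intro x y h
      rw [degZero, ← Matrix.diagonal_one, Matrix.diagonal_sub, Matrix.diagonal_mul] at h
      have h1 := hH.hom x y (right_ne_zero_of_mul h)
      have h2 : deg x ≠ 0 := fun h2 => left_ne_zero_of_mul h (by simp [h2])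
      have h3 : deg y ≠ 0 := by omega
      simp only [coneDeg, h2, h3, if_false]
      omega
    · intro x y h
      rw [degZero, Matrix.mul_diagonal] at h
      have h1 := hD x y (left_ne_zero_of_mul h)
      have h2 : deg y = 0 := by
        by_contra h2
        exact right_ne_zero_of_mul h (by simp [h2])
      have h3 : deg x ≠ 0 := by omega
      simp only [coneDeg, h2, h3, if_false, if_true]
      omega
  -- The hypothesis `H * H = 0` kills the composite of `s • (P * H)`, on `F₀`, with the contraction
  -- on `F₁`, where `P` is the projection to degree zero.
  · have h1 := hD.degZero_mul
    have h2 := hH.hom.mul_degZero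
    have h3 := degZero_mul_self (A := A) deg
    have h4 : H * D = 1 - D * H := eq_sub_of_add_eq' hH.eq_one
    unfold coneDiff
    generalize (degZero deg : Matrix ι ι A) = P at h1 h2 h3 ⊢
    have h1' : ∀ X, P * (D * X) = 0 := fun X => by rw [← mul_assoc, h1, zero_mul]
    have h2' : ∀ X, H * (P * X) = 0 := fun X => by rw [← mul_assoc, h2, zero_mul]
    have h3' : ∀ X, P * (P * X) = P * X := fun X => by rw [← mul_assoc, h3]
    have h4' : ∀ X, H * (D * X) = X - D * (H * X) := fun X => by
      rw [← mul_assoc, h4, sub_mul, one_mul, mul_assoc]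
    have h5' : ∀ X, D * (D * X) = 0 := fun X => by rw [← mul_assoc, hDD, zero_mul]
    have hcs : s * c = 1 := (mul_comm _ _).trans hsc
    simp [mul_add, add_mul, mul_sub, sub_mul, mul_assoc, h1, h2, h3, h4, h1', h2', h3', h4',
      h5', hHH, smul_smul, hsc, hcs]
    abel

/-- Links the two torsions: `∂ + δ` of the shortened complex is the old `D + H` with degree zero
rows scaled by `s` and degree zero columns by `s⁻¹`. In the block from even to odd degrees only the
row scaling is visible, whence the factor `s ^ rank F₀`. -/
theorem coneDiff_add_contraction {D H : Matrix ι ι A} {s c : A}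
    (hD : HomDeg deg (-1) D) (hH : HomDeg deg 1 H) :
    coneDiff deg D (s • H) + ((1 - degZero deg) * H + c • (D * degZero deg)) =
      Matrix.diagonal (fun x => if deg x = 0 then s else 1) * (D + H) *
        Matrix.diagonal (fun x => if deg x = 0 then c else 1) := by
  have hd : ∀ a : A, Matrix.diagonal (fun x => if deg x = 0 then a else 1) =
      1 - degZero deg + a • degZero deg := by
    intro a
    rw [degZero, ← Matrix.diagonal_one, Matrix.diagonal_sub, ← Matrix.diagonal_smul,
      Matrix.diagonal_add]
    congr 1
    ext x
    by_cases h : deg x = 0 <;> simp [h]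
  rw [hd, hd]
  have h1 := hD.degZero_mul
  have h2 := hH.mul_degZero
  unfold coneDiff
  generalize (degZero deg : Matrix ι ι A) = P at h1 h2 ⊢
  simp [mul_add, add_mul, mul_sub, sub_mul, mul_assoc, h1, h2]
  abel

theorem odd_coneDeg (x : ι) : Odd (coneDeg deg x) ↔ Even (deg x) := by
  unfold coneDeg
  split_ifs with h
  · simp [h]
  · rw [← Nat.not_even_iff_odd, Nat.even_sub (by omega)]
    simp

theorem even_coneDeg (x : ι) : Even (coneDeg deg x) ↔ Odd (deg x) := by
  rw [← Nat.not_odd_iff_even, odd_coneDeg, Nat.not_even_iff_odd]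

/-- A null homotopy of multiplication by `s` can be replaced by one of square zero. -/
theorem square_zero_homotopy {D S : Matrix ι ι A} {s : A} (hDD : D * D = 0)
    (hDS : D * S + S * D = s • (1 : Matrix ι ι A)) :
    D * (S * D * S) + S * D * S * D = (s * s) • (1 : Matrix ι ι A) ∧
      S * D * S * (S * D * S) = 0 := by
  -- The reason behind the computation: `S * S` commutes with `D`, so `D * S * S * D = 0`.
  have h4 : S * D = s • (1 : Matrix ι ι A) - D * S := eq_sub_of_add_eq' hDS
  have h4' : ∀ X, S * (D * X) = s • X - D * (S * X) := fun X => by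
    rw [← mul_assoc, h4, sub_mul, smul_mul_assoc, one_mul, mul_assoc]
  have h5' : ∀ X, D * (D * X) = 0 := fun X => by rw [← mul_assoc, hDD, zero_mul]
  constructor <;>
  simp [mul_sub, sub_mul, mul_assoc, h4, h4', h5', smul_smul, smul_sub]

/-- `D` and `aug` are a resolution of `M` by finitely generated free modules; the basis `ι` of the
total module is graded by `deg`. -/
structure GradedRes {M : Type*} [AddCommGroup M] [Module A M] (deg : ι → ℕ) (D : Matrix ι ι A)
    (aug : (ι → A) →ₗ[A] M) : Prop where
  hom : HomDeg deg (-1) D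
  sq : D * D = 0
  surjective : Function.Surjective aug
  aug_of_pos : ∀ v, (∀ x, deg x = 0 → v x = 0) → aug v = 0
  aug_vecMul : ∀ v, aug (Matrix.vecMul v D) = 0
  exact_zero : ∀ v, (∀ x, deg x ≠ 0 → v x = 0) → aug v = 0 →
    ∃ w, (∀ x, deg x ≠ 1 → w x = 0) ∧ Matrix.vecMul w D = v
  exact_succ : ∀ n v, (∀ x, deg x ≠ n + 1 → v x = 0) → Matrix.vecMul v D = 0 →
    ∃ w, (∀ x, deg x ≠ n + 2 → w x = 0) ∧ Matrix.vecMul w D = v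

variable {M : Type*} [AddCommGroup M] [Module A M] {D : Matrix ι ι A} {aug : (ι → A) →ₗ[A] M}

/-- If `s` kills `M`, then multiplication by `s` is null homotopic on each resolution of `M`. -/
theorem GradedRes.exists_homotopy (hres : GradedRes deg D aug) {s : A} (hs : ∀ m : M, s • m = 0) :
    ∃ S : Matrix ι ι A, HomDeg deg 1 S ∧ D * S + S * D = s • (1 : Matrix ι ι A) := by
  have H : ∀ n, ∃ S : Matrix ι ι A, HomDeg deg 1 S ∧
      ∀ x y, deg x < n → (D * S + S * D) x y = (s • (1 : Matrix ι ι A)) x y := by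
    intro n
    induction n with
    | zero => exact ⟨0, fun x y h => absurd rfl h, fun x y h => absurd h (Nat.not_lt_zero _)⟩
    | succ n ih =>
      -- The homotopy is built degree by degree. The defect `E` of degree zero has cycles as its
      -- rows in degree `n`, because the homotopy relation already holds below `n`; exactness lifts
      -- these rows.
      obtain ⟨S, hS, hn⟩ := ih
      let E : Matrix ι ι A := s • (1 : Matrix ι ι A) - D * S
      have hE0 : HomDeg deg 0 E := by
        refine HomDeg.sub (HomDeg.smul ?_ s) (hres.hom.mul hS)
        intro x y h
        have : x = y := by by_contra hxy; exact h (Matrix.one_apply_ne hxy)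
        simp [this]
      have hED : ∀ x, deg x = n → ∀ y, (E * D) x y = 0 := by
        intro x hx y
        have h1 : E * D = D * (s • (1 : Matrix ι ι A) - (D * S + S * D)) + D * D * S := by
          simp only [E, sub_mul, mul_sub, mul_add, smul_mul_assoc, mul_smul_comm, one_mul, mul_one,
            mul_assoc]
          abel
        rw [h1, hres.sq, zero_mul, add_zero, Matrix.mul_apply]
        refine Finset.sum_eq_zero fun z _ => ?_
        by_cases hz : D x z = 0
        · rw [hz, zero_mul]
        · have := hres.hom x z hz
          rw [Matrix.sub_apply, hn z y (by omega), sub_self, mul_zero]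
      have hw : ∀ x, deg x = n → ∃ w : ι → A, (∀ y, deg y ≠ n + 1 → w y = 0) ∧
          Matrix.vecMul w D = E x := by
        intro x hx
        have hsupp : ∀ y, deg y ≠ n → E x y = 0 := fun y hy => hE0.apply_eq_zero (by omega)
        have hcyc : Matrix.vecMul (E x) D = 0 := by
          ext y
          exact hED x hx y
        cases n with
        | zero =>
          refine hres.exact_zero _ hsupp ?_
          -- In degree zero `D` vanishes, so the defect is `s` times a basis vector; it dies under
          -- the augmentation because `s` kills `M`.
          have h1 : E x = s • Pi.single x 1 := by
            ext y
            have h2 : (D * S) x y = 0 := by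
              rw [Matrix.mul_apply]
              refine Finset.sum_eq_zero fun z _ => ?_
              rw [hres.hom.apply_eq_zero (by omega), zero_mul]
            simp only [E, Matrix.sub_apply, h2, sub_zero, Matrix.smul_apply, Pi.smul_apply]
            rw [Matrix.one_apply, Pi.single_apply]
            simp [eq_comm]
          rw [h1, map_smul, hs]
        | succ n => exact hres.exact_succ n _ hsupp hcyc
      choose! w hw0 hw1 using hw
      let S' : Matrix ι ι A := fun x y => if deg x = n then w x y else S x y
      refine ⟨S', ?_, ?_⟩
      · intro x y h
        by_cases hx : deg x = n
        · have h' : w x y ≠ 0 := by simpa [S', hx] using h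
          by_contra hy
          exact h' (hw0 x hx y (by omega))
        · exact hS x y (by simpa [S', hx] using h)
      · intro x y hx
        have h1 : (D * S') x y = (D * S) x y := by
          rw [Matrix.mul_apply, Matrix.mul_apply]
          refine Finset.sum_congr rfl fun z _ => ?_
          by_cases hz : D x z = 0
          · rw [hz, zero_mul, zero_mul]
          · have := hres.hom x z hz
            have hz' : deg z ≠ n := by omega
            simp [S', hz']
        by_cases hxn : deg x = n
        · have h2 : (S' * D) x y = E x y := by
            rw [← hw1 x hxn]
            change _ = ∑ z, w x z * D z y
            rw [Matrix.mul_apply]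
            refine Finset.sum_congr rfl fun z _ => ?_
            simp [S', hxn]
          rw [Matrix.add_apply, h1, h2]
          simp [E]
        · have h2 : (S' * D) x y = (S * D) x y := by
            rw [Matrix.mul_apply, Matrix.mul_apply]
            refine Finset.sum_congr rfl fun z _ => ?_
            simp [S', hxn]
          rw [Matrix.add_apply, h1, h2, ← Matrix.add_apply]
          exact hn x y (by omega)
  -- Beyond the largest degree of a basis element nothing is left to construct.
  obtain ⟨S, hS, h⟩ := H (Finset.univ.sup deg + 1)
  refine ⟨S, hS, ?_⟩
  ext x y
  exact h x y (Nat.lt_succ_of_le (Finset.le_sup (Finset.mem_univ x)))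

/-- The resolution with differential `coneDiff` of the kernel of `Q → M`, where `Q = F₀ / s F₀`. -/
theorem GradedRes.cone [IsDomain A] (hres : GradedRes deg D aug) {S : Matrix ι ι A} {s : A}
    (hs0 : s ≠ 0) (hS : HomDeg deg 1 S) (hDS : D * S + S * D = s • (1 : Matrix ι ι A))
    {Q : Type*} [AddCommGroup Q] [Module A Q] (π : (ι → A) →ₗ[A] Q) (hπ : Function.Surjective π)
    (hπ0 : ∀ v, π v = 0 ↔ ∃ u : ι → A, ∀ x, deg x = 0 → v x = s * u x) (g : Q →ₗ[A] M)
    (hg : ∀ v, g (π v) = aug v) :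
    ∃ aug' : (ι → A) →ₗ[A] LinearMap.ker g,
      GradedRes (coneDeg deg) (coneDiff deg D S) aug' := by
  have hP : ∀ v : ι → A, ∀ x, Matrix.vecMul v (degZero deg) x = if deg x = 0 then v x else 0 := by
    intro v x
    rw [degZero, Matrix.vecMul_diagonal]
    split_ifs <;> simp
  have hvm : ∀ (v : ι → A) (X : Matrix ι ι A) (x : ι),
      Matrix.vecMul v X x = ∑ z, v z * X z x := fun _ _ _ => rfl
  have hSD : S * D = s • (1 : Matrix ι ι A) - D * S := eq_sub_of_add_eq' hDS
  have h1 := hres.hom.degZero_mul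
  have h2 := hS.mul_degZero
  have hcone : ∀ v, Matrix.vecMul v (coneDiff deg D S) =
      Matrix.vecMul v D - Matrix.vecMul (Matrix.vecMul v D) (degZero deg) +
        Matrix.vecMul (Matrix.vecMul v (degZero deg)) S := by
    intro v
    rw [coneDiff, Matrix.vecMul_add, ← Matrix.vecMul_vecMul, Matrix.vecMul_sub, Matrix.vecMul_one,
      Matrix.vecMul_vecMul v (degZero deg)]
  -- the support of `v ᵥ* D`
  have hsuppD : ∀ (n : ℕ) (v : ι → A), (∀ x, deg x ≠ n + 1 → v x = 0) → ∀ x, deg x ≠ n →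
      Matrix.vecMul v D x = 0 := by
    intro n v hv x hx
    rw [hvm]
    refine Finset.sum_eq_zero fun z _ => ?_
    by_cases hz : deg z = n + 1
    · rw [hres.hom.apply_eq_zero (by omega), mul_zero]
    · rw [hv z hz, zero_mul]
  have hPv : ∀ v : ι → A, (∀ x, deg x = 0 → v x = 0) → Matrix.vecMul v (degZero deg) = 0 := by
    intro v hv
    ext x
    rw [hP]
    split_ifs with h
    · exact hv x h
    · rfl
  -- The new differential followed by `D` is `s` times the projection to `F₀`, hence zero in `Q`.
  -- The same identity later isolates the `F₀`-component of a cycle.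
  have hconeD : ∀ v, Matrix.vecMul (Matrix.vecMul v (coneDiff deg D S)) D =
      s • Matrix.vecMul v (degZero deg) := by
    intro v
    have : coneDiff deg D S * D = s • degZero deg := by
      rw [coneDiff, add_mul, mul_assoc, mul_assoc, sub_mul, h1, one_mul, sub_zero, hres.sq, hSD,
        mul_sub, ← mul_assoc, h1, zero_mul, sub_zero, mul_smul_comm, mul_one, zero_add]
    rw [Matrix.vecMul_vecMul, this, Matrix.vecMul_smul]
  have hdeg0 : ∀ x, coneDeg deg x = 0 ↔ deg x = 1 := by
    intro x
    by_cases h : deg x = 0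
    · simp [coneDeg, h]
    · simp only [coneDeg, h, if_false]
      omega
  have hmem : ∀ v, π (Matrix.vecMul v D) ∈ LinearMap.ker g := by
    intro v
    rw [LinearMap.mem_ker, hg, hres.aug_vecMul]
  let aug' : (ι → A) →ₗ[A] LinearMap.ker g :=
    (π ∘ₗ D.vecMulLinear).codRestrict _ hmem
  have haug' : ∀ v, aug' v = 0 ↔ π (Matrix.vecMul v D) = 0 := fun v => by
    rw [Subtype.ext_iff]; rfl
  refine ⟨aug', coneDiff_homDeg hres.hom hS, coneDiff_mul_self hres.hom hS hres.sq hDS, ?_, ?_, ?_,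
    ?_, ?_⟩
  · rintro ⟨q, hq⟩
    obtain ⟨u, rfl⟩ := hπ q
    have hu' : aug (Matrix.vecMul u (degZero deg)) = 0 := by
      have h3 : aug u = 0 := by rw [← hg]; exact hq
      have h4 : aug (Matrix.vecMul u (degZero deg) - u) = 0 := by
        refine hres.aug_of_pos _ fun x hx => ?_
        rw [Pi.sub_apply, hP, if_pos hx, sub_self]
      rwa [map_sub, h3, sub_zero] at h4
    obtain ⟨w, -, hw⟩ := hres.exact_zero _ (fun x hx => by rw [hP, if_neg hx]) hu'
    refine ⟨w, Subtype.ext ?_⟩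
    change π (Matrix.vecMul w D) = π u
    rw [hw, ← sub_eq_zero, ← map_sub, hπ0]
    refine ⟨0, fun x hx => ?_⟩
    rw [Pi.sub_apply, hP, if_pos hx, sub_self, Pi.zero_apply, mul_zero]
  · intro v hv
    rw [haug', hπ0]
    refine ⟨0, fun x hx => ?_⟩
    rw [Pi.zero_apply, mul_zero]
    rw [hvm]
    refine Finset.sum_eq_zero fun z _ => ?_
    by_cases hz : deg z = 1
    · rw [hv z ((hdeg0 z).mpr hz), zero_mul]
    · rw [hres.hom.apply_eq_zero (by omega), mul_zero]
  · intro v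
    rw [haug', hconeD, hπ0]
    refine ⟨v, fun x hx => ?_⟩
    rw [Pi.smul_apply, hP, if_pos hx, smul_eq_mul]
  -- Exactness at `F₁`: if `v D = s u` on `F₀`, then `v - u' S` is a cycle of the old complex, where
  -- `u'` is the degree zero part of `u`. Writing it as `w D` exhibits `v` as the image of `w + u'`.
  · intro v hv hv0
    obtain ⟨u, hu⟩ := (hπ0 _).mp ((haug' v).mp hv0)
    let u' := Matrix.vecMul u (degZero deg)
    have hvsupp : ∀ x, deg x ≠ 0 + 1 → v x = 0 := fun x hx => hv x fun h => hx ((hdeg0 x).mp h)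
    have hu'D : Matrix.vecMul u' D = 0 := by
      rw [Matrix.vecMul_vecMul, h1, Matrix.vecMul_zero]
    have hu'S : Matrix.vecMul (Matrix.vecMul u' S) D = s • u' := by
      rw [Matrix.vecMul_vecMul, hSD, Matrix.vecMul_sub, Matrix.vecMul_smul, Matrix.vecMul_one,
        ← Matrix.vecMul_vecMul, hu'D, Matrix.zero_vecMul, sub_zero]
    have hu'Ssupp : ∀ x, deg x ≠ 1 → Matrix.vecMul u' S x = 0 := by
      intro x hx
      rw [hvm]
      refine Finset.sum_eq_zero fun z _ => ?_
      by_cases hz : deg z = 0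
      · rw [hS.apply_eq_zero (by omega), mul_zero]
      · change Matrix.vecMul u (degZero deg) z * _ = 0
        rw [hP, if_neg hz, zero_mul]
    have hcyc : Matrix.vecMul (v - Matrix.vecMul u' S) D = 0 := by
      rw [Matrix.sub_vecMul, hu'S, sub_eq_zero]
      ext x
      rw [Pi.smul_apply, smul_eq_mul]
      change _ = s * Matrix.vecMul u (degZero deg) x
      rw [hP]
      split_ifs with hx
      · exact hu x hx
      · rw [mul_zero]
        exact hsuppD 0 v hvsupp x hx
    obtain ⟨w, hw, hwD⟩ := hres.exact_succ 0 _ (fun x hx => by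
      rw [Pi.sub_apply, hvsupp x hx, hu'Ssupp x hx, sub_zero]) hcyc
    refine ⟨w + u', ?_, ?_⟩
    · intro x hx
      have hx0 : deg x ≠ 0 := fun h => hx (by simp [coneDeg, h])
      have hx2 : deg x ≠ 0 + 2 := fun h => hx (by simp [coneDeg, h])
      rw [Pi.add_apply, hw x hx2, zero_add]
      change Matrix.vecMul u (degZero deg) x = 0
      rw [hP, if_neg hx0]
    · have h3 : Matrix.vecMul (Matrix.vecMul w D) (degZero deg) = 0 := by
        rw [hwD]
        refine hPv _ fun x hx => ?_
        rw [Pi.sub_apply, hvsupp x (by omega), hu'Ssupp x (by omega), sub_zero]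
      have h4 : Matrix.vecMul w (degZero deg) = 0 := hPv _ fun x hx => hw x (by omega)
      have h5 : Matrix.vecMul u' (degZero deg) = u' := by
        rw [Matrix.vecMul_vecMul, degZero_mul_self]
      rw [hcone, Matrix.add_vecMul, Matrix.add_vecMul, Matrix.add_vecMul, h3, h4, h5, hu'D, hwD,
        Matrix.zero_vecMul]
      simp
  -- A cycle in positive degree satisfies `s • v₀ = 0` for its `F₀`-component `v₀`. As `s ≠ 0` in a
  -- domain, `v₀ = 0` and the old exactness applies.
  · intro n v hv hv0
    have h3 : Matrix.vecMul v (degZero deg) = 0 := by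
      have := hconeD v
      rw [hv0, Matrix.zero_vecMul] at this
      exact (smul_eq_zero.mp this.symm).resolve_left hs0
    have h30 : ∀ x, deg x = 0 → v x = 0 := fun x hx => by
      have := congrFun h3 x
      rwa [hP, if_pos hx] at this
    have hvsupp : ∀ x, deg x ≠ (n + 1) + 1 → v x = 0 := fun x hx => by
      by_cases hx0 : deg x = 0
      · exact h30 x hx0
      · refine hv x fun h => ?_
        rw [coneDeg, if_neg hx0] at h
        omega
    have h4 : Matrix.vecMul (Matrix.vecMul v D) (degZero deg) = 0 :=
      hPv _ fun x hx => hsuppD (n + 1) v hvsupp x (by omega)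
    have h5 : Matrix.vecMul v D = 0 := by
      have := hcone v
      rwa [hv0, h3, h4, Matrix.zero_vecMul, sub_zero, add_zero, eq_comm] at this
    obtain ⟨w, hw, hwD⟩ := hres.exact_succ (n + 1) v hvsupp h5
    refine ⟨w, ?_, ?_⟩
    · intro x hx
      by_cases hx3 : deg x = n + 1 + 2
      · exact absurd (by simp [coneDeg, hx3]) hx
      · exact hw x hx3
    · have h6 : Matrix.vecMul w (degZero deg) = 0 := hPv _ fun x hx => hw x (by omega)
      rw [hcone, hwD, h3, h6, Matrix.zero_vecMul, sub_zero, add_zero]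

end GradedResolutions

end PadicDet

open scoped TensorProduct

namespace PadicDet

universe u

set_option linter.unusedSectionVars false

/-! ### The torsion over the localization and the boundary map -/

noncomputable section BoundaryOfTorsion

variable {p : ℕ} [Fact p.Prime] {N : ℕ}

/-- The product of annihilators of finitely many generators lies in `S_p` and kills the whole
module. -/
theorem exists_mem_Sp_smul_eq_zero {M : Type u} [AddCommGroup M] [Module (GrpRing N) M]
    [hfin : Module.Finite (GrpRing N) M] (hT : IsSpTorsion p N M) :
    ∃ s ∈ Sp p N, ∀ m : M, s • m = 0 := by
  obtain ⟨S, hS⟩ := hfin.fg_top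
  choose s hs hsm using hT
  refine ⟨∏ m ∈ S, s m, prod_mem fun m _ => hs m, fun m => ?_⟩
  have hm : m ∈ Submodule.span (GrpRing N) (S : Set M) := hS ▸ Submodule.mem_top
  induction hm using Submodule.span_induction with
  | mem x hx =>
    obtain ⟨c, hc⟩ := Finset.dvd_prod_of_mem s hx
    rw [hc, mul_comm, mul_smul, hsm, smul_zero]
  | zero => rw [smul_zero]
  | add x y _ _ hx hy => rw [smul_add, hx, hy, add_zero]
  | smul a x _ hx => rw [smul_comm, hx, smul_zero]

/-- The matrices `g` over `R` with `det g ∈ S_p` give elements of `K₁(R[S_p⁻¹])` with boundary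
`[coker g]`. -/
theorem exists_delta_eq_cokerMod {r : ℕ} (g : Matrix (Fin r) (Fin r) (GrpRing N))
    (hg : g.det ∈ Sp p N) : ∃ ξ : K1 (Loc p N),
      delta.{u} p N ξ = Multiplicative.ofAdd (K0.cls (cokerMod.{u} g hg)) ∧
      (K1.det ξ : Loc p N) = algebraMap (GrpRing N) (Loc p N) g.det := by
  have hdet : (g.map (algebraMap (GrpRing N) (Loc p N))).det =
      algebraMap (GrpRing N) (Loc p N) g.det := by
    rw [RingHom.map_det, RingHom.mapMatrix_apply]
  have hu : IsUnit (g.map (algebraMap (GrpRing N) (Loc p N))).det := by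
    rw [hdet]
    exact IsLocalization.map_units (Loc p N) (⟨g.det, hg⟩ : Sp p N)
  let f : Matrix.GeneralLinearGroup (Fin r) (Loc p N) := Matrix.nonsingInvUnit _ hu
  have hf : IsFraction f 1 g := ⟨one_mem _, by rw [map_one, one_smul]; rfl⟩
  refine ⟨K1.mk r f, ?_, hdet⟩
  have h1 : delta.{u} p N (K1.mk r f) = deltaGL p N r f := rfl
  rw [h1, deltaGL_eq hf, fractionCls, cls_cokerMod_isUnit (g := Matrix.scalar (Fin r) 1), sub_zero]
  simp

section Presentation

variable {ι : Type*} [Fintype ι] [DecidableEq ι] {deg : ι → ℕ}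
  {D : Matrix ι ι (GrpRing N)}

/-- The class of a module in terms of the kernel of a presentation of it by `F₀ / s F₀`. -/
theorem GradedRes.exists_cone {M : TorsMod.{u} p N} {aug : (ι → GrpRing N) →ₗ[GrpRing N] M.carrier}
    (hres : GradedRes deg D aug) {S : Matrix ι ι (GrpRing N)} {s : GrpRing N} (hs : s ∈ Sp p N)
    (hS : HomDeg deg 1 S) (hDS : D * S + S * D = s • (1 : Matrix ι ι (GrpRing N))) :
    ∃ (M' : TorsMod.{u} p N) (aug' : (ι → GrpRing N) →ₗ[GrpRing N] M'.carrier),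
      GradedRes (coneDeg deg) (coneDiff deg D S) aug' ∧
      K0.cls (cokerMod.{u} (Matrix.scalar (Fin (Nat.card {x // deg x = 0})) s)
        (scalar_det_mem hs _)) = K0.cls M' + K0.cls M := by
  let n := Nat.card {x // deg x = 0}
  let e : {x // deg x = 0} ≃ Fin n := Finite.equivFin _
  let Q := cokerMod.{u} (Matrix.scalar (Fin n) s) (scalar_det_mem hs _)
  let emb : (Fin n → GrpRing N) →ₗ[GrpRing N] (ι → GrpRing N) :=
    { toFun := fun v x => if h : deg x = 0 then v (e ⟨x, h⟩) else 0
      map_add' := fun v w => by ext1 x; by_cases h : deg x = 0 <;> simp [h]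
      map_smul' := fun c v => by ext1 x; by_cases h : deg x = 0 <;> simp [h] }
  let res : (ι → GrpRing N) →ₗ[GrpRing N] (Fin n → GrpRing N) :=
    LinearMap.funLeft _ _ fun i => ((e.symm i : {x // deg x = 0}) : ι)
  have hres_emb : ∀ v, res (emb v) = v := by
    intro v
    ext1 i
    change (if h : deg ((e.symm i : {x // deg x = 0}) : ι) = 0 then v (e ⟨_, h⟩) else 0) = v i
    rw [dif_pos (e.symm i).2]
    simp
  have hemb_res : ∀ v x, deg x = 0 → emb (res v) x = v x := by
    intro v x hx
    change (if h : deg x = 0 then res v (e ⟨x, h⟩) else 0) = v x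
    rw [dif_pos hx]
    simp [res, LinearMap.funLeft_apply]
  have hsc : ∀ v, (Matrix.scalar (Fin n) s).vecMulLinear v = s • v := by
    intro v
    ext1 i
    rw [Matrix.vecMulLinear_apply, Matrix.scalar_apply, Matrix.vecMul_diagonal, Pi.smul_apply,
      smul_eq_mul, mul_comm]
  let π : (ι → GrpRing N) →ₗ[GrpRing N] Q.carrier :=
    ULift.moduleEquiv.symm.toLinearMap ∘ₗ
      (LinearMap.range (Matrix.scalar (Fin n) s).vecMulLinear).mkQ ∘ₗ res
  have haug : ∀ v, aug (emb (res v)) = aug v := by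
    intro v
    rw [← sub_eq_zero, ← map_sub]
    refine hres.aug_of_pos _ fun x hx => ?_
    rw [Pi.sub_apply, hemb_res v x hx, sub_self]
  -- That `s` kills `M` is read off from the homotopy: one term is a boundary and the other has no
  -- degree zero part.
  have hsM : ∀ v, aug (s • v) = 0 := by
    intro v
    have h1 : s • v = Matrix.vecMul (Matrix.vecMul v D) S + Matrix.vecMul (Matrix.vecMul v S) D := by
      rw [Matrix.vecMul_vecMul, Matrix.vecMul_vecMul, ← Matrix.vecMul_add, hDS, Matrix.vecMul_smul,
        Matrix.vecMul_one]
    rw [h1, map_add, hres.aug_vecMul, add_zero]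
    refine hres.aug_of_pos _ fun x hx => ?_
    change ∑ z, _ * S z x = 0
    refine Finset.sum_eq_zero fun z _ => ?_
    rw [hS.apply_eq_zero (by omega), mul_zero]
  let g : Q.carrier →ₗ[GrpRing N] M.carrier :=
    (Submodule.liftQ _ (aug ∘ₗ emb) (by
      rintro _ ⟨v, rfl⟩
      rw [hsc, LinearMap.mem_ker, LinearMap.comp_apply, map_smul, hsM])) ∘ₗ
      ULift.moduleEquiv.toLinearMap
  have hg : ∀ v, g (π v) = aug v := haug
  have hπ : Function.Surjective π := by
    rintro ⟨q⟩
    obtain ⟨v, rfl⟩ := Submodule.mkQ_surjective _ q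
    refine ⟨emb v, ?_⟩
    change ULift.up (Submodule.mkQ _ (res (emb v))) = _
    rw [hres_emb]
  have hπ0 : ∀ v, π v = 0 ↔ ∃ u : ι → GrpRing N, ∀ x, deg x = 0 → v x = s * u x := by
    intro v
    have h1 : π v = 0 ↔ res v ∈ LinearMap.range (Matrix.scalar (Fin n) s).vecMulLinear := by
      rw [← Submodule.Quotient.mk_eq_zero]
      exact ULift.ext_iff
    rw [h1]
    constructor
    · rintro ⟨w, hw⟩
      refine ⟨emb w, fun x hx => ?_⟩
      rw [← hemb_res v x hx, ← hw, hsc, map_smul, Pi.smul_apply, smul_eq_mul]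
    · rintro ⟨u, hu⟩
      refine ⟨res u, ?_⟩
      rw [hsc]
      ext1 i
      exact (hu _ (e.symm i).2).symm
  have hs0 : s ≠ 0 := nonZeroDivisors.ne_zero (Sp_le hs)
  obtain ⟨aug', haug'⟩ := hres.cone hs0 hS hDS π hπ hπ0 g hg
  let M' : TorsMod.{u} p N :=
    { carrier := LinearMap.ker g
      torsion := fun m => by
        obtain ⟨t, ht, h⟩ := Q.torsion m
        exact ⟨t, ht, Subtype.ext h⟩ }
  refine ⟨M', aug', haug', ?_⟩
  refine K0.cls_exact (M' := M') (M := Q) (M'' := M) (LinearMap.ker g).subtype g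
    (Submodule.injective_subtype _) (LinearMap.exact_subtype_ker_map g) ?_
  intro m
  obtain ⟨v, hv⟩ := hres.surjective m
  exact ⟨π v, (hg v).trans hv⟩

/-- The class of a module with a resolution of length at most one. -/
theorem GradedRes.cls_eq_cokerMod {M : TorsMod.{u} p N}
    {aug : (ι → GrpRing N) →ₗ[GrpRing N] M.carrier} (hres : GradedRes deg D aug)
    (hdeg : ∀ x, deg x ≤ 1) (e : {x // Odd (deg x)} ≃ {x // Even (deg x)}) {r : ℕ}
    (eo : {x // Odd (deg x)} ≃ Fin r)
    (hd : (D.submatrix (fun i => (eo.symm i : ι)) fun i => (e (eo.symm i) : ι)).det ∈ Sp p N) :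
    K0.cls (cokerMod.{u} _ hd) = K0.cls M := by
  have hodd : ∀ x, Odd (deg x) ↔ deg x ≠ 0 := fun x => by
    have := hdeg x
    interval_cases deg x <;> simp
  have heven : ∀ x, Even (deg x) ↔ deg x = 0 := fun x => by
    have := hdeg x
    interval_cases deg x <;> simp
  let e0 : Fin r ≃ {x // Even (deg x)} := eo.symm.trans e
  set G : Matrix (Fin r) (Fin r) (GrpRing N) :=
    D.submatrix (fun i => (eo.symm i : ι)) fun i => (e (eo.symm i) : ι) with hG
  let emb : (Fin r → GrpRing N) →ₗ[GrpRing N] (ι → GrpRing N) :=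
    { toFun := fun v x => if h : Even (deg x) then v (e0.symm ⟨x, h⟩) else 0
      map_add' := fun v w => by ext1 x; by_cases h : Even (deg x) <;> simp [h]
      map_smul' := fun c v => by ext1 x; by_cases h : Even (deg x) <;> simp [h] }
  let emb1 : (Fin r → GrpRing N) → (ι → GrpRing N) :=
    fun v x => if h : Odd (deg x) then v (eo ⟨x, h⟩) else 0
  have hemb : ∀ v i, emb v (e0 i : ι) = v i := by
    intro v i
    change (if h : Even (deg (e0 i : ι)) then v (e0.symm ⟨_, h⟩) else 0) = v i
    rw [dif_pos (e0 i).2]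
    simp
  have hemb' : ∀ v x, ¬ Even (deg x) → emb v x = 0 := fun v x hx => dif_neg hx
  have hsum : ∀ (w : ι → GrpRing N) (j : Fin r), (∀ x, ¬ Odd (deg x) → w x = 0) →
      Matrix.vecMul w D (e0 j : ι) = Matrix.vecMul (fun i => w (eo.symm i : ι)) G j := by
    intro w j hw
    change ∑ z, w z * D z (e0 j : ι) = ∑ i, w (eo.symm i : ι) * D (eo.symm i : ι) (e0 j : ι)
    classical
    rw [← Fintype.sum_subtype_add_sum_subtype (fun x => Odd (deg x)),
      eo.symm.sum_comp (fun k : {x // Odd (deg x)} => w k * D k (e0 j : ι)), add_eq_left]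
    refine Finset.sum_eq_zero fun z _ => ?_
    rw [hw z z.2, zero_mul]
  have hDodd : ∀ (w : ι → GrpRing N) (x : ι), ¬ Even (deg x) → Matrix.vecMul w D x = 0 := by
    intro w x hx
    change ∑ z, w z * D z x = 0
    refine Finset.sum_eq_zero fun z _ => ?_
    have h1 := hdeg z
    have h2 := (not_congr (heven x)).mp hx
    rw [hres.hom.apply_eq_zero (by omega), mul_zero]
  have hker : ∀ v, aug (emb v) = 0 ↔ v ∈ LinearMap.range G.vecMulLinear := by
    intro v
    constructor
    · intro hv
      -- Exactness at `F₀` gives a preimage in `F₁`, and here `F₁` is the whole odd part.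
      obtain ⟨w, hw, hwD⟩ := hres.exact_zero (emb v)
        (fun x hx => hemb' v x fun h => hx ((heven x).mp h)) hv
      refine ⟨fun i => w (eo.symm i : ι), ?_⟩
      ext1 j
      rw [Matrix.vecMulLinear_apply, ← hsum w j, hwD, hemb]
      intro x hx
      refine hw x fun h => hx ?_
      rw [hodd, h]
      exact one_ne_zero
    · rintro ⟨w, rfl⟩
      have h1 : emb (G.vecMulLinear w) = Matrix.vecMul (emb1 w) D := by
        ext1 x
        by_cases hx : Even (deg x)
        · obtain ⟨j, hj⟩ := e0.surjective ⟨x, hx⟩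
          have hxj : x = (e0 j : ι) := by rw [hj]
          rw [hxj, hemb, hsum, Matrix.vecMulLinear_apply]
          · congr 1
            ext1 i
            change w i = if h : Odd (deg (eo.symm i : ι)) then w (eo ⟨_, h⟩) else 0
            rw [dif_pos (eo.symm i).2]
            simp
          · intro x hx
            exact dif_neg hx
        · rw [hemb' _ x hx, hDodd _ x hx]
      rw [h1, hres.aug_vecMul]
  let φ : Coker G →ₗ[GrpRing N] M.carrier := Submodule.liftQ _ (aug ∘ₗ emb) fun v hv =>
    (hker v).mpr hv
  have hφ : Function.Bijective φ := by
    constructor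
    · rw [← LinearMap.ker_eq_bot, LinearMap.ker_eq_bot']
      intro m hm
      obtain ⟨v, rfl⟩ := Submodule.mkQ_surjective _ m
      exact (Submodule.Quotient.mk_eq_zero _).mpr ((hker v).mp hm)
    · intro m
      obtain ⟨v, rfl⟩ := hres.surjective m
      refine ⟨Submodule.Quotient.mk fun i => v (e0 i : ι), ?_⟩
      change aug (emb fun i => v (e0 i : ι)) = aug v
      rw [← sub_eq_zero, ← map_sub]
      refine hres.aug_of_pos _ fun x hx => ?_
      obtain ⟨j, hj⟩ := e0.surjective ⟨x, (heven x).mpr hx⟩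
      have hxj : x = (e0 j : ι) := by rw [hj]
      rw [Pi.sub_apply, hxj, hemb, sub_self]
  exact K0.cls_congr (M := cokerMod G hd) (M' := M)
    (ULift.moduleEquiv.trans (LinearEquiv.ofBijective φ hφ))

theorem blockDet_isUnit {A : Type*} [CommRing A] {D H : Matrix ι ι A} (hD : HomDeg deg (-1) D)
    (hDD : D * D = 0) (hH : IsContraction deg D H)
    (e : {x // Odd (deg x)} ≃ {x // Even (deg x)}) : IsUnit (blockDet _ _ e (D + H)) :=
  IsUnit.of_mul_eq_one _ (blockDet_odd_mul_blockDet_even hD hDD hH hH e)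

/-- Over `R[S_p⁻¹]`, the torsion of a resolution of a finitely generated `S_p`-torsion module `M` is
the determinant of an element of `K₁` with boundary `[M]`. -/
theorem exists_delta_eq_cls_and_det_eq (n : ℕ) (deg : ι → ℕ) (D : Matrix ι ι (GrpRing N))
    (M : TorsMod.{u} p N) (aug : (ι → GrpRing N) →ₗ[GrpRing N] M.carrier)
    (hres : GradedRes deg D aug) (hdeg : ∀ x, deg x ≤ n + 1) (H : Matrix ι ι (Loc p N))
    (hH : IsContraction deg (D.map (algebraMap (GrpRing N) (Loc p N))) H)
    (e : {x // Odd (deg x)} ≃ {x // Even (deg x)}) :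
    ∃ ξ : K1 (Loc p N), delta.{u} p N ξ = Multiplicative.ofAdd (K0.cls M) ∧
      (K1.det ξ : Loc p N) = blockDet _ _ e (D.map (algebraMap (GrpRing N) (Loc p N)) + H) := by
  have hDL : ∀ {deg : ι → ℕ} {D : Matrix ι ι (GrpRing N)}, D * D = 0 →
      D.map (algebraMap (GrpRing N) (Loc p N)) * D.map (algebraMap (GrpRing N) (Loc p N)) = 0 := by
    intro _ D h
    rw [← Matrix.map_mul, h, Matrix.map_zero _ (map_zero _)]
  induction n generalizing deg D M aug H e with
  | zero =>
    let r := Nat.card {x // Odd (deg x)}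
    let eo : {x // Odd (deg x)} ≃ Fin r := Finite.equivFin _
    let G : Matrix (Fin r) (Fin r) (GrpRing N) :=
      D.submatrix (fun i => (eo.symm i : ι)) fun i => (e (eo.symm i) : ι)
    have hblock : blockDet _ _ e (D.map (algebraMap (GrpRing N) (Loc p N)) + H) =
        algebraMap (GrpRing N) (Loc p N) G.det := by
      rw [blockDet_reindex e eo, RingHom.map_det]
      congr 1
      ext i j
      -- The contraction raises degrees, so it has no component from `F₁` to `F₀`; the odd block is
      -- the matrix of the differential alone.
      have h1 : H (eo.symm i : ι) (e (eo.symm j) : ι) = 0 := by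
        refine hH.hom.apply_eq_zero ?_
        have h2 := hdeg (e (eo.symm j) : ι)
        have h3 := (eo.symm i).2.pos
        omega
      simp [G, h1]
    have hd : G.det ∈ Sp p N := by
      apply mem_Sp_of_isUnit
      rw [← hblock]
      exact blockDet_isUnit (hres.hom.map _) (hDL (deg := deg) hres.sq) hH e
    obtain ⟨ξ, h1, h2⟩ := exists_delta_eq_cokerMod.{u} G hd
    exact ⟨ξ, by rw [h1, hres.cls_eq_cokerMod hdeg e eo hd], by rw [h2, hblock]⟩
  | succ n ih =>
    obtain ⟨s₀, hs₀, hsM⟩ := exists_mem_Sp_smul_eq_zero M.torsion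
    obtain ⟨S₀, hS₀, hDS₀⟩ := hres.exists_homotopy hsM
    -- The homotopy is replaced by `S₀ D S₀` and `s₀` by its square, to obtain the square zero
    -- condition needed for the contraction of the shortened complex.
    obtain ⟨hDS, hSS⟩ := square_zero_homotopy hres.sq hDS₀
    have hS : HomDeg deg 1 (S₀ * D * S₀) := (hS₀.mul hres.hom).mul hS₀
    have hs : s₀ * s₀ ∈ Sp p N := mul_mem hs₀ hs₀
    generalize S₀ * D * S₀ = S at hDS hSS hS
    generalize s₀ * s₀ = s at hDS hs
    set φ := algebraMap (GrpRing N) (Loc p N) with hφ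
    obtain ⟨c, hc⟩ : ∃ c, c * φ s = 1 :=
      (IsLocalization.map_units (Loc p N) (⟨s, hs⟩ : Sp p N)).exists_left_inv
    have hcs : φ s * c = 1 := (mul_comm _ _).trans hc
    -- the chain contraction of square zero given by the null homotopy of `s`
    let K : Matrix ι ι (Loc p N) := c • S.map φ
    have hsK : φ s • K = S.map φ := by rw [smul_smul, hcs, one_smul]
    have hK : IsContraction deg (D.map φ) K := by
      refine ⟨(hS.map φ).smul c, ?_⟩
      have h1 : D.map φ * S.map φ + S.map φ * D.map φ = φ s • 1 := by
        rw [← Matrix.map_mul, ← Matrix.map_mul, ← Matrix.map_add φ (map_add φ), hDS]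
        ext i j
        simp [Matrix.one_apply, apply_ite φ]
      rw [mul_smul_comm, smul_mul_assoc, ← smul_add, h1, smul_smul, hc, one_smul]
    have hKK : K * K = 0 := by
      rw [smul_mul_assoc, mul_smul_comm, ← Matrix.map_mul, hSS, Matrix.map_zero _ (map_zero _),
        smul_zero, smul_zero]
    obtain ⟨M', aug', hres', hcls⟩ := hres.exists_cone hs hS hDS
    have hcone : (coneDiff deg D S).map φ = coneDiff deg (D.map φ) (φ s • K) := by
      rw [hsK, coneDiff, coneDiff, Matrix.map_add φ (map_add φ), Matrix.map_mul, Matrix.map_mul,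
        Matrix.map_sub φ (map_sub φ), degZero_map, Matrix.map_one φ (map_zero φ) (map_one φ)]
    have hdeg' : ∀ x, coneDeg deg x ≤ n + 1 := by
      intro x
      have := hdeg x
      by_cases h : deg x = 0
      · simp [coneDeg, h]
      · simp only [coneDeg, h, if_false]
        omega
    have hH' := coneDiff_isContraction hc (hres.hom.map φ) (hDL (deg := deg) hres.sq) hK hKK
    rw [← hcone] at hH'
    -- The degree shift exchanges parities, so the induction hypothesis is used with the inverse
    -- bijection.
    obtain ⟨e', he'⟩ := blockDet_congr (A := Loc p N) (fun x => (odd_coneDeg (deg := deg) x).symm)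
      (fun x => (even_coneDeg (deg := deg) x).symm) e.symm
    obtain ⟨ξ', hξ', hdet'⟩ := ih _ _ M' aug' hres' hdeg' _ hH' e'
    obtain ⟨ξ, hξ, hdet⟩ := exists_delta_eq_cokerMod.{u} _
      (scalar_det_mem hs (Nat.card {x // deg x = 0}))
    -- Mirrors `[M] = [F₀ / s F₀] - [M']`: here `ξ` has boundary `[F₀ / s F₀]` and `ξ'` has boundary
    -- `[M']`.
    refine ⟨ξ * ξ'⁻¹, ?_, ?_⟩
    · rw [map_mul, map_inv, hξ, hξ', hcls, ← ofAdd_neg, ← ofAdd_add]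
      congr 1
      abel
    · have h1 : blockDet _ _ e.symm (D.map φ + K) * φ s ^ Nat.card {x // deg x = 0} =
          K1.det ξ' := by
        rw [hdet', he', hcone, coneDiff_add_contraction (hres.hom.map φ) hK.hom,
          blockDet_scale, mul_comm]
        · intro x hx
          rw [hx]
          exact Even.zero
        · intro y hy
          rw [if_neg]
          exact hy.pos.ne'
      have h2 : (K1.det ξ : Loc p N) = φ s ^ Nat.card {x // deg x = 0} := by
        rw [hdet, Matrix.scalar_apply, Matrix.det_diagonal, Finset.prod_const, Finset.card_univ,
          Fintype.card_fin, map_pow]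
      -- The odd determinant for the given `H` is inverse to the even one for the special
      -- contraction `K`, so `H` need not have square zero.
      have h3 : blockDet _ _ e (D.map φ + H) * blockDet _ _ e.symm (D.map φ + K) = 1 :=
        blockDet_odd_mul_blockDet_even (hres.hom.map φ) (hDL (deg := deg) hres.sq) hH hK e
      rw [map_mul, map_inv, Units.val_mul, Units.mul_inv_eq_iff_eq_mul, h2, ← h1, ← mul_assoc, h3,
        one_mul]

end Presentation

end BoundaryOfTorsion

end PadicDet

open scoped TensorProduct

namespace PadicDet

universe u

/-! ### Lengths at the prime elements and the kernel of the boundary map -/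

noncomputable section Orders

section PID

variable {B : Type*} [CommRing B] [IsDomain B]

theorem ord_prod {ι : Type*} (s : Finset ι) (a : ι → B) (ha : ∀ i ∈ s, a i ≠ 0) :
    Ring.ord B (∏ i ∈ s, a i) = ∑ i ∈ s, Ring.ord B (a i) := by
  classical
  induction s using Finset.induction_on with
  | empty => simp
  | insert i s hi ih =>
    rw [Finset.prod_insert hi, Finset.sum_insert hi, Ring.ord_mul' B
      (mem_nonZeroDivisors_of_ne_zero (ha i (Finset.mem_insert_self i s))),
      ih fun j hj => ha j (Finset.mem_insert_of_mem hj)]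

theorem ord_pow {a : B} (ha : a ≠ 0) (k : ℕ) : Ring.ord B (a ^ k) = k * Ring.ord B a := by
  have := ord_prod (Finset.range k) (fun _ => a) fun _ _ => ha
  simpa using this

/-- The length of the cokernel of an injective endomorphism of a free module. -/
theorem length_quotient_range [IsPrincipalIdealRing B] {F : Type*} [AddCommGroup F] [Module B F]
    [Module.Free B F] [Module.Finite B F] (f : F →ₗ[B] F) (hf : LinearMap.det f ≠ 0) :
    Module.length B (F ⧸ LinearMap.range f) = Ring.ord B (LinearMap.det f) := by
  have hinj : Function.Injective f := by
    rw [← LinearMap.ker_eq_bot]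
    by_contra h
    exact hf (LinearMap.det_eq_zero_iff_ker_ne_bot.mpr h)
  let b := Module.Free.chooseBasis B F
  have hrank : Module.finrank B (LinearMap.range f) = Module.finrank B F :=
    LinearMap.finrank_range_of_inj hinj
  -- Smith normal form of the image: up to an automorphism, `f` is diagonal with entries `a i`, so
  -- its cokernel is the product of the `B / a i` and its determinant is associated to their
  -- product.
  let a := Submodule.smithNormalFormCoeffs b hrank
  let b' := Submodule.smithNormalFormTopBasis b hrank
  let ab := Submodule.smithNormalFormBotBasis b hrank
  have hab : ∀ i, (ab i : F) = a i • b' i := Submodule.smithNormalFormBotBasis_def b hrank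
  have ha : ∀ i, a i ≠ 0 := by
    intro i h
    have h1 := hab i
    rw [h, zero_smul] at h1
    exact ab.ne_zero i (Subtype.ext h1)
  let e₁ : F ≃ₗ[B] LinearMap.range f := LinearEquiv.ofInjective f hinj
  let e₂ : F ≃ₗ[B] LinearMap.range f := b'.equiv ab (Equiv.refl _)
  have hdet : LinearMap.det ((LinearMap.range f).subtype ∘ₗ e₂.toLinearMap) = ∏ i, a i := by
    rw [← LinearMap.det_toMatrix b', ← Matrix.det_diagonal]
    congr 1
    ext i j
    rw [LinearMap.toMatrix_apply]
    simp only [LinearMap.comp_apply, LinearEquiv.coe_coe, e₂, Module.Basis.equiv_apply,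
      Submodule.subtype_apply, Equiv.refl_apply, hab, map_smul, Module.Basis.repr_self,
      Finsupp.smul_apply, Matrix.diagonal_apply, Finsupp.single_apply]
    by_cases h : i = j
    · subst h; simp
    · simp [h, Ne.symm h]
  have hfe : f = ((LinearMap.range f).subtype ∘ₗ e₂.toLinearMap) ∘ₗ
      (e₁.trans e₂.symm).toLinearMap := by
    ext x
    simp [e₁]
  have hass : Associated (LinearMap.det f) (∏ i, a i) := by
    have h1 := congrArg LinearMap.det hfe
    rw [LinearMap.det_comp, hdet] at h1
    rw [h1]
    exact associated_mul_unit_left _ _ (LinearEquiv.isUnit_det' _)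
  have hord : Ring.ord B (LinearMap.det f) = Ring.ord B (∏ i, a i) := by
    rw [Ring.ord, Ring.ord, Ideal.span_singleton_eq_span_singleton.mpr hass]
  rw [hord, ord_prod _ _ fun i _ => ha i,
    (Submodule.quotientEquivPiSpan _ b hrank).length_eq, Module.length_pi_of_fintype]
  rfl

-- The module is a quotient of a finite power of `B / s`, which has finite length.
omit [IsDomain B] in
theorem length_ne_top_of_smul_eq_zero {M : Type*} [AddCommGroup M] [Module B M]
    [Module.Finite B M] {s : B} (hs : Ring.ord B s ≠ ⊤) (hM : ∀ m : M, s • m = 0) :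
    Module.length B M ≠ ⊤ := by
  obtain ⟨k, f, hf⟩ := Module.Finite.exists_fin' B M
  have hker : ∀ m : M, Ideal.span {s} ≤ LinearMap.ker (LinearMap.toSpanSingleton B M m) := by
    intro m
    rw [Ideal.span_singleton_le_iff_mem]
    exact hM m
  let φ : (Fin k → B ⧸ Ideal.span {s}) →ₗ[B] M :=
    LinearMap.lsum B _ B fun i =>
      Submodule.liftQ (Ideal.span {s}) (LinearMap.toSpanSingleton B M (f (Pi.single i 1))) (hker _)
  have hφ : Function.Surjective φ := by
    intro m
    obtain ⟨v, rfl⟩ := hf m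
    refine ⟨fun i => Submodule.Quotient.mk (v i), ?_⟩
    rw [pi_eq_sum_univ' v, map_sum]
    simp only [φ, LinearMap.lsum_apply, LinearMap.sum_apply, LinearMap.comp_apply,
      LinearMap.proj_apply]
    refine Finset.sum_congr rfl fun i _ => ?_
    rw [Submodule.liftQ_apply, LinearMap.toSpanSingleton_apply, ← map_smul]
    congr 1
    ext j
    simp [Pi.single_apply]
  refine ne_top_of_le_ne_top ?_ (Module.length_le_of_surjective φ hφ)
  rw [Module.length_pi_of_fintype]
  exact ENat.sum_ne_top.mpr fun _ _ => hs

end PID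

section UFD

variable {R : Type*} [CommRing R] [IsDomain R]

/-- A Noetherian local domain whose maximal ideal is principal is a principal ideal ring. -/
theorem isPrincipalIdealRing_localization_span_prime [IsNoetherianRing R] {π : R}
    (P : Ideal R) [P.IsPrime] (hP : P = Ideal.span {π}) :
    IsPrincipalIdealRing (Localization.AtPrime P) := by
  have hnoeth : IsNoetherianRing (Localization.AtPrime P) :=
    IsLocalization.isNoetherianRing P.primeCompl _ inferInstance
  refine ((tfae_of_isNoetherianRing_of_isLocalRing_of_isDomain (Localization.AtPrime P)).out 0 4).mpr
    ?_
  have h1 : Ideal.map (algebraMap R (Localization.AtPrime P)) P =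
      Ideal.span {algebraMap R (Localization.AtPrime P) π} :=
    (congrArg (Ideal.map (algebraMap R (Localization.AtPrime P))) hP).trans
      (by rw [Ideal.map_span, Set.image_singleton])
  rw [← Localization.AtPrime.map_eq_maximalIdeal, h1]
  exact ⟨⟨_, rfl⟩⟩

/-- In a unique factorization domain, the orders at the prime elements determine the element up to
units. -/
theorem dvd_of_ord_localization_le [IsNoetherianRing R] [UniqueFactorizationMonoid R] {a b : R}
    (ha : a ≠ 0) (hb : b ≠ 0)
    (h : ∀ (P : Ideal R) [P.IsPrime], (∃ π, Prime π ∧ P = Ideal.span {π}) →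
      Ring.ord (Localization.AtPrime P) (algebraMap R _ a) =
        Ring.ord (Localization.AtPrime P) (algebraMap R _ b)) : a ∣ b := by
  rw [UniqueFactorizationMonoid.dvd_iff_emultiplicity_le ha]
  intro π hπ
  have hprime : (Ideal.span {π}).IsPrime := (Ideal.span_singleton_prime hπ.ne_zero).mpr hπ
  let B := Localization.AtPrime (Ideal.span {π})
  have hPID : IsPrincipalIdealRing B :=
    isPrincipalIdealRing_localization_span_prime _ rfl
  have hinj : Function.Injective (algebraMap R B) :=
    IsLocalization.injective B (Ideal.primeCompl_le_nonZeroDivisors (Ideal.span {π}))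
  have hne : ∀ x : R, x ≠ 0 → algebraMap R B x ≠ 0 := fun x hx =>
    (map_ne_zero_iff _ hinj).mpr hx
  -- Write `x = π ^ k * c` with `π ∤ c`. Then `c` is a unit in `B`, so the order of `x` is `k` times
  -- that of `π`.
  have hord : ∀ x : R, x ≠ 0 → ∃ k : ℕ, emultiplicity π x = k ∧
      Ring.ord B (algebraMap R B x) = k * Ring.ord B (algebraMap R B π) := by
    intro x hx
    have hfin : FiniteMultiplicity π x := FiniteMultiplicity.of_prime_left hπ hx
    obtain ⟨c, hc, hπc⟩ := hfin.exists_eq_pow_mul_and_not_dvd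
    refine ⟨multiplicity π x, hfin.emultiplicity_eq_multiplicity, ?_⟩
    have hcu : IsUnit (algebraMap R B c) :=
      IsLocalization.map_units B (⟨c, fun h => hπc (Ideal.mem_span_singleton.mp h)⟩ :
        (Ideal.span {π}).primeCompl)
    have hc0 : Ring.ord B (algebraMap R B c) = 0 := by
      rw [Ring.ord, Ideal.span_singleton_eq_top.mpr hcu]
      exact Module.length_eq_zero
    conv_lhs => rw [hc]
    rw [map_mul, map_pow, Ring.ord_mul B (mem_nonZeroDivisors_of_ne_zero hcu.ne_zero), hc0, add_zero,
      ord_pow (hne π hπ.ne_zero)]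
  obtain ⟨k, hk, hk'⟩ := hord a ha
  obtain ⟨l, hl, hl'⟩ := hord b hb
  have hab := h (Ideal.span {π}) ⟨π, hπ, rfl⟩
  -- The order of `π` is finite and nonzero, so it can be cancelled; its exact value is not needed.
  have htop : Ring.ord B (algebraMap R B π) ≠ ⊤ :=
    Ring.ord_ne_top (mem_nonZeroDivisors_of_ne_zero (hne π hπ.ne_zero))
  have h0 : Ring.ord B (algebraMap R B π) ≠ 0 := by
    rw [Ring.ord, Ne, Module.length_eq_zero_iff, Submodule.Quotient.subsingleton_iff,
      Ideal.span_singleton_eq_top]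
    intro hu
    have := (IsLocalization.AtPrime.isUnit_to_map_iff B (Ideal.span {π}) π).mp hu
    exact this (Ideal.mem_span_singleton_self π)
  rw [hk, hl]
  change Ring.ord B _ = Ring.ord B _ at hab
  rw [hk', hl'] at hab
  lift Ring.ord B (algebraMap R B π) to ℕ using htop with m
  have h1 : k * m = l * m := by exact_mod_cast hab
  have h2 : k = l := Nat.eq_of_mul_eq_mul_right (Nat.pos_of_ne_zero (by exact_mod_cast h0)) h1
  rw [h2]

end UFD

section K0

variable {p : ℕ} [Fact p.Prime] {N : ℕ}

variable (B : Type*) [CommRing B] [Algebra (GrpRing N) B]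

variable (N) in
/-- The length of `B ⊗ M` over the `R`-algebra `B`. -/
def locLength (M : Type u) [AddCommGroup M] [Module (GrpRing N) M] : ℕ∞ :=
  Module.length B (B ⊗[GrpRing N] M)

theorem locLength_exact [Module.Flat (GrpRing N) B] {M' M M'' : Type u} [AddCommGroup M'] [Module (GrpRing N) M']
    [AddCommGroup M] [Module (GrpRing N) M] [AddCommGroup M''] [Module (GrpRing N) M'']
    (f : M' →ₗ[GrpRing N] M) (g : M →ₗ[GrpRing N] M'') (hf : Function.Injective f)
    (hfg : Function.Exact f g) (hg : Function.Surjective g) :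
    locLength N B M = locLength N B M' + locLength N B M'' :=
  Module.length_eq_add_of_exact (f.baseChange B)
    (g.baseChange B)
    (Module.Flat.lTensor_preserves_injective_linearMap (M := B) _ hf)
    (LinearMap.lTensor_surjective _ hg) (lTensor_exact _ hfg hg)

variable [FaithfulSMul (GrpRing N) B] [IsDomain B] [IsPrincipalIdealRing B]

/-- Finiteness matters because `locLengthK0` passes through `ENat.toNat`, which is additive only on
finite values. -/
theorem locLength_ne_top (M : TorsMod.{u} p N) : locLength N B M.carrier ≠ ⊤ := by
  obtain ⟨s, hs, hsM⟩ := exists_mem_Sp_smul_eq_zero M.torsion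
  have hs0 : s ≠ 0 := nonZeroDivisors.ne_zero (Sp_le hs)
  refine length_ne_top_of_smul_eq_zero (s := algebraMap _ _ s)
    (Ring.ord_ne_top (mem_nonZeroDivisors_of_ne_zero ((FaithfulSMul.algebraMap_injective _ B).ne_iff' (map_zero _) |>.mpr hs0))) fun m => ?_
  induction m with
  | zero => rw [smul_zero]
  | add x y hx hy => rw [smul_add, hx, hy, add_zero]
  | tmul x y =>
    rw [algebraMap_smul, TensorProduct.smul_tmul', TensorProduct.smul_tmul, hsM,
      TensorProduct.tmul_zero]

/-- Tensoring is right exact, so `B ⊗ R^r / R^r g` is the cokernel of the base-changed matrix, to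
which the Smith normal form computation applies. -/
theorem locLength_cokerMod {r : ℕ} (g : Matrix (Fin r) (Fin r) (GrpRing N))
    (hg : g.det ∈ Sp p N) : locLength N B (cokerMod.{u} g hg).carrier =
      Ring.ord B (algebraMap _ _ g.det) := by
  let φ : (Fin r → GrpRing N) →ₗ[GrpRing N] (Fin r → GrpRing N) := g.vecMulLinear
  have hdet : LinearMap.det φ = g.det := by
    have : φ = Matrix.toLin' g.transpose := by
      ext v i
      simp [φ]
    rw [this, LinearMap.det_toLin', Matrix.det_transpose]
  have hdetB : LinearMap.det (φ.baseChange B) = algebraMap _ _ g.det := by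
    rw [LinearMap.det_baseChange, hdet]
  have hne : LinearMap.det (φ.baseChange B) ≠ 0 := by
    rw [hdetB]
    exact ((FaithfulSMul.algebraMap_injective _ B).ne_iff' (map_zero _)).mpr (nonZeroDivisors.ne_zero (Sp_le hg))
  rw [← hdetB, ← length_quotient_range _ hne]
  let q : (Fin r → GrpRing N) →ₗ[GrpRing N] (cokerMod.{u} g hg).carrier :=
    ULift.moduleEquiv.symm.toLinearMap ∘ₗ (LinearMap.range φ).mkQ
  have hq : Function.Surjective q :=
    ULift.moduleEquiv.symm.surjective.comp (Submodule.mkQ_surjective _)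
  have hφq : Function.Exact φ q := by
    intro v
    have h1 : q v = 0 ↔ (LinearMap.range φ).mkQ v = 0 := ULift.ext_iff
    rw [h1, Submodule.mkQ_apply, Submodule.Quotient.mk_eq_zero]
    rfl
  have hex : Function.Exact (φ.baseChange B) (q.baseChange B) := lTensor_exact B hφq hq
  have hs : Function.Surjective (q.baseChange B) := LinearMap.lTensor_surjective B hq
  exact ((Submodule.quotEquivOfEq _ _ (LinearMap.exact_iff.mp hex).symm).trans
    ((q.baseChange B).quotKerEquivOfSurjective hs)).length_eq.symm

variable (p) in
/-- The homomorphism `K₀(𝓜_{S_p}(R)) → ℤ` given by the length of `B ⊗ M`. -/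
def locLengthK0 [Module.Flat (GrpRing N) B] : K0.{u} p N →+ ℤ :=
  QuotientAddGroup.lift _
    (FreeAbelianGroup.lift fun M : TorsMod.{u} p N => ((locLength N B M.carrier).toNat : ℤ)) (by
      rw [AddSubgroup.closure_le]
      rintro _ ⟨M', M, M'', f, g, hf, hfg, hg, rfl⟩
      have h := locLength_exact B f g hf hfg hg
      simp only [SetLike.mem_coe, AddMonoidHom.mem_ker, map_sub, FreeAbelianGroup.lift_apply_of]
      rw [h, ENat.toNat_add (locLength_ne_top B M') (locLength_ne_top B M'')]
      push_cast
      ring)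

theorem locLengthK0_cls [Module.Flat (GrpRing N) B] (M : TorsMod.{u} p N) :
    locLengthK0.{u} p B (K0.cls M) = ((locLength N B M.carrier).toNat : ℤ) := by
  exact FreeAbelianGroup.lift_apply_of _ _

end K0

section Injectivity

variable {p : ℕ} [Fact p.Prime] {N : ℕ}

/-- The determinant of an element of the kernel of the boundary map comes from a unit of `R`. -/
theorem det_mem_of_delta_eq_one {ξ : K1 (Loc p N)} (hξ : delta.{u} p N ξ = 1) :
    ∃ x : (GrpRing N)ˣ,
      K1.det ξ = Units.map (algebraMap (GrpRing N) (Loc p N)).toMonoidHom x := by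
  obtain ⟨r, f, rfl⟩ : ∃ (r : ℕ) (f : Matrix.GeneralLinearGroup (Fin r) (Loc p N)),
      K1.mk r f = ξ := by
    obtain ⟨y, rfl⟩ := QuotientGroup.mk_surjective ξ
    induction y using DirectLimit.induction with
    | _ r f => exact ⟨r, f, rfl⟩
  obtain ⟨s, g, h⟩ := exists_isFraction f
  have h1 : deltaGL.{u} p N r f = 1 := hξ
  rw [deltaGL_eq h] at h1
  have h2 : K0.cls (cokerMod.{u} g h.det_mem) =
      K0.cls (cokerMod (Matrix.scalar (Fin r) s) (scalar_det_mem h.1 r)) := sub_eq_zero.mp h1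
  have hg0 : g.det ≠ 0 := nonZeroDivisors.ne_zero (Sp_le h.det_mem)
  have hs0 : (Matrix.scalar (Fin r) s).det ≠ 0 :=
    nonZeroDivisors.ne_zero (Sp_le (scalar_det_mem h.1 r))
  have hord : ∀ (P : Ideal (GrpRing N)) [P.IsPrime], (∃ π, Prime π ∧ P = Ideal.span {π}) →
      Ring.ord (Localization.AtPrime P) (algebraMap _ _ g.det) =
        Ring.ord (Localization.AtPrime P) (algebraMap _ _ (Matrix.scalar (Fin r) s).det) := by
    rintro P _ ⟨π, hπ, hP⟩
    have := isPrincipalIdealRing_localization_span_prime P hP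
    have hfaith : FaithfulSMul (GrpRing N) (Localization.AtPrime P) :=
      (faithfulSMul_iff_algebraMap_injective _ _).mpr
        (IsLocalization.injective (Localization.AtPrime P) (Ideal.primeCompl_le_nonZeroDivisors P))
    have hflat : Module.Flat (GrpRing N) (Localization.AtPrime P) :=
      IsLocalization.flat _ P.primeCompl
    have h3 := congrArg (locLengthK0.{u} p (Localization.AtPrime P)) h2
    rw [locLengthK0_cls, locLengthK0_cls, Nat.cast_inj] at h3
    rw [← locLength_cokerMod.{u} (p := p) (Localization.AtPrime P) g h.det_mem,
      ← locLength_cokerMod.{u} (p := p) (Localization.AtPrime P) _ (scalar_det_mem h.1 r),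
      ← ENat.natCast_toNat (locLength_ne_top _ (cokerMod.{u} g h.det_mem)), h3,
      ENat.natCast_toNat (locLength_ne_top _ _)]
  -- For `f = s⁻¹ g` this says that `det g` and `s ^ r` differ by a unit `x` of `R`; hence `det f =
  -- x`.
  obtain ⟨x, hx⟩ := associated_of_dvd_dvd
    (dvd_of_ord_localization_le hs0 hg0 fun P _ hP => (hord P hP).symm)
    (dvd_of_ord_localization_le hg0 hs0 hord)
  refine ⟨x, Units.ext ?_⟩
  change Matrix.det f.val = algebraMap (GrpRing N) (Loc p N) x
  have h4 := congrArg Matrix.det h.2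
  have hdet : (g.map (algebraMap (GrpRing N) (Loc p N))).det =
      algebraMap (GrpRing N) (Loc p N) g.det := by
    rw [RingHom.map_det, RingHom.mapMatrix_apply]
  rw [hdet, ← hx, Matrix.det_smul, map_mul, Matrix.scalar_apply, Matrix.det_diagonal,
    Finset.prod_const, Finset.card_univ, map_pow] at h4
  have hu : IsUnit (algebraMap (GrpRing N) (Loc p N) s ^ Fintype.card (Fin r)) :=
    (IsLocalization.map_units (Loc p N) (⟨s, h.1⟩ : Sp p N)).pow _
  exact (hu.mul_left_cancel h4).symm

end Injectivity

end Orders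

end PadicDet

open scoped TensorProduct

namespace PadicDet

noncomputable section

variable {p : ℕ} [Fact p.Prime] {N : ℕ}

/-! ### The maximum norm on `c₀(Γ)` and reduction modulo `p` -/

namespace C0

instance : CompleteSpace (C0 p N) :=
  inferInstanceAs (CompleteSpace (ZeroAtInftyContinuousMap (Lat N) ℚ_[p]))

theorem norm_apply_le (a : C0 p N) (γ : Lat N) : ‖a γ‖ ≤ ‖a‖ :=
  BoundedContinuousFunction.norm_coe_le_norm
    (ZeroAtInftyContinuousMap.toBCF (a : ZeroAtInftyContinuousMap (Lat N) ℚ_[p])) γ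

theorem norm_le_of_forall {a : C0 p N} {c : ℝ} (hc : 0 ≤ c) (h : ∀ γ, ‖a γ‖ ≤ c) : ‖a‖ ≤ c :=
  (BoundedContinuousFunction.norm_le
    (f := ZeroAtInftyContinuousMap.toBCF (a : ZeroAtInftyContinuousMap (Lat N) ℚ_[p])) hc).mpr h

@[simp] theorem smul_apply (c : ℚ_[p]) (a : C0 p N) (γ : Lat N) : (c • a) γ = c * a γ := rfl

@[simp] theorem sub_apply (a b : C0 p N) (γ : Lat N) : (a - b) γ = a γ - b γ := rfl

theorem one_apply (γ : Lat N) : (1 : C0 p N) γ = if γ = 0 then 1 else 0 := by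
  rw [one_def, single_apply]

theorem norm_tsum_le {ι : Type*} {f : ι → ℚ_[p]} {c : ℝ} (hc : 0 ≤ c) (h : ∀ i, ‖f i‖ ≤ c) :
    ‖∑' i, f i‖ ≤ c :=
  IsUltrametricDist.norm_tsum_le_of_forall_le_of_nonneg hc h

theorem norm_mul_le' (a b : C0 p N) : ‖a * b‖ ≤ ‖a‖ * ‖b‖ := by
  refine norm_le_of_forall (by positivity) fun γ => ?_
  rw [mul_apply]
  refine norm_tsum_le (by positivity) fun x => ?_
  rw [norm_mul]
  exact mul_le_mul (norm_apply_le _ _) (norm_apply_le _ _) (norm_nonneg _) (norm_nonneg _)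

instance : NormedCommRing (C0 p N) :=
  { (inferInstance : NormedAddCommGroup (C0 p N)), (inferInstance : CommRing (C0 p N)) with
    norm_mul_le := norm_mul_le' }

instance : Algebra ℚ_[p] (C0 p N) :=
  Algebra.ofModule
    (fun r x y => by
      ext γ
      simp only [mul_apply, smul_apply, mul_assoc, tsum_mul_left])
    (fun r x y => by
      ext γ
      simp only [mul_apply, smul_apply, mul_left_comm _ r, tsum_mul_left])

instance : NormedAlgebra ℚ_[p] (C0 p N) where
  norm_smul_le r x := by
    refine norm_le_of_forall (by positivity) fun γ => ?_
    rw [smul_apply, norm_mul]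
    exact mul_le_mul_of_nonneg_left (norm_apply_le _ _) (norm_nonneg _)

instance : IsUltrametricDist (C0 p N) :=
  IsUltrametricDist.isUltrametricDist_of_forall_norm_add_le_max_norm fun x y => by
    refine norm_le_of_forall (le_max_of_le_left (norm_nonneg _)) fun γ => ?_
    exact (IsUltrametricDist.norm_add_le_max _ _).trans
      (max_le_max (norm_apply_le _ _) (norm_apply_le _ _))

instance : NormOneClass (C0 p N) where
  norm_one := by
    refine le_antisymm (norm_le_of_forall zero_le_one fun γ => ?_) ?_
    · rw [one_apply]
      split_ifs <;> simp
    · simpa [one_apply] using norm_apply_le (1 : C0 p N) 0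

theorem finite_setOf_le (a : C0 p N) {ε : ℝ} (hε : 0 < ε) : {γ | ε ≤ ‖a γ‖}.Finite := by
  have h := a.summable.tendsto_cofinite_zero.norm
  rw [norm_zero] at h
  have := h.eventually (gt_mem_nhds hε)
  simpa [Filter.eventually_cofinite] using this

theorem exists_norm_eq (a : C0 p N) : ∃ γ, ‖a γ‖ = ‖a‖ := by
  by_cases h : a = 0
  · exact ⟨0, by simp [h]⟩
  · obtain ⟨γ₀, h₀⟩ : ∃ γ, a γ ≠ 0 := by
      by_contra! h'
      exact h (ext h')
    have hpos : 0 < ‖a γ₀‖ := norm_pos_iff.mpr h₀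
    obtain ⟨γ, hγ, hmax⟩ := (a.finite_setOf_le hpos).exists_maximalFor (fun γ => ‖a γ‖) _
      ⟨γ₀, le_refl ‖a γ₀‖⟩
    refine ⟨γ, le_antisymm (norm_apply_le _ _) (norm_le_of_forall (norm_nonneg _) fun x => ?_)⟩
    rcases le_total ‖a γ₀‖ ‖a x‖ with hx | hx
    · rcases le_total ‖a x‖ ‖a γ‖ with h1 | h1
      · exact h1
      · exact hmax hx h1
    · exact hx.trans hγ

theorem norm_lt_iff {a : C0 p N} {c : ℝ} : ‖a‖ < c ↔ ∀ γ, ‖a γ‖ < c := by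
  refine ⟨fun h γ => (norm_apply_le a γ).trans_lt h, fun h => ?_⟩
  obtain ⟨γ, hγ⟩ := a.exists_norm_eq
  exact hγ ▸ h γ

/-- Only finitely many terms have norm at least `c / 2`, so the strict bounds on the terms are
uniform. -/
theorem norm_tsum_lt {ι : Type*} {f : ι → ℚ_[p]} (hf : Summable f) {c : ℝ} (hc : 0 < c)
    (h : ∀ i, ‖f i‖ < c) : ‖∑' i, f i‖ < c := by
  have h0 := hf.tendsto_cofinite_zero.norm
  rw [norm_zero] at h0
  have hfin : {i | c / 2 ≤ ‖f i‖}.Finite := by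
    have := h0.eventually (gt_mem_nhds (half_pos hc))
    simpa [Filter.eventually_cofinite] using this
  let s := hfin.toFinset
  obtain ⟨d, hd, hdc, hds⟩ : ∃ d, 0 ≤ d ∧ d < c ∧ ∀ i ∈ s, ‖f i‖ ≤ d := by
    rcases s.eq_empty_or_nonempty with hs | hs
    · exact ⟨0, le_rfl, hc, by simp [hs]⟩
    · obtain ⟨i, -, hi⟩ := s.exists_max_image (fun i => ‖f i‖) hs
      exact ⟨‖f i‖, norm_nonneg _, h i, hi⟩
  refine (norm_tsum_le (c := max d (c / 2)) (le_max_of_le_left hd) fun i => ?_).trans_lt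
    (max_lt hdc (half_lt_self hc))
  by_cases hi : i ∈ s
  · exact le_max_of_le_left (hds i hi)
  · refine le_max_of_le_right ?_
    by_contra! h'
    exact hi (hfin.mem_toFinset.mpr h'.le)

/-- The set of `γ` for which `|a_γ| = 1`, for `‖a‖ ≤ 1`. -/
def lead (a : C0 p N) : Finset (Lat N) := (a.finite_setOf_le one_pos).toFinset

theorem mem_lead {a : C0 p N} (ha : ‖a‖ ≤ 1) {γ : Lat N} : γ ∈ a.lead ↔ ‖a γ‖ = 1 := by
  rw [lead, Set.Finite.mem_toFinset]
  exact ⟨fun h => le_antisymm ((norm_apply_le _ _).trans ha) h, fun h => h.ge⟩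

theorem lead_nonempty {a : C0 p N} (ha : ‖a‖ = 1) : a.lead.Nonempty := by
  obtain ⟨γ, hγ⟩ := a.exists_norm_eq
  exact ⟨γ, (mem_lead ha.le).mpr (hγ.trans ha)⟩

/-- In the coefficient at `α + β` exactly one product has norm one and all others have norm less
than one, so the ultrametric inequality is an equality. -/
theorem norm_mul_apply_of_uniqueAdd {a b : C0 p N} (ha : ‖a‖ ≤ 1) (hb : ‖b‖ ≤ 1) {α β : Lat N}
    (hα : α ∈ a.lead) (hβ : β ∈ b.lead) (h : UniqueAdd a.lead b.lead α β) :
    ‖(a * b) (α + β)‖ = 1 := by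
  classical
  have hs := summable_mul a b (α + β)
  rw [mul_apply, hs.tsum_eq_add_tsum_ite α, add_sub_cancel_left]
  have h1 : ‖a α * b β‖ = 1 := by
    rw [norm_mul, (mem_lead ha).mp hα, (mem_lead hb).mp hβ, one_mul]
  have h2 : ‖∑' x, if x = α then 0 else a x * b (α + β - x)‖ < 1 := by
    refine norm_tsum_lt ?_ one_pos fun x => ?_
    · refine (hs.update α 0).congr fun x => ?_
      by_cases hx : x = α <;> simp [hx]
    · split_ifs with hx
      · simp
      · have hxa := (norm_apply_le a x).trans ha
        have hxb := (norm_apply_le b (α + β - x)).trans hb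
        rw [norm_mul]
        refine lt_of_le_of_ne (mul_le_one₀ hxa (norm_nonneg _) hxb) fun he => hx ?_
        have h3 : ‖a x‖ = 1 := by
          refine le_antisymm hxa ?_
          nlinarith [norm_nonneg (a x), norm_nonneg (b (α + β - x))]
        have h4 : ‖b (α + β - x)‖ = 1 := by rwa [h3, one_mul] at he
        exact (h ((mem_lead ha).mpr h3) ((mem_lead hb).mpr h4) (by abel)).1
  rw [IsUltrametricDist.norm_add_eq_max_of_norm_ne_norm (by rw [h1]; exact h2.ne'), h1,
    max_eq_left h2.le]

/-- Gauss's lemma. Two finite nonempty subsets of `Γ` have a sum represented only once, so the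
leading terms cannot all cancel. -/
theorem norm_mul_eq_one {a b : C0 p N} (ha : ‖a‖ = 1) (hb : ‖b‖ = 1) : ‖a * b‖ = 1 := by
  obtain ⟨α, hα, β, hβ, h⟩ :=
    UniqueSums.uniqueAdd_of_nonempty (lead_nonempty ha) (lead_nonempty hb)
  refine le_antisymm ((norm_mul_le a b).trans (by rw [ha, hb, one_mul])) ?_
  rw [← norm_mul_apply_of_uniqueAdd ha.le hb.le hα hβ h]
  exact norm_apply_le _ _

theorem exists_zpow_smul (a : C0 p N) (ha : a ≠ 0) :
    ∃ (ν : ℤ) (b : C0 p N), ‖b‖ = 1 ∧ a = (p : ℚ_[p]) ^ ν • b := by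
  have hp : (p : ℚ_[p]) ≠ 0 := by exact_mod_cast (Fact.out : p.Prime).ne_zero
  obtain ⟨γ, hγ⟩ := a.exists_norm_eq
  have h0 : a γ ≠ 0 := by
    rw [← norm_ne_zero_iff, hγ, norm_ne_zero_iff]
    exact ha
  refine ⟨(a γ).valuation, (p : ℚ_[p]) ^ (-(a γ).valuation) • a, ?_, ?_⟩
  · rw [norm_smul, Padic.norm_p_zpow, ← hγ, Padic.norm_eq_zpow_neg_valuation h0, neg_neg,
      ← zpow_add₀ (by exact_mod_cast (Fact.out : p.Prime).ne_zero), add_neg_cancel, zpow_zero]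
  · rw [smul_smul, ← zpow_add₀ hp, add_neg_cancel, zpow_zero, one_smul]

/-- The reduction modulo `p` is a unit of a Laurent polynomial ring over a field, hence a monomial.
Concretely, more than one pair of leading exponents would give two pairs with uniquely represented
sums; both sums would have to be `0`, since `a * b = 1`. -/
theorem exists_lead_eq_singleton {a b : C0 p N} (ha : ‖a‖ = 1) (hb : ‖b‖ = 1) (hab : a * b = 1) :
    ∃ α, a.lead = {α} := by
  have key : ∀ α β, α ∈ a.lead → β ∈ b.lead → UniqueAdd a.lead b.lead α β → α + β = 0 := by
    intro α β hα hβ h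
    have h1 := norm_mul_apply_of_uniqueAdd ha.le hb.le hα hβ h
    rw [hab, one_apply] at h1
    by_contra hne
    simp [hne] at h1
  have hcard : a.lead.card * b.lead.card ≤ 1 := by
    by_contra! hlt
    obtain ⟨⟨α, β⟩, hαβ, ⟨γ, δ⟩, hγδ, hne, hu, hv⟩ := TwoUniqueSums.uniqueAdd_of_one_lt_card hlt
    simp only [Finset.mem_product] at hαβ hγδ hne hu hv
    have h1 := key α β hαβ.1 hαβ.2 hu
    have h2 := key γ δ hγδ.1 hγδ.2 hv
    have := hu hγδ.1 hγδ.2 (h2.trans h1.symm)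
    exact hne (Prod.ext this.1.symm this.2.symm)
  refine Finset.card_eq_one.mp (le_antisymm ?_ (lead_nonempty ha).card_pos)
  exact (Nat.le_mul_of_pos_right _ (lead_nonempty hb).card_pos).trans hcard

end C0

/-! ### Teichmüller representatives -/

/-- Hensel's lemma for `X ^ (p - 1) - 1`: by Fermat `a` is a root modulo `p`, and the derivative `(p
- 1) a ^ (p - 2)` is a unit. -/
theorem exists_teichmuller {a : ℚ_[p]} (ha : ‖a‖ = 1) :
    ∃ ζ : ℚ_[p], ζ ^ (p - 1) = 1 ∧ ‖a - ζ‖ < 1 := by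
  have hp1 : 1 < p := (Fact.out : p.Prime).one_lt
  let x : ℤ_[p] := ⟨a, ha.le⟩
  have hx : ‖x‖ = 1 := ha
  have hxu : IsUnit x := PadicInt.isUnit_iff.mpr hx
  have h1 : ‖x ^ (p - 1) - 1‖ < 1 := by
    rw [PadicInt.norm_lt_one_iff_dvd, ← Ideal.mem_span_singleton, ← PadicInt.maximalIdeal_eq_span_p,
      ← PadicInt.ker_toZMod, RingHom.mem_ker, map_sub, map_pow, map_one,
      ZMod.pow_card_sub_one_eq_one (hxu.map PadicInt.toZMod).ne_zero, sub_self]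
  let F : Polynomial ℤ_[p] := Polynomial.X ^ (p - 1) - 1
  have hd : ‖F.derivative.aeval x‖ = 1 := by
    have h2 : ‖((p - 1 : ℕ) : ℤ_[p])‖ = 1 := by
      rw [PadicInt.norm_def, PadicInt.coe_natCast]
      exact Padic.norm_natCast_p_sub_one
    simp only [F, Polynomial.derivative_sub, Polynomial.derivative_X_pow, Polynomial.derivative_one,
      sub_zero, map_mul, map_pow, Polynomial.aeval_X, map_natCast,
      norm_mul, norm_pow, hx, one_pow, mul_one]
    exact h2
  obtain ⟨z, hz, hzx, -⟩ := hensels_lemma (F := F) (a := x) (by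
    rw [hd]; simpa [F] using h1)
  refine ⟨z, ?_, ?_⟩
  · have : z ^ (p - 1) - 1 = 0 := by simpa [F] using hz
    have h3 := congrArg (fun y : ℤ_[p] => (y : ℚ_[p])) (sub_eq_zero.mp this)
    simpa using h3
  · rw [hd, norm_sub_rev, PadicInt.norm_def] at hzx
    exact hzx

theorem norm_eq_one_of_pow {ζ : ℚ_[p]} (h : ζ ^ (p - 1) = 1) : ‖ζ‖ = 1 := by
  have hp : p - 1 ≠ 0 := Nat.sub_ne_zero_of_lt (Fact.out : p.Prime).one_lt
  have := congrArg norm h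
  rw [norm_pow, norm_one] at this
  exact (pow_eq_one_iff_of_nonneg (norm_nonneg _) hp).mp this

theorem norm_finset_sum_lt {ι : Type*} (s : Finset ι) {f : ι → ℚ_[p]} {c : ℝ} (hc : 0 < c)
    (h : ∀ i ∈ s, ‖f i‖ < c) : ‖∑ i ∈ s, f i‖ < c := by
  classical
  induction s using Finset.induction_on with
  | empty => simpa using hc
  | insert i s hi ih =>
    rw [Finset.sum_insert hi]
    exact (IsUltrametricDist.norm_add_le_max _ _).trans_lt
      (max_lt (h i (Finset.mem_insert_self i s))
        (ih fun j hj => h j (Finset.mem_insert_of_mem hj)))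

/-- `X ^ (p - 1) - 1` has simple roots modulo `p`. For `ζ ≠ ξ` the sum of the `ζ ^ i * ξ ^ (p - 2 -
i)` vanishes, but modulo `p` it is `(p - 1) ξ ^ (p - 2)`, a unit. -/
theorem eq_of_pow_eq_one {ζ ξ : ℚ_[p]} (hζ : ζ ^ (p - 1) = 1) (hξ : ξ ^ (p - 1) = 1)
    (h : ‖ζ - ξ‖ < 1) : ζ = ξ := by
  by_contra hne
  have h1 : (∑ i ∈ Finset.range (p - 1), ζ ^ i * ξ ^ (p - 1 - 1 - i)) * (ζ - ξ) = 0 := by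
    rw [(Commute.all ζ ξ).geom_sum₂_mul, hζ, hξ, sub_self]
  have h2 := (mul_eq_zero.mp h1).resolve_right (sub_ne_zero.mpr hne)
  have hζ1 := norm_eq_one_of_pow hζ
  have hξ1 := norm_eq_one_of_pow hξ
  have h3 : ∀ i, ‖ζ ^ i - ξ ^ i‖ < 1 := by
    intro i
    rw [← (Commute.all ζ ξ).geom_sum₂_mul, norm_mul]
    refine (mul_le_of_le_one_left (norm_nonneg _) ?_).trans_lt h
    refine IsUltrametricDist.norm_sum_le_of_forall_le_of_nonneg zero_le_one fun j _ => ?_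
    rw [norm_mul, norm_pow, norm_pow, hζ1, hξ1, one_pow, one_pow, one_mul]
  have h4 : ‖∑ i ∈ Finset.range (p - 1), (ζ ^ i - ξ ^ i) * ξ ^ (p - 1 - 1 - i)‖ < 1 := by
    refine norm_finset_sum_lt _ one_pos fun i _ => ?_
    rw [norm_mul, norm_pow, hξ1, one_pow, mul_one]
    exact h3 i
  have h5 : ∑ i ∈ Finset.range (p - 1), (ζ ^ i - ξ ^ i) * ξ ^ (p - 1 - 1 - i) =
      -(((p - 1 : ℕ) : ℚ_[p]) * ξ ^ (p - 1 - 1)) := by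
    simp only [sub_mul, Finset.sum_sub_distrib, h2, zero_sub]
    congr 1
    rw [Finset.sum_congr rfl fun i hi => ?_, Finset.sum_const, Finset.card_range, nsmul_eq_mul]
    rw [← pow_add]
    congr 1
    have := Finset.mem_range.mp hi
    omega
  rw [h5, norm_neg, norm_mul, norm_pow, hξ1, one_pow, mul_one, Padic.norm_natCast_p_sub_one] at h4
  exact lt_irrefl _ h4

end

end PadicDet

open scoped TensorProduct

namespace PadicDet

noncomputable section

variable {p : ℕ} [Fact p.Prime] {N : ℕ}

theorem norm_sub_le_max_of_ultrametric {E : Type*} [SeminormedAddCommGroup E] [IsUltrametricDist E]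
    (x y : E) : ‖x - y‖ ≤ max ‖x‖ ‖y‖ := by
  rw [sub_eq_add_neg, ← norm_neg y]
  exact IsUltrametricDist.norm_add_le_max _ _

/-! ### Decomposition of the units of `c₀(Γ)` and the logarithm -/

namespace C0

theorem IsOneUnit.norm_apply_zero {g : C0 p N} (hg : IsOneUnit g) : ‖g 0‖ = 1 := by
  have h : ‖(1 - g) 0‖ < 1 := (norm_apply_le _ _).trans_lt hg
  rw [sub_apply, one_apply, if_pos rfl, norm_sub_rev] at h
  rw [← sub_add_cancel (g 0) 1,
    IsUltrametricDist.norm_add_eq_max_of_norm_ne_norm (by rw [norm_one]; exact h.ne), norm_one,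
    max_eq_right h.le]

theorem IsOneUnit.norm_apply_lt {g : C0 p N} (hg : IsOneUnit g) {γ : Lat N} (hγ : γ ≠ 0) :
    ‖g γ‖ < 1 := by
  have h : ‖(1 - g) γ‖ < 1 := (norm_apply_le _ _).trans_lt hg
  rwa [sub_apply, one_apply, if_neg hγ, zero_sub, norm_neg] at h

theorem IsOneUnit.norm_apply_le_one {g : C0 p N} (hg : IsOneUnit g) (γ : Lat N) :
    ‖g γ‖ ≤ 1 := by
  by_cases h : γ = 0
  · exact h ▸ hg.norm_apply_zero.le
  · exact (hg.norm_apply_lt h).le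

/-- The decomposition `c₀(Γ)ˣ = p^ℤ μ_{p-1} Γ U¹_Γ`. -/
theorem exists_decomposition (u : (C0 p N)ˣ) :
    ∃ (ν : ℤ) (ζ : ℚ_[p]) (γ : Lat N) (g : C0 p N), ζ ^ (p - 1) = 1 ∧ IsOneUnit g ∧
      (u : C0 p N) = ((p : ℚ_[p]) ^ ν * ζ) • (single γ * g) := by
  have hp : (p : ℚ_[p]) ≠ 0 := by exact_mod_cast (Fact.out : p.Prime).ne_zero
  obtain ⟨ν, a, ha, hu⟩ := exists_zpow_smul (u : C0 p N) u.ne_zero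
  obtain ⟨μ, b, hb, hv⟩ := exists_zpow_smul ((u⁻¹ : (C0 p N)ˣ) : C0 p N) u⁻¹.ne_zero
  have hab' : (p : ℚ_[p]) ^ (ν + μ) • (a * b) = 1 := by
    rw [← u.mul_inv, hu, hv, smul_mul_smul_comm, zpow_add₀ hp]
  -- Norms multiply on elements of norm one, so the powers of `p` in `u` and `u⁻¹` cancel.
  have hab : a * b = 1 := by
    have h1 := congrArg norm hab'
    rw [norm_smul, norm_mul_eq_one ha hb, mul_one, norm_one, Padic.norm_p_zpow,
      zpow_eq_one_iff_right₀ (by positivity)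
        (by exact_mod_cast (Fact.out : p.Prime).one_lt.ne')] at h1
    rwa [neg_eq_zero.mp h1, zpow_zero, one_smul] at hab'
  obtain ⟨γ, hγ⟩ := exists_lead_eq_singleton ha hb hab
  have hγ' : ∀ x, ‖a x‖ = 1 ↔ x = γ := fun x => by
    rw [← mem_lead ha.le, hγ, Finset.mem_singleton]
  obtain ⟨ζ, hζ, hζa⟩ := exists_teichmuller ((hγ' γ).mpr rfl)
  have hζ1 := norm_eq_one_of_pow hζ
  have hζ0 : ζ ≠ 0 := norm_ne_zero_iff.mp (by rw [hζ1]; exact one_ne_zero)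
  refine ⟨ν, ζ, γ, ζ⁻¹ • (single (-γ) * a), hζ, ?_, ?_⟩
  · rw [IsOneUnit, norm_lt_iff]
    intro x
    rw [sub_apply, one_apply, smul_apply, single_mul_apply, sub_neg_eq_add]
    split_ifs with hx
    · have h2 : 1 - ζ⁻¹ * a (x + γ) = ζ⁻¹ * (ζ - a γ) := by
        rw [hx, zero_add, mul_sub, inv_mul_cancel₀ hζ0]
      rw [h2, norm_mul, norm_inv, hζ1, inv_one, one_mul, norm_sub_rev]
      exact hζa
    · rw [zero_sub, norm_neg, norm_mul, norm_inv, hζ1, inv_one, one_mul]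
      refine lt_of_le_of_ne ((norm_apply_le a _).trans ha.le) fun h => hx ?_
      simpa using (hγ' _).mp h
  · rw [hu, mul_smul_comm, ← mul_assoc, single_mul_single, add_neg_cancel, ← one_def, one_mul,
      smul_smul, mul_assoc, mul_inv_cancel₀ hζ0, mul_one]

/-- The coefficients of a one-unit have norm one at `0` and smaller norm elsewhere. Comparing
coefficients therefore determines in turn `ν` (largest norm), `γ` (where it is attained) and `ζ` (by
its residue). -/
theorem decomposition_unique {ν ν' : ℤ} {ζ ζ' : ℚ_[p]} {γ γ' : Lat N} {g g' : C0 p N}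
    (hζ : ζ ^ (p - 1) = 1) (hζ' : ζ' ^ (p - 1) = 1) (hg : IsOneUnit g) (hg' : IsOneUnit g')
    (h : ((p : ℚ_[p]) ^ ν * ζ) • (single γ * g) = ((p : ℚ_[p]) ^ ν' * ζ') • (single γ' * g')) :
    g = g' := by
  have hp : (p : ℚ_[p]) ≠ 0 := by exact_mod_cast (Fact.out : p.Prime).ne_zero
  have hval : ∀ x, (p : ℚ_[p]) ^ ν * ζ * g (x - γ) = (p : ℚ_[p]) ^ ν' * ζ' * g' (x - γ') := by
    intro x
    have := DFunLike.congr_fun h x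
    simpa only [smul_apply, single_mul_apply] using this
  have hnorm : ∀ {ν ν' : ℤ} {ζ ζ' : ℚ_[p]} {γ γ' : Lat N} {g g' : C0 p N}, ζ ^ (p - 1) = 1 →
      ζ' ^ (p - 1) = 1 → IsOneUnit g → IsOneUnit g' →
      (∀ x, (p : ℚ_[p]) ^ ν * ζ * g (x - γ) = (p : ℚ_[p]) ^ ν' * ζ' * g' (x - γ')) →
      ‖(p : ℚ_[p]) ^ ν‖ ≤ ‖(p : ℚ_[p]) ^ ν'‖ := by
    intro ν ν' ζ ζ' γ γ' g g' hζ hζ' hg hg' hv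
    have h1 := congrArg norm (hv γ)
    rw [sub_self, norm_mul, norm_mul, norm_mul, norm_mul, norm_eq_one_of_pow hζ,
      norm_eq_one_of_pow hζ', hg.norm_apply_zero, mul_one, mul_one, mul_one] at h1
    rw [h1]
    exact mul_le_of_le_one_right (norm_nonneg _) (hg'.norm_apply_le_one _)
  have hν : ‖(p : ℚ_[p]) ^ ν‖ = ‖(p : ℚ_[p]) ^ ν'‖ :=
    le_antisymm (hnorm hζ hζ' hg hg' hval) (hnorm hζ' hζ hg' hg fun x => (hval x).symm)
  have hν' : ν = ν' := by
    rw [Padic.norm_p_zpow, Padic.norm_p_zpow] at hν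
    have hp1 : (1 : ℝ) < p := by exact_mod_cast (Fact.out : p.Prime).one_lt
    have := zpow_right_injective₀ (by positivity) hp1.ne' hν
    exact neg_injective this
  subst hν'
  have hval' : ∀ x, ζ * g (x - γ) = ζ' * g' (x - γ') := fun x => by
    have := hval x
    rw [mul_assoc, mul_assoc] at this
    exact mul_left_cancel₀ (zpow_ne_zero _ hp) this
  have hγ : γ = γ' := by
    by_contra hne
    have h1 := congrArg norm (hval' γ)
    rw [sub_self, norm_mul, norm_mul, norm_eq_one_of_pow hζ, norm_eq_one_of_pow hζ',
      hg.norm_apply_zero, one_mul, one_mul] at h1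
    exact (hg'.norm_apply_lt (sub_ne_zero.mpr hne)).ne h1.symm
  subst hγ
  have hζζ : ζ = ζ' := by
    refine eq_of_pow_eq_one hζ hζ' ?_
    have h1 := hval' γ
    rw [sub_self] at h1
    have h2 : ‖1 - g 0‖ < 1 := by
      simpa [one_apply] using (norm_apply_le (1 - g) 0).trans_lt hg
    have h2' : ‖1 - g' 0‖ < 1 := by
      simpa [one_apply] using (norm_apply_le (1 - g') 0).trans_lt hg'
    have h3 : ζ - ζ' = ζ * (1 - g 0) - ζ' * (1 - g' 0) := by
      rw [mul_sub, mul_sub, h1]; ring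
    rw [h3]
    refine (norm_sub_le_max_of_ultrametric _ _).trans_lt ?_
    rw [norm_mul, norm_mul, norm_eq_one_of_pow hζ, norm_eq_one_of_pow hζ', one_mul, one_mul]
    exact max_lt h2 h2'
  subst hζζ
  have hζ0 : ζ ≠ 0 := norm_ne_zero_iff.mp (by rw [norm_eq_one_of_pow hζ]; exact one_ne_zero)
  ext x
  have := hval' (x + γ)
  rw [add_sub_cancel_right] at this
  exact mul_left_cancel₀ hζ0 this

theorem existsUnique_hasLogDet (u : (C0 p N)ˣ) : ∃! q, HasLogDet u q := by
  obtain ⟨ν, ζ, γ, g, hζ, hg, hu⟩ := exists_decomposition u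
  refine ⟨tr (log g), ⟨ν, ζ, γ, g, hζ, hg, hu, rfl⟩, ?_⟩
  rintro _ ⟨ν', ζ', γ', g', hζ', hg', hu', rfl⟩
  rw [decomposition_unique hζ hζ' hg hg' (hu.symm.trans hu')]

/-! ### The logarithm as a limit -/

/-- The limit is the binomial coefficient of `-1` over `k`, because `p ^ n - 1` tends to `-1` in
`ℚ_p`. -/
theorem tendsto_choose (p : ℕ) [Fact p.Prime] (k : ℕ) :
    Filter.Tendsto (fun n : ℕ => ((p ^ n - 1).choose k : ℚ_[p])) Filter.atTop
      (nhds ((-1) ^ k)) := by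
  have hp0 : Filter.Tendsto (fun n : ℕ => (p : ℚ_[p]) ^ n) Filter.atTop (nhds 0) :=
    tendsto_pow_atTop_nhds_zero_of_norm_lt_one Padic.norm_p_lt_one
  induction k with
  | zero => simp
  | succ k ih =>
    have h1 : ∀ n : ℕ, ((p ^ n - 1).choose (k + 1) : ℚ_[p]) =
        (p : ℚ_[p]) ^ n * ((p ^ n - 1).choose k / (k + 1 : ℚ_[p])) - (p ^ n - 1).choose k := by
      intro n
      obtain ⟨m, hm⟩ : ∃ m, p ^ n = m + 1 :=
        Nat.exists_eq_succ_of_ne_zero (pow_ne_zero _ (Fact.out : p.Prime).ne_zero)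
      have hk : (k + 1 : ℚ_[p]) ≠ 0 := by exact_mod_cast k.succ_ne_zero
      have h2 : (p : ℚ_[p]) ^ n = m + 1 := by exact_mod_cast congrArg (Nat.cast (R := ℚ_[p])) hm
      have h3 : ((m : ℚ_[p]) + 1) * m.choose k = (m + 1).choose (k + 1) * (k + 1) := by
        exact_mod_cast Nat.add_one_mul_choose_eq m k
      rw [hm, h2, Nat.add_sub_cancel, mul_div_assoc', h3, mul_div_cancel_right₀ _ hk,
        Nat.choose_succ_succ]
      push_cast
      ring
    refine (((hp0.mul (ih.div_const _)).sub ih).congr fun n => (h1 n).symm).trans_eq ?_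
    congr 1
    ring

theorem norm_inv_natCast_le (k : ℕ) : ‖((k + 1 : ℚ_[p]))⁻¹‖ ≤ k + 1 := by
  have hk : (k + 1 : ℚ_[p]) ≠ 0 := by exact_mod_cast k.succ_ne_zero
  have hp1 : (1 : ℝ) < p := by exact_mod_cast (Fact.out : p.Prime).one_lt
  have h1 : ((k + 1 : ℕ) : ℚ_[p]) = k + 1 := by push_cast; rfl
  rw [norm_inv, ← h1, Padic.norm_eq_zpow_neg_valuation (by rw [h1]; exact hk), ← zpow_neg,
    neg_neg, Padic.valuation_natCast, zpow_natCast]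
  exact_mod_cast Nat.le_of_dvd k.succ_pos pow_padicValNat_dvd

/-- Since `p⁻ⁿ C(pⁿ, k + 1) = C(pⁿ - 1, k) / (k + 1)`, the binomial expansion at `x = g - 1`
converges term by term to the logarithm series. This handles the sign for `p = 2` without the
functional equation of `log`. -/
theorem tendsto_log {g : C0 p N} (hg : IsOneUnit g) :
    Filter.Tendsto (fun n : ℕ => ((p : ℚ_[p]) ^ n)⁻¹ • (g ^ p ^ n - 1)) Filter.atTop
      (nhds (log g)) := by
  have hp : (p : ℚ_[p]) ≠ 0 := by exact_mod_cast (Fact.out : p.Prime).ne_zero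
  set x := g - 1 with hx
  have hx1 : ‖x‖ < 1 := by rw [hx, norm_sub_rev]; exact hg
  let F : ℕ → ℕ → C0 p N := fun n k =>
    (((p ^ n - 1).choose k : ℚ_[p]) * (k + 1 : ℚ_[p])⁻¹) • x ^ (k + 1)
  have hF : ∀ n, ∑' k, F n k = ((p : ℚ_[p]) ^ n)⁻¹ • (g ^ p ^ n - 1) := by
    intro n
    obtain ⟨m, hm⟩ : ∃ m, p ^ n = m + 1 :=
      Nat.exists_eq_succ_of_ne_zero (pow_ne_zero _ (Fact.out : p.Prime).ne_zero)
    have h2 : (p : ℚ_[p]) ^ n = m + 1 := by exact_mod_cast congrArg (Nat.cast (R := ℚ_[p])) hm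
    have hm0 : (m + 1 : ℚ_[p]) ≠ 0 := by exact_mod_cast m.succ_ne_zero
    rw [tsum_eq_sum (s := Finset.range (m + 1))]
    · have h3 : g ^ (m + 1) - 1 =
          ∑ k ∈ Finset.range (m + 1), (((m + 1).choose (k + 1) : ℕ) : ℚ_[p]) • x ^ (k + 1) := by
        rw [show g = x + 1 by rw [hx, sub_add_cancel], add_pow, Finset.sum_range_succ']
        simp only [one_pow, mul_one, pow_zero, Nat.choose_zero_right, Nat.cast_one,
          add_sub_cancel_right]
        refine Finset.sum_congr rfl fun k _ => ?_
        rw [Nat.cast_smul_eq_nsmul, nsmul_eq_mul, mul_comm]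
      rw [hm, h3, h2, Finset.smul_sum]
      refine Finset.sum_congr rfl fun k _ => ?_
      have hk : (k + 1 : ℚ_[p]) ≠ 0 := by exact_mod_cast k.succ_ne_zero
      have h4 : ((m : ℚ_[p]) + 1) * m.choose k = (m + 1).choose (k + 1) * (k + 1) := by
        exact_mod_cast Nat.add_one_mul_choose_eq m k
      rw [smul_smul]
      simp only [F]
      rw [hm, Nat.add_sub_cancel]
      congr 1
      field_simp
      linear_combination h4
    · intro k hk
      simp only [F]
      rw [hm, Nat.add_sub_cancel, Nat.choose_eq_zero_of_lt (by simpa using hk)]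
      simp
  have hlog : log g = ∑' k : ℕ, ((-1 : ℚ_[p]) ^ k * (k + 1 : ℚ_[p])⁻¹) • x ^ (k + 1) := by
    rw [log, ← tsum_neg]
    refine tsum_congr fun k => ?_
    rw [show 1 - g = (-1 : ℚ_[p]) • x by rw [neg_one_smul, hx, neg_sub], smul_pow, smul_smul,
      ← neg_smul]
    congr 1
    ring
  rw [hlog]
  refine Filter.Tendsto.congr hF ?_
  -- The bound uses that binomial coefficients are `p`-adic integers and that the norm of `1 / (k +
  -- 1)` is at most `k + 1`.
  refine tendsto_tsum_of_dominated_convergence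
    (bound := fun k : ℕ => ((k + 1 : ℕ) : ℝ) * ‖x‖ ^ (k + 1)) ?_ ?_ ?_
  · have h5 := summable_pow_mul_geometric_of_norm_lt_one 1 (r := ‖x‖) (by rwa [norm_norm])
    simpa using (summable_nat_add_iff 1).mpr h5
  · intro k
    exact ((tendsto_choose p k).mul_const _).smul_const _
  · refine Filter.Eventually.of_forall fun n k => ?_
    rw [norm_smul, norm_mul]
    have h6 : ‖((p ^ n - 1).choose k : ℚ_[p])‖ ≤ 1 := by
      exact_mod_cast Padic.norm_int_le_one ((p ^ n - 1).choose k : ℤ)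
    refine mul_le_mul ?_ (norm_pow_le _ _) (norm_nonneg _) (by positivity)
    push_cast
    exact (mul_le_of_le_one_left (norm_nonneg _) h6).trans (norm_inv_natCast_le k)

theorem log_neg (hp2 : p = 2) {g : C0 p N} (hg : IsOneUnit g) (hg' : IsOneUnit (-g)) :
    log (-g) = log g := by
  refine tendsto_nhds_unique (tendsto_log hg') ((tendsto_log hg).congr' ?_)
  filter_upwards [Filter.eventually_ge_atTop 1] with n hn
  have : Even (p ^ n) := by
    rw [hp2]
    exact (even_two).pow_of_ne_zero (by omega)
  rw [this.neg_pow]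

/-! ### Invariance under `± Γ` -/

theorem HasLogDet.unitSingle_mul {u : (C0 p N)ˣ} {q : ℚ_[p]} (h : HasLogDet u q) (γ : Lat N) :
    HasLogDet (unitSingle γ * u) q := by
  obtain ⟨ν, ζ, δ, g, hζ, hg, hu, hq⟩ := h
  refine ⟨ν, ζ, γ + δ, g, hζ, hg, ?_, hq⟩
  rw [Units.val_mul, hu, mul_smul_comm, ← mul_assoc, ← single_mul_single]
  rfl

/-- For odd `p` the sign is absorbed in `ζ`, as `-1` is a `(p - 1)`-st root of unity. For `p = 2`
the element `-g` is again a one-unit, with the same logarithm. -/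
theorem HasLogDet.neg {u : (C0 p N)ˣ} {q : ℚ_[p]} (h : HasLogDet u q) : HasLogDet (-u) q := by
  obtain ⟨ν, ζ, δ, g, hζ, hg, hu, hq⟩ := h
  rcases (Fact.out : p.Prime).eq_two_or_odd' with hp2 | hodd
  · have hg' : IsOneUnit (-g) := by
      have h2 : ‖(2 : C0 p N)‖ < 1 := by
        have h1 : (2 : C0 p N) = (p : ℚ_[p]) • (1 : C0 p N) := by
          rw [Nat.cast_smul_eq_nsmul, nsmul_one]
          exact_mod_cast congrArg (Nat.cast (R := C0 p N)) hp2.symm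
        rw [h1, norm_smul, norm_one, mul_one]
        exact Padic.norm_p_lt_one
      rw [IsOneUnit, show 1 - -g = 2 - (1 - g) by ring]
      exact (norm_sub_le_max_of_ultrametric _ _).trans_lt (max_lt h2 hg)
    refine ⟨ν, ζ, δ, -g, hζ, hg', ?_, by rw [log_neg hp2 hg hg', hq]⟩
    rw [Units.val_neg, hu, mul_neg, smul_neg]
  · refine ⟨ν, -ζ, δ, g, ?_, hg, ?_, hq⟩
    · rw [(Nat.Odd.sub_odd hodd odd_one).neg_pow, hζ]
    · rw [Units.val_neg, hu, mul_neg, neg_smul]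

end C0

/-! ### The logarithmic determinant on `K_T` -/

theorem K1.det_ofUnit {A : Type*} [CommRing A] (u : Aˣ) : K1.det (K1.ofUnit u) = u := by
  ext1
  simp only [K1.det, K1.ofUnit, MonoidHom.comp_apply, K1.lift_mk]
  change Matrix.det (Matrix.scalar (Fin 1) (u : A)) = u
  simp

theorem K1.det_map {A B : Type*} [CommRing A] [CommRing B] (φ : A →+* B) (ξ : K1 A) :
    (K1.det (K1.map φ ξ) : B) = φ (K1.det ξ) := by
  obtain ⟨r, f, rfl⟩ : ∃ (r : ℕ) (f : Matrix.GeneralLinearGroup (Fin r) A), K1.mk r f = ξ := by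
    obtain ⟨y, rfl⟩ := QuotientGroup.mk_surjective ξ
    induction y using DirectLimit.induction with
    | _ r f => exact ⟨r, f, rfl⟩
  simp only [K1.det, K1.map, K1.lift_mk, MonoidHom.comp_apply]
  change Matrix.det (f.val.map φ) = φ (Matrix.det f.val)
  rw [RingHom.map_det, RingHom.mapMatrix_apply]

theorem hasLogDet_det_mul_iff {t : K1 (C0 p N)} (ht : t ∈ trivialUnits p N) (x : K1 (C0 p N))
    (q : ℚ_[p]) : C0.HasLogDet (K1.det (t * x)) q ↔ C0.HasLogDet (K1.det x) q := by
  have key : ∀ t ∈ trivialUnits p N, ∀ (x : K1 (C0 p N)) (q : ℚ_[p]),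
      C0.HasLogDet (K1.det x) q → C0.HasLogDet (K1.det (t * x)) q := by
    intro t ht
    induction ht using Subgroup.closure_induction with
    | mem t ht =>
      intro x q h
      rw [map_mul]
      rcases ht with rfl | ⟨γ, rfl⟩
      · rw [K1.det_ofUnit, neg_one_mul]
        exact h.neg
      · rw [K1.det_ofUnit]
        exact h.unitSingle_mul γ
    | one => intro x q h; rwa [one_mul]
    | mul s t _ _ hs ht => intro x q h; rw [mul_assoc]; exact hs _ _ (ht _ _ h)
    -- Inverses need no new computation: a value exists for `t⁻¹ * x`, it is also a value for `x`,
    -- and values are unique.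
    | inv t _ ht =>
      intro x q h
      obtain ⟨q', hq', -⟩ := C0.existsUnique_hasLogDet (K1.det (t⁻¹ * x))
      have h1 := ht _ _ hq'
      rw [mul_inv_cancel_left] at h1
      rwa [(C0.existsUnique_hasLogDet _).unique h h1]
  refine ⟨fun h => ?_, key t ht x q⟩
  have := key t⁻¹ (inv_mem ht) _ _ h
  rwa [inv_mul_cancel_left] at this

theorem hasLogDet_mk (x : K1 (C0 p N)) (q : ℚ_[p]) :
    HasLogDet (QuotientGroup.mk x : KT p N) q ↔ C0.HasLogDet (K1.det x) q := by
  refine ⟨?_, fun h => ⟨x, rfl, h⟩⟩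
  rintro ⟨y, hy, h⟩
  have h1 := QuotientGroup.eq.mp hy
  have h2 := (hasLogDet_det_mul_iff h1 y q).mpr h
  rwa [mul_comm, mul_inv_cancel_left] at h2

theorem hasLogDet_iff (t : KT p N) (q : ℚ_[p]) : HasLogDet t q ↔ q = logDetKT t := by
  obtain ⟨x, rfl⟩ := QuotientGroup.mk_surjective t
  obtain ⟨q₀, h₀, -⟩ := C0.existsUnique_hasLogDet (K1.det x)
  have hex : ∃ q, HasLogDet (QuotientGroup.mk x : KT p N) q := ⟨q₀, (hasLogDet_mk x q₀).mpr h₀⟩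
  have h1 : HasLogDet (QuotientGroup.mk x : KT p N) (logDetKT (QuotientGroup.mk x)) := by
    rw [logDetKT, dif_pos hex]
    exact hex.choose_spec
  refine ⟨fun h => ?_, fun h => h ▸ h1⟩
  rw [hasLogDet_mk] at h h1
  exact (C0.existsUnique_hasLogDet _).unique h h1

/-- Elements of `K₁(c₀(Γ))` whose determinants agree up to `± Γ` have the same logarithmic
determinant. -/
theorem logDetKT_eq_of_det {x y t : K1 (C0 p N)} (ht : t ∈ trivialUnits p N)
    (h : K1.det x = K1.det t * K1.det y) :
    logDetKT (QuotientGroup.mk x : KT p N) = logDetKT (QuotientGroup.mk y : KT p N) := by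
  have h1 := (hasLogDet_iff (QuotientGroup.mk x : KT p N) _).mpr rfl
  rw [hasLogDet_mk, h, ← map_mul, hasLogDet_det_mul_iff ht] at h1
  exact (hasLogDet_iff _ _).mp ((hasLogDet_mk _ _).mpr h1)

end

end PadicDet

open scoped TensorProduct

namespace PadicDet

universe u

/-! ### Expansive modules are `S_p`-torsion -/

noncomputable section

/-- If `S ⊗ M = 0` for a finitely generated module `M`, then the annihilator of `M` generates the
unit ideal of `S`. -/
theorem map_annihilator_eq_top {R S M : Type*} [CommRing R] [CommRing S] [Algebra R S]
    [AddCommGroup M] [Module R M] [Module.Finite R M] [Subsingleton (S ⊗[R] M)] :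
    (Module.annihilator R M).map (algebraMap R S) = ⊤ := by
  by_contra hne
  obtain ⟨𝔪, hmax, hle⟩ := Ideal.exists_le_maximal _ hne
  let 𝔭 : Ideal R := 𝔪.comap (algebraMap R S)
  -- As `M` is finitely generated, its support is the zero locus of its annihilator, so the fibre of
  -- `M` at `𝔭` is nonzero.
  have hsupp : (⟨𝔭, inferInstance⟩ : PrimeSpectrum R) ∈ Module.support R M := by
    rw [Module.support_eq_zeroLocus, PrimeSpectrum.mem_zeroLocus]
    exact Ideal.map_le_iff_le_comap.mp hle
  have hnt := (Module.mem_support_iff_nontrivial_residueField_tensorProduct _).mp hsupp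
  change Nontrivial (𝔭.ResidueField ⊗[R] M) at hnt
  obtain ⟨x, hx⟩ := exists_ne (0 : 𝔭.ResidueField ⊗[R] M)
  obtain ⟨f, hf⟩ : ∃ f : Module.Dual 𝔭.ResidueField (𝔭.ResidueField ⊗[R] M), f x ≠ 0 := by
    by_contra! h
    exact hx ((Module.forall_dual_apply_eq_zero_iff 𝔭.ResidueField x).mp h)
  let ψ : 𝔭.ResidueField →ₐ[R] 𝔪.ResidueField :=
    Ideal.ResidueField.mapₐ 𝔭 𝔪 (Algebra.ofId R S) rfl
  let g : M →ₗ[R] 𝔪.ResidueField :=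
    ψ.toLinearMap ∘ₗ f.restrictScalars R ∘ₗ TensorProduct.mk R 𝔭.ResidueField M 1
  have hg : ∀ m, g m = 0 := by
    intro m
    -- An `R`-linear map from `M` to an `S`-module factors through `S ⊗ M = 0`, so `g` vanishes,
    -- which contradicts `f x ≠ 0`.
    let G : S ⊗[R] M →ₗ[S] 𝔪.ResidueField := TensorProduct.AlgebraTensorModule.lift
      ((LinearMap.lsmul S (M →ₗ[R] 𝔪.ResidueField)).flip g)
    have h1 : G (1 ⊗ₜ m) = g m := by simp [G]
    rw [← h1, Subsingleton.elim ((1 : S) ⊗ₜ[R] m) 0, map_zero]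
  refine hf ?_
  clear hf hx
  induction x with
  | zero => rw [map_zero]
  | add x y hx hy => rw [map_add, hx, hy, add_zero]
  | tmul a m =>
    have h2 : a ⊗ₜ[R] m = a • ((1 : 𝔭.ResidueField) ⊗ₜ[R] m) := by
      rw [TensorProduct.smul_tmul', smul_eq_mul, mul_one]
    rw [h2, map_smul]
    have h3 : f (1 ⊗ₜ m) = 0 := ψ.toRingHom.injective ((hg m).trans (map_zero _).symm)
    rw [h3, smul_zero]

variable {p : ℕ} [Fact p.Prime] {N : ℕ}

namespace C0

/-- `ℤ[1/p]Γ` is dense in `c₀(Γ)`. -/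
theorem exists_norm_sub_lt (a : C0 p N) {ε : ℝ} (hε : 0 < ε) :
    ∃ (k : ℕ) (z : GrpRing N),
      ‖a - ((p : ℚ_[p]) ^ k)⁻¹ • algebraMap (GrpRing N) (C0 p N) z‖ < ε := by
  have hp0 : (p : ℚ_[p]) ≠ 0 := by exact_mod_cast (Fact.out : p.Prime).ne_zero
  have hp1 : (1 : ℝ) < p := by exact_mod_cast (Fact.out : p.Prime).one_lt
  -- After scaling by `p ^ k` the coefficients are `p`-adic integers, in which `ℤ` is dense;
  -- coefficients of norm below `ε` are dropped.
  obtain ⟨k, hk⟩ := pow_unbounded_of_one_lt ‖a‖ hp1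
  have hpk : ‖(p : ℚ_[p]) ^ k‖ = ((p : ℝ) ^ k)⁻¹ := by
    rw [norm_pow, Padic.norm_p, inv_pow]
  have hint : ∀ γ, ∃ z : ℤ, ‖(p : ℚ_[p]) ^ k * a γ - z‖ < ε * ((p : ℝ) ^ k)⁻¹ := by
    intro γ
    have h1 : ‖(p : ℚ_[p]) ^ k * a γ‖ ≤ 1 := by
      rw [norm_mul, hpk]
      exact inv_mul_le_one_of_le₀ ((norm_apply_le a γ).trans hk.le) (by positivity)
    obtain ⟨b, hb⟩ : ∃ b : ℤ_[p], (b : ℚ_[p]) = (p : ℚ_[p]) ^ k * a γ := ⟨⟨_, h1⟩, rfl⟩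
    obtain ⟨z, hz⟩ := (PadicInt.denseRange_intCast (p := p)).exists_dist_lt b
      (show 0 < ε * ((p : ℝ) ^ k)⁻¹ by positivity)
    rw [dist_eq_norm, PadicInt.norm_def, PadicInt.coe_sub, PadicInt.coe_intCast, hb] at hz
    exact ⟨z, hz⟩
  choose z hz using hint
  let s := (a.finite_setOf_le hε).toFinset
  refine ⟨k, ∑ γ ∈ s, AddMonoidAlgebra.single γ (z γ), norm_lt_iff.mpr fun x => ?_⟩
  have hval : (algebraMap (GrpRing N) (C0 p N) (∑ γ ∈ s, AddMonoidAlgebra.single γ (z γ))) x =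
      if x ∈ s then (z x : ℚ_[p]) else 0 := by
    rw [algebraMap_apply, AddMonoidAlgebra.coeff_sum, Finsupp.finsetSum_apply]
    simp [AddMonoidAlgebra.coeff_single, Finsupp.single_apply]
  rw [sub_apply, smul_apply, hval]
  split_ifs with hx
  · have h2 : a x - ((p : ℚ_[p]) ^ k)⁻¹ * z x =
        ((p : ℚ_[p]) ^ k)⁻¹ * ((p : ℚ_[p]) ^ k * a x - z x) := by
      rw [mul_sub, inv_mul_cancel_left₀ (pow_ne_zero k hp0)]
    rw [h2, norm_mul, norm_inv, hpk, inv_inv]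
    have h3 := hz x
    rw [← div_eq_mul_inv, lt_div_iff₀ (by positivity), mul_comm] at h3
    exact h3
  · rw [mul_zero, sub_zero]
    by_contra! h
    exact hx ((a.finite_setOf_le hε).mem_toFinset.mpr h)

/-- Elements of `I c₀(Γ)` are limits of elements of `I[1/p]`: the approximable elements contain `I`,
are closed under sums after taking a common denominator, and are closed under multiplication by
`c₀(Γ)` because `ℤ[1/p]Γ` is dense. -/
theorem exists_mem_ideal_norm_sub_lt (I : Ideal (GrpRing N)) {a : C0 p N}
    (ha : a ∈ I.map (algebraMap (GrpRing N) (C0 p N))) :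
    ∀ ε : ℝ, 0 < ε → ∃ (k : ℕ) (z : GrpRing N), z ∈ I ∧
      ‖a - ((p : ℚ_[p]) ^ k)⁻¹ • algebraMap (GrpRing N) (C0 p N) z‖ < ε := by
  have hp0 : (p : ℚ_[p]) ≠ 0 := by exact_mod_cast (Fact.out : p.Prime).ne_zero
  have hsmul : ∀ (k : ℕ) (z : GrpRing N), (p : ℚ_[p]) ^ k • algebraMap (GrpRing N) (C0 p N) z =
      algebraMap (GrpRing N) (C0 p N) ((p ^ k : ℕ) • z) := by
    intro k z
    rw [map_nsmul, ← Nat.cast_smul_eq_nsmul ℚ_[p], Nat.cast_pow]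
  induction ha using Submodule.span_induction with
  | mem x hx =>
    obtain ⟨z, hz, rfl⟩ := hx
    intro ε hε
    exact ⟨0, z, hz, by simpa using hε⟩
  | zero =>
    intro ε hε
    exact ⟨0, 0, I.zero_mem, by simpa using hε⟩
  | add x y _ _ hx hy =>
    intro ε hε
    obtain ⟨k, z, hz, h1⟩ := hx ε hε
    obtain ⟨l, w, hw, h2⟩ := hy ε hε
    refine ⟨k + l, (p ^ l) • z + (p ^ k) • w,
      add_mem (I.nsmul_mem hz _) (I.nsmul_mem hw _), ?_⟩
    have h3 : ((p : ℚ_[p]) ^ (k + l))⁻¹ •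
        algebraMap (GrpRing N) (C0 p N) ((p ^ l) • z + (p ^ k) • w) =
        ((p : ℚ_[p]) ^ k)⁻¹ • algebraMap (GrpRing N) (C0 p N) z +
          ((p : ℚ_[p]) ^ l)⁻¹ • algebraMap (GrpRing N) (C0 p N) w := by
      rw [map_add, ← hsmul, ← hsmul, smul_add, smul_smul, smul_smul, pow_add, mul_inv]
      congr 2
      · field_simp
      · field_simp
    rw [h3, add_sub_add_comm]
    exact (IsUltrametricDist.norm_add_le_max _ _).trans_lt (max_lt h1 h2)
  | smul a x _ hx =>
    intro ε hε
    obtain ⟨k, z, hz, h1⟩ := hx (ε / (‖a‖ + 1)) (by positivity)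
    set y := ((p : ℚ_[p]) ^ k)⁻¹ • algebraMap (GrpRing N) (C0 p N) z with hy
    obtain ⟨l, w, h2⟩ := exists_norm_sub_lt a (ε := ε / (‖y‖ + 1)) (by positivity)
    refine ⟨l + k, w * z, I.mul_mem_left _ hz, ?_⟩
    have h3 : a • x - ((p : ℚ_[p]) ^ (l + k))⁻¹ • algebraMap (GrpRing N) (C0 p N) (w * z) =
        a * (x - y) + (a - ((p : ℚ_[p]) ^ l)⁻¹ • algebraMap (GrpRing N) (C0 p N) w) * y := by
      rw [map_mul, pow_add, mul_inv, ← smul_mul_smul_comm, ← hy, smul_eq_mul]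
      ring
    rw [h3]
    refine (IsUltrametricDist.norm_add_le_max _ _).trans_lt (max_lt ?_ ?_)
    · refine (norm_mul_le _ _).trans_lt ?_
      rw [lt_div_iff₀ (by positivity)] at h1
      nlinarith [norm_nonneg a, norm_nonneg (x - y)]
    · refine (norm_mul_le _ _).trans_lt ?_
      rw [lt_div_iff₀ (by positivity)] at h2
      nlinarith [norm_nonneg y,
        norm_nonneg (a - ((p : ℚ_[p]) ^ l)⁻¹ • algebraMap (GrpRing N) (C0 p N) w)]

end C0

/-- A `p`-adically expansive module is `S_p`-torsion. -/
theorem IsPadicallyExpansive.isSpTorsion {M : Type u} [AddCommGroup M] [Module (GrpRing N) M]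
    (hM : IsPadicallyExpansive p N M) : IsSpTorsion p N M := by
  have := hM.finite
  have := hM.subsingleton
  have h1 : (1 : C0 p N) ∈
      (Module.annihilator (GrpRing N) M).map (algebraMap (GrpRing N) (C0 p N)) := by
    rw [map_annihilator_eq_top]; trivial
  -- An annihilator `s` with `p⁻ᵏ s` at distance less than one from `1` is a unit of `c₀(Γ)` by the
  -- geometric series.
  obtain ⟨k, s, hs, h⟩ := C0.exists_mem_ideal_norm_sub_lt _ h1 1 one_pos
  refine fun m => ⟨s, ?_, Module.mem_annihilator.mp hs m⟩
  have hu : IsUnit (((p : ℚ_[p]) ^ k)⁻¹ • algebraMap (GrpRing N) (C0 p N) s) := by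
    rw [← sub_sub_cancel (1 : C0 p N) (((p : ℚ_[p]) ^ k)⁻¹ • algebraMap (GrpRing N) (C0 p N) s)]
    exact isUnit_one_sub_of_norm_lt_one h
  rw [mem_Sp]
  rw [Algebra.smul_def] at hu
  exact isUnit_of_mul_isUnit_right hu

end

end PadicDet

open scoped TensorProduct

namespace PadicDet

universe u

/-! ### Based resolutions as graded matrices -/

noncomputable section

theorem IsContraction.map {ι A B : Type*} [Fintype ι] [DecidableEq ι] [CommRing A] [CommRing B]
    {deg : ι → ℕ} {D H : Matrix ι ι A} (h : IsContraction deg D H) (φ : A →+* B) :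
    IsContraction deg (D.map φ) (H.map φ) := by
  refine ⟨h.hom.map φ, ?_⟩
  rw [← Matrix.map_mul, ← Matrix.map_mul, ← Matrix.map_add φ (map_add φ), h.eq_one,
    Matrix.map_one φ (map_zero φ) (map_one φ)]

/-- After inverting an element which kills `M`, a resolution of `M` is contractible. -/
theorem GradedRes.exists_contraction {ι A B M : Type*} [Fintype ι] [DecidableEq ι] [CommRing A]
    [CommRing B] [AddCommGroup M] [Module A M] {deg : ι → ℕ} {D : Matrix ι ι A}
    {aug : (ι → A) →ₗ[A] M} (hres : GradedRes deg D aug) {s : A} (hs : ∀ m : M, s • m = 0)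
    (φ : A →+* B) (hu : IsUnit (φ s)) : ∃ H, IsContraction deg (D.map φ) H := by
  obtain ⟨S, hS, hDS⟩ := hres.exists_homotopy hs
  obtain ⟨c, hc⟩ := hu.exists_left_inv
  refine ⟨c • S.map φ, (hS.map φ).smul c, ?_⟩
  have h1 : D.map φ * S.map φ + S.map φ * D.map φ = φ s • (1 : Matrix ι ι B) := by
    rw [← Matrix.map_mul, ← Matrix.map_mul, ← Matrix.map_add φ (map_add φ), hDS]
    ext x y
    simp [Matrix.one_apply, apply_ite φ]
  rw [Matrix.mul_smul, Matrix.smul_mul, ← smul_add, h1, smul_smul, hc, one_smul]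

namespace BasedResolution

variable {p : ℕ} [Fact p.Prime] {N : ℕ} {M : Type u} [AddCommGroup M] [Module (GrpRing N) M]
  (F : BasedResolution N M)

/-- The basis of the sum of all `F_i`. -/
abbrev Idx : Type := Σ i : Fin (F.len + 1), Fin (F.rank i)

/-- The degree of a basis element. -/
abbrev deg (x : F.Idx) : ℕ := x.1

/-- Since the ranks vanish beyond `len`, families over all `i : ℕ` are the same as vectors over the
finite index type `F.Idx`. -/
theorem le_len {i : ℕ} (j : Fin (F.rank i)) : i ≤ F.len := by
  by_contra! h
  have h0 := F.rank_eq_zero i h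
  have := j.2
  omega

/-- The `j`-th basis element of `F_i`. -/
def idx (i : ℕ) (j : Fin (F.rank i)) : F.Idx := ⟨⟨i, Nat.lt_succ_of_le (F.le_len j)⟩, j⟩

section Vectors

variable (A : Type*) [CommRing A]

/-- Elements of the sum of the `A^(rank i)`, as families and as vectors. -/
def vecEquiv : (∀ i, Fin (F.rank i) → A) ≃ₗ[A] (F.Idx → A) where
  toFun v x := v x.1 x.2
  invFun w i j := w (F.idx i j)
  map_add' _ _ := rfl
  map_smul' _ _ := rfl
  left_inv _ := rfl
  right_inv _ := rfl

variable {A}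

theorem vecEquiv_apply (v : ∀ i, Fin (F.rank i) → A) (x : F.Idx) :
    F.vecEquiv A v x = v x.1 x.2 := rfl

/-- A basis element, as a family. -/
abbrev basisFam (A : Type*) [CommRing A] (x : F.Idx) : ∀ i, Fin (F.rank i) → A :=
  Pi.single (x.1 : ℕ) (Pi.single x.2 1)

theorem vecEquiv_basisFam (x : F.Idx) : F.vecEquiv A (F.basisFam A x) = Pi.single x 1 := by
  obtain ⟨i, j⟩ := x
  ext ⟨i', j'⟩
  rw [vecEquiv_apply]
  by_cases h : i' = i
  · subst h
    simp [Pi.single_apply, Sigma.ext_iff]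
  · rw [basisFam, Pi.single_eq_of_ne (by simpa [Fin.ext_iff] using h), Pi.single_eq_of_ne]
    · rfl
    · intro h'
      exact h (congrArg Sigma.fst h')

/-- The matrix of an endomorphism of the sum of the `A^(rank i)`. -/
def mat (Φ : (∀ i, Fin (F.rank i) → A) →ₗ[A] ∀ i, Fin (F.rank i) → A) : Matrix F.Idx F.Idx A :=
  Matrix.of fun x y => Φ (F.basisFam A x) y.1 y.2

theorem mat_apply (Φ : (∀ i, Fin (F.rank i) → A) →ₗ[A] ∀ i, Fin (F.rank i) → A) (x y : F.Idx) :
    F.mat Φ x y = Φ (F.basisFam A x) y.1 y.2 := rfl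

theorem vecMul_mat (Φ : (∀ i, Fin (F.rank i) → A) →ₗ[A] ∀ i, Fin (F.rank i) → A)
    (w : F.Idx → A) :
    Matrix.vecMul w (F.mat Φ) = F.vecEquiv A (Φ ((F.vecEquiv A).symm w)) := by
  have h : (F.mat Φ).vecMulLinear =
      (F.vecEquiv A).toLinearMap ∘ₗ Φ ∘ₗ (F.vecEquiv A).symm.toLinearMap := by
    refine LinearMap.pi_ext' fun x => LinearMap.ext_ring ?_
    simp only [LinearMap.comp_apply, LinearMap.single_apply, LinearEquiv.coe_coe,
      Matrix.vecMulLinear_apply, Matrix.single_one_vecMul]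
    rw [← F.vecEquiv_basisFam, LinearEquiv.symm_apply_apply]
    rfl
  exact LinearMap.congr_fun h w

theorem ext_vecMul {ι A : Type*} [Fintype ι] [DecidableEq ι] [CommRing A] {X Y : Matrix ι ι A}
    (h : ∀ w, Matrix.vecMul w X = Matrix.vecMul w Y) : X = Y := by
  ext x y
  have := congrFun (h (Pi.single x 1)) y
  simpa using this

/-- The rows of `F.mat Φ` are the images of the basis elements, so matrices act on row vectors from
the right and the order of composition is reversed. -/
theorem mat_mul (Φ Ψ : (∀ i, Fin (F.rank i) → A) →ₗ[A] ∀ i, Fin (F.rank i) → A) :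
    F.mat Φ * F.mat Ψ = F.mat (Ψ ∘ₗ Φ) :=
  ext_vecMul fun w => by
    rw [← Matrix.vecMul_vecMul, vecMul_mat, vecMul_mat, vecMul_mat, LinearEquiv.symm_apply_apply]
    rfl

theorem mat_add (Φ Ψ : (∀ i, Fin (F.rank i) → A) →ₗ[A] ∀ i, Fin (F.rank i) → A) :
    F.mat Φ + F.mat Ψ = F.mat (Φ + Ψ) := rfl

theorem mat_id : F.mat (LinearMap.id : (∀ i, Fin (F.rank i) → A) →ₗ[A] _) = 1 :=
  ext_vecMul fun w => by rw [vecMul_mat, Matrix.vecMul_one]; rfl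

theorem mat_zero : F.mat (0 : (∀ i, Fin (F.rank i) → A) →ₗ[A] _) = 0 := rfl

theorem exists_mat_eq (X : Matrix F.Idx F.Idx A) : ∃ Φ, F.mat Φ = X := by
  refine ⟨(F.vecEquiv A).symm.toLinearMap ∘ₗ X.vecMulLinear ∘ₗ (F.vecEquiv A).toLinearMap,
    ext_vecMul fun w => ?_⟩
  rw [vecMul_mat]
  simp

theorem mat_injective : Function.Injective (F.mat (A := A)) := by
  intro Φ Ψ h
  refine LinearMap.ext fun v => ?_
  have h1 := congrArg (Matrix.vecMul (F.vecEquiv A v)) h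
  rw [vecMul_mat, vecMul_mat, LinearEquiv.symm_apply_apply] at h1
  exact (F.vecEquiv A).injective h1

/-- The endomorphism given by maps `A^(rank (i + 1)) → A^(rank i)`. -/
def lower (T : ∀ i, (Fin (F.rank (i + 1)) → A) →ₗ[A] (Fin (F.rank i) → A)) :
    (∀ i, Fin (F.rank i) → A) →ₗ[A] ∀ i, Fin (F.rank i) → A :=
  LinearMap.pi fun i => T i ∘ₗ LinearMap.proj (i + 1)

theorem lower_apply (T : ∀ i, (Fin (F.rank (i + 1)) → A) →ₗ[A] (Fin (F.rank i) → A))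
    (v : ∀ i, Fin (F.rank i) → A) (i : ℕ) : F.lower T v i = T i (v (i + 1)) := rfl

/-- The endomorphism given by maps `A^(rank i) → A^(rank (i + 1))`. -/
def raise (h : ∀ i, (Fin (F.rank i) → A) →ₗ[A] (Fin (F.rank (i + 1)) → A)) :
    (∀ i, Fin (F.rank i) → A) →ₗ[A] ∀ i, Fin (F.rank i) → A :=
  LinearMap.pi fun
    | 0 => 0
    | i + 1 => h i ∘ₗ LinearMap.proj i

theorem raise_zero (h : ∀ i, (Fin (F.rank i) → A) →ₗ[A] (Fin (F.rank (i + 1)) → A))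
    (v : ∀ i, Fin (F.rank i) → A) : F.raise h v 0 = 0 := rfl

theorem raise_succ (h : ∀ i, (Fin (F.rank i) → A) →ₗ[A] (Fin (F.rank (i + 1)) → A))
    (v : ∀ i, Fin (F.rank i) → A) (i : ℕ) : F.raise h v (i + 1) = h i (v i) := rfl

theorem homDeg_mat_lower (T : ∀ i, (Fin (F.rank (i + 1)) → A) →ₗ[A] (Fin (F.rank i) → A)) :
    HomDeg F.deg (-1) (F.mat (F.lower T)) := by
  intro x y h
  rw [mat_apply, lower_apply] at h
  by_contra hne
  have : (y.1 : ℕ) + 1 ≠ x.1 := fun h' => hne (by simp only [deg]; omega)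
  rw [basisFam, Pi.single_eq_of_ne this, map_zero] at h
  exact h rfl

theorem homDeg_mat_raise (h : ∀ i, (Fin (F.rank i) → A) →ₗ[A] (Fin (F.rank (i + 1)) → A)) :
    HomDeg F.deg 1 (F.mat (F.raise h)) := by
  intro x y hxy
  obtain ⟨⟨_ | k, hk⟩, j⟩ := y
  · exact absurd rfl hxy
  · rw [mat_apply] at hxy
    by_contra hne
    have : k ≠ x.1 := fun h' => hne (by simp only [deg]; omega)
    change h k (F.basisFam A x k) j ≠ 0 at hxy
    rw [basisFam, Pi.single_eq_of_ne this, map_zero] at hxy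
    exact hxy rfl

/-- A matrix of degree one is given by maps `A^(rank i) → A^(rank (i + 1))`. -/
theorem exists_mat_raise_eq {X : Matrix F.Idx F.Idx A} (hX : HomDeg F.deg 1 X) :
    ∃ h, F.mat (F.raise h) = X := by
  obtain ⟨Φ, rfl⟩ := F.exists_mat_eq X
  refine ⟨fun i => LinearMap.proj (i + 1) ∘ₗ Φ ∘ₗ LinearMap.single A (fun i => Fin (F.rank i) → A) i, ?_⟩
  ext x ⟨⟨k, hk⟩, j⟩
  rw [mat_apply]
  cases k with
  | zero =>
    rw [hX.apply_eq_zero (by simp only [deg]; omega)]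
    rfl
  | succ k =>
    change Φ (Pi.single k (F.basisFam A x k)) (k + 1) j = Φ (F.basisFam A x) (k + 1) j
    by_cases h : k = x.1
    · subst h
      rw [basisFam, Pi.single_eq_same]
    · have h1 := hX.apply_eq_zero (x := x) (y := ⟨⟨k + 1, hk⟩, j⟩) (by simp only [deg]; omega)
      rw [mat_apply] at h1
      rw [h1, basisFam, Pi.single_eq_of_ne h, Pi.single_zero, map_zero]
      rfl

end Vectors

/-- The differential of the resolution. -/
def diffMat : Matrix F.Idx F.Idx (GrpRing N) := F.mat (F.lower F.d)

/-- The augmentation, on the sum of all `F_i`. -/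
def totalAug : (F.Idx → GrpRing N) →ₗ[GrpRing N] M :=
  F.aug ∘ₗ LinearMap.proj 0 ∘ₗ (F.vecEquiv (GrpRing N)).symm.toLinearMap

theorem totalAug_apply (w : F.Idx → GrpRing N) :
    F.totalAug w = F.aug ((F.vecEquiv (GrpRing N)).symm w 0) := rfl

theorem gradedRes : GradedRes F.deg F.diffMat F.totalAug where
  hom := F.homDeg_mat_lower F.d
  sq := by
    rw [diffMat, mat_mul, ← mat_zero]
    congr 1
    refine LinearMap.ext fun v => funext fun i => ?_
    exact (F.exact_succ i).apply_apply_eq_zero _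
  surjective m := by
    obtain ⟨v, rfl⟩ := F.aug_surjective m
    refine ⟨F.vecEquiv _ (Pi.single 0 v), ?_⟩
    rw [totalAug_apply, LinearEquiv.symm_apply_apply, Pi.single_eq_same]
  aug_of_pos v hv := by
    rw [totalAug_apply]
    have : (F.vecEquiv (GrpRing N)).symm v 0 = 0 := funext fun j => hv _ rfl
    rw [this, map_zero]
  aug_vecMul v := by
    rw [diffMat, vecMul_mat, totalAug_apply, LinearEquiv.symm_apply_apply, lower_apply]
    exact F.exact_zero.apply_apply_eq_zero _
  exact_zero v hv hav := by
    obtain ⟨u, hu⟩ := (F.exact_zero _).mp hav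
    refine ⟨F.vecEquiv _ (Pi.single 1 u), fun x hx => ?_, ?_⟩
    · rw [vecEquiv_apply, Pi.single_eq_of_ne hx]
      rfl
    · rw [diffMat, vecMul_mat, LinearEquiv.symm_apply_apply]
      refine funext fun ⟨⟨k, hk⟩, j⟩ => ?_
      rw [vecEquiv_apply, lower_apply]
      cases k with
      | zero => exact congrFun hu j
      | succ k =>
        rw [hv _ (Nat.succ_ne_zero k), Pi.single_eq_of_ne (by simp), map_zero]
        rfl
  exact_succ n v hv hdv := by
    have h1 : F.d n ((F.vecEquiv (GrpRing N)).symm v (n + 1)) = 0 := by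
      rw [diffMat, vecMul_mat] at hdv
      have := (F.vecEquiv (GrpRing N)).injective (hdv.trans (map_zero _).symm)
      exact congrFun this n
    obtain ⟨u, hu⟩ := (F.exact_succ n _).mp h1
    refine ⟨F.vecEquiv _ (Pi.single (n + 2) u), fun x hx => ?_, ?_⟩
    · rw [vecEquiv_apply, Pi.single_eq_of_ne hx]
      rfl
    · rw [diffMat, vecMul_mat, LinearEquiv.symm_apply_apply]
      refine funext fun ⟨⟨k, hk⟩, j⟩ => ?_
      rw [vecEquiv_apply, lower_apply]
      by_cases h : k = n + 1
      · subst h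
        change F.d (n + 1) ((Pi.single (n + 2) u : ∀ i, Fin (F.rank i) → GrpRing N) (n + 2)) j = _
        rw [Pi.single_eq_same]
        exact congrFun hu j
      · rw [hv ⟨⟨k, hk⟩, j⟩ h]
        change F.d k ((Pi.single (n + 2) u : ∀ i, Fin (F.rank i) → GrpRing N) (k + 1)) j = 0
        rw [Pi.single_eq_of_ne (by omega), map_zero]
        rfl

theorem dHat_map (i : ℕ) (v : Fin (F.rank (i + 1)) → GrpRing N) :
    F.dHat p i (fun j => algebraMap (GrpRing N) (C0 p N) (v j)) =
      fun j => algebraMap (GrpRing N) (C0 p N) (F.d i v j) := by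
  ext1 j
  rw [dHat, Matrix.toLin'_apply, ← LinearMap.toMatrix'_mulVec (F.d i) v]
  simp [Matrix.mulVec, dotProduct]

theorem single_single_map {ι : Type*} [DecidableEq ι] {κ : ι → Type*} [∀ i, DecidableEq (κ i)]
    {A B : Type*} [CommRing A] [CommRing B] (φ : A →+* B) (i : ι) (j : κ i) (i' : ι) (j' : κ i') :
    (Pi.single i (Pi.single j 1) : ∀ i, κ i → B) i' j' =
      φ ((Pi.single i (Pi.single j 1) : ∀ i, κ i → A) i' j') := by
  by_cases h : i' = i
  · subst h
    rw [Pi.single_eq_same, Pi.single_eq_same]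
    simp only [Pi.single_apply, apply_ite φ, map_one, map_zero]
  · rw [Pi.single_eq_of_ne h, Pi.single_eq_of_ne h]
    simp

/-- `dHat` is defined through matrices acting on columns. The comparison is made on basis families,
whose entries come from the group ring. -/
theorem mat_lower_dHat :
    F.mat (F.lower (F.dHat p)) = F.diffMat.map (algebraMap (GrpRing N) (C0 p N)) := by
  ext1 x y
  rw [Matrix.map_apply, diffMat, mat_apply, mat_apply, lower_apply, lower_apply]
  have h : F.basisFam (C0 p N) x (y.1 + 1) =
      fun j => algebraMap (GrpRing N) (C0 p N) (F.basisFam (GrpRing N) x (y.1 + 1) j) :=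
    funext fun j => single_single_map _ _ _ _ _
  rw [h, dHat_map]

theorem Contraction.oddMatrix_eq {F : BasedResolution N M} (c : F.Contraction p) :
    c.oddMatrix = (F.diffMat.map (algebraMap (GrpRing N) (C0 p N)) +
      F.mat (F.raise c.h)).submatrix Subtype.val Subtype.val := by
  rw [← mat_lower_dHat]
  ext1 ⟨x, hx⟩ ⟨⟨⟨k, hk⟩, j⟩, hy⟩
  cases k with
  | zero => exact (add_zero _).symm
  | succ k => rfl

theorem Contraction.isContraction {F : BasedResolution N M} (c : F.Contraction p) :
    IsContraction F.deg (F.diffMat.map (algebraMap (GrpRing N) (C0 p N)))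
      (F.mat (F.raise c.h)) := by
  refine ⟨F.homDeg_mat_raise c.h, ?_⟩
  rw [← mat_lower_dHat, mat_mul, mat_mul, mat_add, ← mat_id]
  congr 1
  refine LinearMap.ext fun v => funext fun i => ?_
  cases i with
  | zero => exact (zero_add _).trans (LinearMap.congr_fun c.zero (v 0))
  | succ k => exact (add_comm _ _).trans (LinearMap.congr_fun (c.succ k) (v (k + 1)))

theorem exists_contraction {H : Matrix F.Idx F.Idx (C0 p N)}
    (hH : IsContraction F.deg (F.diffMat.map (algebraMap (GrpRing N) (C0 p N))) H) :
    Nonempty (F.Contraction p) := by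
  obtain ⟨h, rfl⟩ := F.exists_mat_raise_eq hH.hom
  have h1 := hH.eq_one
  rw [← mat_lower_dHat, mat_mul, mat_mul, mat_add, ← mat_id] at h1
  have h2 : ∀ v i, (F.raise h (F.lower (F.dHat p) v) + F.lower (F.dHat p) (F.raise h v)) i = v i :=
    fun v i => congrFun (LinearMap.congr_fun (F.mat_injective h1) v) i
  refine ⟨⟨h, ?_, fun i => ?_⟩⟩
  · refine LinearMap.ext fun v => ?_
    have h3 := h2 (Pi.single 0 v) 0
    rw [Pi.add_apply, raise_zero, zero_add, lower_apply, raise_succ, Pi.single_eq_same] at h3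
    exact h3
  · refine LinearMap.ext fun v => ?_
    have h3 := h2 (Pi.single (i + 1) v) (i + 1)
    rw [Pi.add_apply, raise_succ, lower_apply, lower_apply, raise_succ, Pi.single_eq_same] at h3
    exact (add_comm _ _).trans h3

/-- The two orderings enter the determinant only through the bijection between odd and even basis
elements which they induce. -/
theorem Contraction.det_submatrix_oddMatrix {F : BasedResolution N M} (c : F.Contraction p) {r : ℕ}
    (eo : F.OddIdx ≃ Fin r) (ee : F.EvenIdx ≃ Fin r) :
    (c.oddMatrix.submatrix eo.symm ee.symm).det =
      blockDet (fun x => Odd (F.deg x)) (fun x => Even (F.deg x)) (eo.trans ee.symm)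
        (F.diffMat.map (algebraMap (GrpRing N) (C0 p N)) + F.mat (F.raise c.h)) := by
  rw [blockDet_reindex _ eo, c.oddMatrix_eq, Matrix.submatrix_submatrix]
  congr 1
  ext1 i j
  simp

/-- The torsion of a based resolution of a `p`-adically expansive module is defined. -/
theorem exists_isTorsion (hfin : Module.Finite (GrpRing N) M) (hT : IsSpTorsion p N M) :
    ∃ t : KT p N, F.IsTorsion t := by
  obtain ⟨s, hs, hsM⟩ := exists_mem_Sp_smul_eq_zero hT
  obtain ⟨H, hH⟩ := F.gradedRes.exists_contraction hsM (algebraMap (GrpRing N) (C0 p N))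
    (mem_Sp.mp hs)
  obtain ⟨c⟩ := F.exists_contraction hH
  have hD : HomDeg F.deg (-1) (F.diffMat.map (algebraMap (GrpRing N) (C0 p N))) :=
    F.gradedRes.hom.map _
  have hDD : F.diffMat.map (algebraMap (GrpRing N) (C0 p N)) *
      F.diffMat.map (algebraMap (GrpRing N) (C0 p N)) = 0 := by
    rw [← Matrix.map_mul, F.gradedRes.sq, Matrix.map_zero _ (map_zero _)]
  -- Equality of the odd and even ranks, needed to order both bases by the same `Fin r`.
  obtain ⟨e⟩ := nonempty_odd_equiv_even hD hDD c.isContraction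
  let eo : F.OddIdx ≃ Fin (Nat.card F.OddIdx) := Finite.equivFin _
  let ee : F.EvenIdx ≃ Fin (Nat.card F.OddIdx) := e.symm.trans eo
  have hu : IsUnit (c.oddMatrix.submatrix eo.symm ee.symm) := by
    rw [Matrix.isUnit_iff_isUnit_det, c.det_submatrix_oddMatrix]
    exact blockDet_isUnit hD hDD c.isContraction _
  exact ⟨_, c, _, eo, ee, hu.unit, rfl, rfl⟩

end BasedResolution

/-! ### Comparison of the two invariants -/

section Comparison

variable {p : ℕ} [Fact p.Prime] {N : ℕ}

theorem locToC0_comp_algebraMap :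
    (locToC0 p N).comp (algebraMap (GrpRing N) (Loc p N)) = algebraMap (GrpRing N) (C0 p N) :=
  RingHom.ext locToC0_algebraMap

theorem map_ofUnit_mem_trivialUnits (x : (GrpRing N)ˣ) :
    K1.map (locToC0 p N) (K1.ofUnit (Units.map (algebraMap (GrpRing N) (Loc p N)).toMonoidHom x)) ∈
      trivialUnits p N := by
  have h : locToKT p N (QuotientGroup.mk
      (K1.ofUnit (Units.map (algebraMap (GrpRing N) (Loc p N)).toMonoidHom x))) = 1 := by
    refine (congrArg (locToKT p N) ?_).trans (map_one _)
    exact (QuotientGroup.eq_one_iff _).mpr (show _ ∈ unitsInK1 p N from ⟨x, rfl⟩)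
  exact (QuotientGroup.eq_one_iff _).mp h

/-- The logarithmic determinant does not depend on the preimage under the boundary map. -/
theorem logDetKT_locToKT_eq {ξ η : K1 (Loc p N) ⧸ unitsInK1 p N}
    (h : deltaBar.{u} p N ξ = deltaBar.{u} p N η) :
    logDetKT (locToKT p N ξ) = logDetKT (locToKT p N η) := by
  obtain ⟨ξ, rfl⟩ := QuotientGroup.mk_surjective ξ
  obtain ⟨η, rfl⟩ := QuotientGroup.mk_surjective η
  have h1 : delta.{u} p N (ξ * η⁻¹) = 1 := by
    rw [map_mul, map_inv, mul_inv_eq_one]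
    exact h
  -- The determinants of `ξ` and `η` differ by a unit of `R`, whose image in `K₁(c₀(Γ))` lies in `⟨±
  -- Γ⟩`.
  obtain ⟨x, hx⟩ := det_mem_of_delta_eq_one h1
  refine logDetKT_eq_of_det (map_ofUnit_mem_trivialUnits (p := p) x) ?_
  ext1
  rw [← map_mul, ← map_mul, K1.det_map, K1.det_map, map_mul, K1.det_ofUnit, ← hx, ← map_mul,
    inv_mul_cancel_right]

/-- The torsion of a based resolution is the image of a preimage of `[M]` under the boundary map,
up to the kernel of the determinant. -/
theorem BasedResolution.IsTorsion.exists_logDetKT_eq {M : TorsMod.{u} p N}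
    {F : BasedResolution N M.carrier} {t : KT p N} (ht : F.IsTorsion t) :
    ∃ ξ, deltaBar.{u} p N ξ = Multiplicative.ofAdd (K0.cls M) ∧
      logDetKT (locToKT p N ξ) = logDetKT t := by
  obtain ⟨c, r, eo, ee, g, hg, rfl⟩ := ht
  obtain ⟨s, hs, hsM⟩ := exists_mem_Sp_smul_eq_zero M.torsion
  obtain ⟨H, hH⟩ := F.gradedRes.exists_contraction hsM (algebraMap (GrpRing N) (Loc p N))
    (IsLocalization.map_units _ ⟨s, hs⟩)
  -- Using the bijection given by the orderings in the torsion makes the determinants agree exactly,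
  -- without a sign.
  obtain ⟨ξ, hξ, hdet⟩ := exists_delta_eq_cls_and_det_eq F.len F.deg F.diffMat M F.totalAug
    F.gradedRes (fun x => x.1.2.le) H hH (eo.trans ee.symm)
  refine ⟨QuotientGroup.mk ξ, hξ, ?_⟩
  refine logDetKT_eq_of_det (one_mem _) ?_
  rw [map_one, one_mul]
  ext1
  have hD : (F.diffMat.map (algebraMap (GrpRing N) (Loc p N))).map (locToC0 p N) =
      F.diffMat.map (algebraMap (GrpRing N) (C0 p N)) := by
    rw [Matrix.map_map, ← RingHom.coe_comp, locToC0_comp_algebraMap]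
  have hDD : F.diffMat.map (algebraMap (GrpRing N) (C0 p N)) *
      F.diffMat.map (algebraMap (GrpRing N) (C0 p N)) = 0 := by
    rw [← Matrix.map_mul, F.gradedRes.sq, Matrix.map_zero _ (map_zero _)]
  have hH' := hH.map (locToC0 p N)
  rw [hD] at hH'
  -- The contraction over the localization and the given one over `c₀(Γ)` need not be related;
  -- independence of the contraction compares them.
  rw [K1.det_map, hdet, ← blockDet_map, Matrix.map_add _ (map_add _), hD,
    blockDet_odd_eq (F.gradedRes.hom.map _) hDD hH' c.isContraction, ← c.det_submatrix_oddMatrix,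
    ← hg]
  simp only [K1.det, K1.lift_mk]
  rfl

end Comparison

end

end PadicDet

theorem proposition5p4 (p : ℕ) [Fact p.Prime] (N : ℕ)
    (M : Type*) [AddCommGroup M] [Module (PadicDet.GrpRing N) M]
    (hM : PadicDet.IsPadicallyExpansive p N M) :
    -- the `p`-adic `R`-torsion of `M` is defined and independent of the based resolution
    Nonempty (PadicDet.BasedResolution N M) ∧
    (∀ F : PadicDet.BasedResolution N M,
      (∃ t : PadicDet.KT p N, F.IsTorsion t) ∧
      ∀ t : PadicDet.KT p N, F.IsTorsion t →
        ∀ q : ℚ_[p], PadicDet.HasLogDet t q ↔ q = PadicDet.padicRTorsion p N M) ∧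
    -- `M` is an object of the category of finitely generated `S_p`-torsion modules
    ∃ hT : PadicDet.IsSpTorsion p N M,
      -- the class `[M]` is in the image of the boundary map and `log_p det_Γ [M]` is well defined
      (∃ ξ, PadicDet.deltaBar p N ξ = Multiplicative.ofAdd (PadicDet.classOf M hM hT)) ∧
      (∀ ξ, PadicDet.deltaBar p N ξ = Multiplicative.ofAdd (PadicDet.classOf M hM hT) →
        ∀ q : ℚ_[p], PadicDet.HasLogDet (PadicDet.locToKT p N ξ) q ↔
          q = PadicDet.logDetK0 (PadicDet.classOf M hM hT)) ∧
      -- the two invariants agree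
      PadicDet.logDetK0 (PadicDet.classOf M hM hT) = PadicDet.padicRTorsion p N M := by
  have hfin := hM.finite
  have hT := hM.isSpTorsion
  have hres : Nonempty (PadicDet.BasedResolution N M) := PadicDet.nonempty_basedResolution M
  have hcomp : ∀ (F : PadicDet.BasedResolution N M) (t : PadicDet.KT p N), F.IsTorsion t →
      ∃ ξ, PadicDet.deltaBar p N ξ = Multiplicative.ofAdd (PadicDet.classOf M hM hT) ∧
        PadicDet.logDetKT (PadicDet.locToKT p N ξ) = PadicDet.logDetKT t := fun F t ht =>
    PadicDet.BasedResolution.IsTorsion.exists_logDetKT_eq (M := ⟨M, hT⟩) ht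
  have hex : ∃ t : PadicDet.KT p N, ∃ F : PadicDet.BasedResolution N M, F.IsTorsion t := by
    obtain ⟨F⟩ := hres
    obtain ⟨t, ht⟩ := F.exists_isTorsion hfin hT
    exact ⟨t, F, ht⟩
  have htor : PadicDet.padicRTorsion p N M = PadicDet.logDetKT hex.choose := by
    rw [PadicDet.padicRTorsion, dif_pos hex]
  obtain ⟨F₀, hF₀⟩ := hex.choose_spec
  obtain ⟨ξ₀, hξ₀, hlog₀⟩ := hcomp F₀ _ hF₀
  -- `clp` is a right inverse on the image of `δ̄`, and `[M]` lies in this image. Injectivity of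
  -- `δ̄` is not needed, because the logarithmic determinant is constant on its fibres.
  have hclp : PadicDet.deltaBar p N (PadicDet.clp (PadicDet.classOf M hM hT)) =
      Multiplicative.ofAdd (PadicDet.classOf M hM hT) :=
    Function.invFun_eq ⟨ξ₀, hξ₀⟩
  have hK0 : PadicDet.logDetK0 (PadicDet.classOf M hM hT) = PadicDet.padicRTorsion p N M := by
    rw [PadicDet.logDetK0, htor, ← hlog₀]
    exact PadicDet.logDetKT_locToKT_eq (hclp.trans hξ₀.symm)
  refine ⟨hres, fun F => ⟨F.exists_isTorsion hfin hT, fun t ht q => ?_⟩, hT, ⟨ξ₀, hξ₀⟩,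
    fun ξ hξ q => ?_, hK0⟩
  -- An arbitrary torsion and the chosen one both come from preimages of `[M]`, so their values
  -- agree.
  · obtain ⟨ξ, hξ, hlog⟩ := hcomp F t ht
    rw [PadicDet.hasLogDet_iff, htor, ← hlog₀, ← hlog,
      PadicDet.logDetKT_locToKT_eq (hξ.trans hξ₀.symm)]
  · rw [PadicDet.hasLogDet_iff, hK0, htor, ← hlog₀,
      PadicDet.logDetKT_locToKT_eq (hξ.trans hξ₀.symm)]
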